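/- **Setting.** Work on a coordinate patch of $\mathrm{OSP}(1|2)$ with bosonic coordinates $(\varphi,y,u)\in\mathbb R^3$ and fermionic coordinates $(\psi,\chi)$. Superfunctions are polynomials in $\psi,\chi$ whose coefficients are smooth functions of $(\varphi,y,u)$ with values in the supernumbers (the real Grassmann algebra on countably many odd generators, infinite formal sums allowed). DeWitt's conventions are used: an index in an exponent of $-1$ stands for its parity, $dx^\mu dx^\nu=(-1)^{\mu\nu}dx^\nu dx^\mu$, $dx^\mu\wedge dx^\nu=-(-1)^{\mu\nu}dx^\nu\wedge dx^\mu$, $ds^2=(-1)^{\mu\nu}G_{\mu\nu}dx^\mu dx^\nu$, $B=\frac{(-1)^{\mu\nu}}2B_{\mu\nu}dx^\mu\wedge dx^\nu$, $H=dB$. **Backgrounds.** Let $\eta,\tilde A,\kappa\in\mathbb R$. The Yang–Baxter deformed backgrounds of the $\mathrm{OSP}(1|2)$ WZW model, one for each of the classical r-matrices $r_{i,\epsilon}=\epsilon H\wedge X_-$, $r_{ii,\epsilon}=\epsilon(H\wedge X_--Q_-\wedge Q_-)$ ($\epsilon=\pm1$) and $r_\omega=H\wedge X_+-Q_+\wedge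 Q_++\omega(H\wedge X_--Q_-\wedge Q_-)$ ($\omega\in\mathbb{R}\setminus\{0\}$), are the following. * $\mathrm{OSP}(1|2)_{i,\epsilon}$ and $\mathrm{OSP}(1|2)_{ii,\epsilon}$ have the common metric $$ds^2=\tfrac12d\varphi^2-\tfrac{\eta^2}2e^{-2\varphi}dy^2+2e^{-\varphi}dy\,du-\tfrac{\eta^2}4e^{-2\varphi}\psi\,dy\,d\psi+\tfrac12e^{-\varphi}\chi\,dy\,d\chi+\tfrac12e^{-\varphi}\psi\,du\,d\psi-\big(e^{-\varphi/2}+\tfrac18e^{-\varphi}\psi\chi\big)d\psi\,d\chi ,$$ and, with $s=+1$ in case $i$ and $s=-1$ in case $ii$, $$B=-\kappa e^{-\varphi}dy\wedge du-\tfrac{\epsilon\tilde A}2e^{-\varphi}d\varphi\wedge dy-\tfrac{\epsilon\tilde A}8e^{-\varphi}\psi\,d\varphi\wedge d\psi-\tfrac\kappa4e^{-\varphi}\chi\,dy\wedge d\chi+\tfrac\kappa4e^{-\varphi}\psi\,du\wedge d\psi+\tfrac\kappa2\big(e^{-\varphi/2}+\tfrac18e^{-\varphi}\psi\chi\big)d\psi\wedge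 d\chi+\tfrac{s\,\epsilon\tilde A}4e^{-3\varphi/2}\chi\,dy\wedge d\psi+b\,d\psi\wedge d\psi ,$$ where $b=-\frac{\epsilon\tilde A}{16}e^{-3\varphi/2}\psi\chi$ in case $i$ and $b=\frac{\epsilon\tilde A}4e^{-\varphi}\big(1+\frac14e^{-\varphi/2}\psi\chi\big)$ in case $ii$. * $\mathrm{OSP}(1|2)_\omega$: with $q=\omega+u^2$, $$\begin{aligned}ds^2={}&\tfrac12(1-\eta^2u^2)d\varphi^2-\tfrac{\eta^2}2q^2e^{-2\varphi}dy^2-\tfrac{\eta^2}2du^2+\eta^2u\,d\varphi\,du-\eta^2q\,u\,e^{-\varphi}d\varphi\,dy+(2+\eta^2q)e^{-\varphi}dy\,du\\&+\tfrac12\big[(1+\tfrac{\eta^2}2q)e^{-\varphi}\psi+\eta^2e^{-\varphi/2}u\chi\big]du\,d\psi+\tfrac12\big(1-\tfrac{\eta^2}2q\big)e^{-\varphi}\chi\,dy\,d\chi-\tfrac{\eta^2}4q\big[q\,e^{-2\varphi}\psi+2e^{-3\varphi/2}u\chi\big]dy\,d\psi\\&-\tfrac{\eta^2}2\big[u\,e^{-\varphi/2}\chi+\tfrac12q\,e^{-\varphi}\psi\big]u\,d\varphi\,d\psi-\tfrac{\eta^2}4u\chi\,d\varphi\,d\chi+\tfrac{\eta^2}4\chi\,du\,d\chi-\big[e^{-\varphi/2}+\tfrac18e^{-\varphi}\psi\chi-\tfrac{\eta^2}{16}q\,e^{-\varphi}\psi\chi\big]d\psi\,d\chi,\end{aligned}$$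 $$\begin{aligned}B={}&-\tfrac{\tilde A}2q\,e^{-\varphi}d\varphi\wedge dy-\tfrac{\tilde A}2d\varphi\wedge du-\tfrac{\tilde A}4\big[u\,e^{-\varphi/2}\chi+\tfrac12e^{-\varphi}q\psi\big]d\varphi\wedge d\psi-(\kappa+\tilde Au)e^{-\varphi}dy\wedge du-\tfrac{\tilde A}4q\,e^{-3\varphi/2}\chi\,dy\wedge d\psi\\&-\tfrac14(\kappa+\tilde Au)e^{-\varphi}\chi\,dy\wedge d\chi-\tfrac{\tilde A}8\chi\,d\varphi\wedge d\chi+\tfrac14\big[\kappa e^{-\varphi}\psi+\tilde A(u\,e^{-\varphi}\psi+e^{-\varphi/2}\chi)\big]du\wedge d\psi+\tfrac{\tilde A}4d\chi\wedge d\chi\\&+\tfrac12(\kappa+\tilde Au)\big(e^{-\varphi/2}+\tfrac18e^{-\varphi}\psi\chi\big)d\psi\wedge d\chi+\tfrac{\tilde A}4q\big(e^{-\varphi}+\tfrac14e^{-3\varphi/2}\psi\chi\big)d\psi\wedge d\psi.\end{aligned}$$ **Equations.** The graded generalized supergravity equations (without Ramond–Ramond fields) for an even supervector field $I$, even super one-forms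 $Z$ and $X$ with $X_\mu=I_\mu+Z_\mu$, and a cosmological constant $\Lambda$ (a $c$-number) are $$\mathcal R_{\mu\nu}+\tfrac14H_{\mu\rho\sigma}H^{\sigma\rho}{}_\nu+\nabla_\mu X_\nu+(-1)^{\mu\nu}\nabla_\nu X_\mu=0,$$ $$\tfrac12(-1)^\lambda\nabla^\lambda H_{\lambda\mu\nu}-(-1)^\lambda X^\lambda H_{\lambda\mu\nu}-\nabla_\mu X_\nu+(-1)^{\mu\nu}\nabla_\nu X_\mu=0,$$ $$-4\Lambda+\mathcal R+\tfrac1{12}H_{\mu\nu\rho}H^{\rho\nu\mu}+4\nabla_\mu X^\mu-4X_\mu X^\mu=0,$$ $$\mathcal L_IG_{\mu\nu}=0,\qquad\mathcal L_IB_{\mu\nu}=0,$$ $$\nabla_\mu Z_\nu-(-1)^{\mu\nu}\nabla_\nu Z_\mu+(-1)^\lambda I^\lambda H_{\lambda\mu\nu}=0,\qquad(-1)^\lambda I^\lambda Z_\lambda=0,$$ where $\nabla$, $\mathcal R_{\mu\nu}$, $\mathcal R$ are the Levi-Civita connection, Ricci tensor and scalar curvature of $G$. The two Lie-derivative equations say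 that $I$ is a Killing supervector field of the background; every even linear combination of Killing supervectors with $c$- and $a$-number coefficients is such an $I$. **Theorem.** Let $\eta,\tilde A,\kappa\in\mathbb R$ with $(\eta,\tilde A,\kappa^2)\neq(0,0,1)$; in particular $(\eta,\tilde A)$ may be any pair other than $(0,0)$, with $\kappa$ arbitrary. For each of the backgrounds $\mathrm{OSP}(1|2)_{i,\epsilon}$, $\mathrm{OSP}(1|2)_{ii,\epsilon}$ ($\epsilon=\pm1$) and $\mathrm{OSP}(1|2)_\omega$ ($\omega\ne0$, $1+\omega\eta^2\neq0$) the supermetric is non-degenerate, and over no non-empty open set of values of $(\varphi,y,u)$ do there exist smooth $I$, $Z$, $X=I+Z$ and $\Lambda$ as above that satisfy all of these equations. (In particular there are none with $Z_\mu=(-1)^\mu\partial_\mu\Phi+(-1)^\lambda I^\lambda B_{\lambda\mu}$ for a dilaton $\Phi$.) -/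

import Mathlib

noncomputable section

namespace OSp

/-! ### Superfunctions

The coordinate patch has bosonic coordinates `(φ, y, u)` and fermionic coordinates `ψ, χ`.
A superfunction is a function of the real variables `(φ, y, u)` with values in the real Grassmann
algebra on countably many odd generators `θ 0, θ 1, θ 2, ...`, infinite formal sums allowed.
Here `θ 0 = ψ` and `θ 1 = χ` are the odd coordinates and `θ 2, θ 3, ...` are the auxiliary odd
constants that generate the supernumbers. -/

/-- A superfunction `f = ∑ S, f S * θ S`, where `S = {s₁ < ... < s_k}` is a finite set of indices,
`θ S = θ s₁ * ... * θ s_k`, and the coefficient `f S` is a function of `x = (φ, y, u)`. -/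
def SuperFun : Type := Finset ℕ → (Fin 3 → ℝ) → ℝ

instance : AddCommGroup SuperFun :=
  inferInstanceAs (AddCommGroup (Finset ℕ → (Fin 3 → ℝ) → ℝ))

instance : Module ℝ SuperFun :=
  inferInstanceAs (Module ℝ (Finset ℕ → (Fin 3 → ℝ) → ℝ))

/-- The coefficient of `θ S` in `f`, at the point `x`. -/
def coeff (f : SuperFun) (S : Finset ℕ) (x : Fin 3 → ℝ) : ℝ := f S x

/-- The sign `(-1) ^ n`. -/
def sgn (n : ℕ) : ℝ := (-1) ^ n

/-- The number of pairs `b < a` with `a ∈ S`, `b ∈ T`: for disjoint `S`, `T` one has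
`θ S * θ T = (-1) ^ inversions S T * θ (S ∪ T)`. -/
def inversions (S T : Finset ℕ) : ℕ := ((S ×ˢ T).filter fun p => p.2 < p.1).card

/-- The Grassmann product. -/
instance : Mul SuperFun :=
  ⟨fun f g S x => ∑ T ∈ S.powerset, sgn (inversions T (S \ T)) * (f T x * g (S \ T) x)⟩

/-- An ordinary function of `(φ, y, u)` as a superfunction. -/
def bos (f : (Fin 3 → ℝ) → ℝ) : SuperFun := fun S x => if S = ∅ then f x else 0

/-- The odd generator `θ n`. -/
def theta (n : ℕ) : SuperFun := fun S _ => if S = {n} then 1 else 0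

/-- The odd coordinate `ψ`. -/
def psi : SuperFun := theta 0

/-- The odd coordinate `χ`. -/
def chi : SuperFun := theta 1

/-- Partial derivative along the `i`-th bosonic coordinate. -/
def derivEven (i : Fin 3) (f : SuperFun) : SuperFun :=
  fun S x => fderiv ℝ (f S) x (Pi.single i 1)

/-- Left partial derivative along the odd generator `θ n`. -/
def derivOdd (n : ℕ) (f : SuperFun) : SuperFun :=
  fun S x => if n ∈ S then 0 else sgn (S.filter (· < n)).card * f (insert n S) x

/-- Equality of two superfunctions over the domain `U`. -/
def EqOver (U : Set (Fin 3 → ℝ)) (f g : SuperFun) : Prop :=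
  ∀ S, ∀ x ∈ U, coeff f S x = coeff g S x

/-- Smoothness over the domain `U`. -/
def Smooth (U : Set (Fin 3 → ℝ)) (f : SuperFun) : Prop :=
  ∀ S, ContDiffOn ℝ (⊤ : ℕ∞) (coeff f S) U

/-- Over `U` the superfunction is homogeneous of parity `p` mod 2. -/
def HasParity (U : Set (Fin 3 → ℝ)) (f : SuperFun) (p : ℕ) : Prop :=
  ∀ S, ∀ x ∈ U, coeff f S x ≠ 0 → S.card % 2 = p % 2

/-- A `c`-number: an even superfunction that depends neither on `(φ, y, u)` nor on `ψ, χ`. -/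
def IsCNumber (f : SuperFun) : Prop :=
  (∃ c : Finset ℕ → ℝ, ∀ S x, coeff f S x = c S) ∧
    (∀ S x, coeff f S x ≠ 0 → Even S.card ∧ 0 ∉ S ∧ 1 ∉ S)

/-! ### Tensor calculus on the supermanifold

Supercoordinates `x^0, ..., x^4 = φ, y, u, ψ, χ`. All tensors have their indices on the right, in
the conventions of DeWitt. In an array, the order of the arguments is the order of the indices,
read from left to right, the upper index of `christoffel` and `riemann` coming first. -/

/-- The parity of a coordinate index. -/
def par : Fin 5 → ℕ := ![0, 0, 0, 1, 1]

/-- Left partial derivative along the `μ`-th supercoordinate. -/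
def pd : Fin 5 → SuperFun → SuperFun :=
  ![derivEven 0, derivEven 1, derivEven 2, derivOdd 0, derivOdd 1]

/-- Right partial derivative along the `μ`-th supercoordinate of a superfunction of parity `p`. -/
def rpd (p : ℕ) (μ : Fin 5) (f : SuperFun) : SuperFun := sgn (par μ * (p + 1)) • pd μ f

/-- Components of a supervector (upper index) or super one-form (lower index). -/
abbrev Vec := Fin 5 → SuperFun

/-- Components of a tensor with two indices. -/
abbrev Ten2 := Fin 5 → Fin 5 → SuperFun

/-- Components of a tensor with three indices. -/
abbrev Ten3 := Fin 5 → Fin 5 → Fin 5 → SuperFun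

/-- An even supervector field or even super one-form, smooth over `U`: the component with index
`μ` has the parity of `μ`. -/
def IsEvenField (U : Set (Fin 3 → ℝ)) (V : Vec) : Prop :=
  ∀ μ, Smooth U (V μ) ∧ HasParity U (V μ) (par μ)

/-- The metric with line element `ds² = ∑_{i ≤ j} c i j dx^i dx^j`, where
`ds² = (-1)^{μν} G_{μν} dx^μ dx^ν`, `G_{μν} = (-1)^{μν} G_{νμ}` and
`dx^μ dx^ν = (-1)^{μν} dx^ν dx^μ`. Only the entries `c i j` with `i ≤ j` are used. -/
def ofLineElement (c : Ten2) : Ten2 := fun i j =>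
  if i = j then sgn (par i) • c i i
  else if i < j then ((1 / 2 : ℝ) * sgn (par i * par j)) • c i j
  else (1 / 2 : ℝ) • c j i

/-- The `B`-field `B = ∑_{i ≤ j} c i j dx^i ∧ dx^j`, where
`B = ((-1)^{μν} / 2) B_{μν} dx^μ ∧ dx^ν`, `B_{μν} = -(-1)^{μν} B_{νμ}` and
`dx^μ ∧ dx^ν = -(-1)^{μν} dx^ν ∧ dx^μ`. Only the entries `c i j` with `i ≤ j` are used. -/
def ofTwoForm (c : Ten2) : Ten2 := fun i j =>
  if i = j then (2 * sgn (par i)) • c i i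
  else if i < j then sgn (par i * par j) • c i j
  else -c j i

/-- `M = (G^{μν})` is the inverse over `U` of the supermetric `G`:
`(-1)^κ G_{κλ} G^{λμ} = δ_κ^μ` and `G^{κλ} (-1)^λ G_{λμ} = δ^κ_μ`. -/
def IsInverse (U : Set (Fin 3 → ℝ)) (G M : Ten2) : Prop :=
  (∀ κ μ, Smooth U (M κ μ)) ∧
  (∀ κ μ, EqOver U (∑ l, sgn (par κ) • (G κ l * M l μ)) (bos fun _ => if κ = μ then 1 else 0)) ∧
  (∀ κ μ, EqOver U (∑ l, sgn (par l) • (M κ l * G l μ)) (bos fun _ => if κ = μ then 1 else 0))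

/-- `Γ_{ijk} = ½ (G_{ij,k} + (-1)^{jk} G_{ik,j} - (-1)^{i(j+k)} G_{jk,i})`, right derivatives. -/
def christoffelLow (G : Ten2) : Ten3 := fun i j k => (1 / 2 : ℝ) •
  (rpd (par i + par j) k (G i j) + sgn (par j * par k) • rpd (par i + par k) j (G i k)
    - sgn (par i * (par j + par k)) • rpd (par j + par k) i (G j k))

/-- The Levi-Civita connection `Γ^l_{jk} = G^{li} (-1)^i Γ_{ijk}`. -/
def christoffel (G M : Ten2) : Ten3 := fun l j k =>
  ∑ i, sgn (par i) • (M l i * christoffelLow G i j k)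

/-- The curvature `R^m_{ijk} = -Γ^m_{ij,k} + (-1)^{jk} Γ^m_{ik,j}
+ (-1)^{j(i+l)} Γ^m_{lj} Γ^l_{ik} - (-1)^{k(i+j+l)} Γ^m_{lk} Γ^l_{ij}`, right derivatives. -/
def riemann (Γ : Ten3) (m i j k : Fin 5) : SuperFun :=
  sgn (par j * par k) • rpd (par m + par i + par k) j (Γ m i k)
    - rpd (par m + par i + par j) k (Γ m i j)
    + ∑ l, (sgn (par j * (par i + par l)) • (Γ m l j * Γ l i k)
        - sgn (par k * (par i + par j + par l)) • (Γ m l k * Γ l i j))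

/-- The Ricci tensor `R_{ij} = (-1)^{k(i+1)} R^k_{ikj}`. -/
def ricci (G M : Ten2) : Ten2 := fun i j =>
  ∑ k, sgn (par k * (par i + 1)) • riemann (christoffel G M) k i k j

/-- The contraction `T_{μν} G^{νμ}`. -/
def contract (M T : Ten2) : SuperFun := ∑ μ, ∑ ν, T μ ν * M ν μ

/-- The scalar curvature `R_{μν} G^{νμ}`. -/
def scalarCurv (G M : Ten2) : SuperFun := contract M (ricci G M)

/-- The flux `H = dB`. -/
def flux (B : Ten2) : Ten3 := fun μ ν ρ =>
  sgn (par μ) • pd μ (B ν ρ)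
    + sgn (par ν + par μ * (par ν + par ρ)) • pd ν (B ρ μ)
    + sgn (par ρ * (1 + par μ + par ν)) • pd ρ (B μ ν)

/-- `H^{σρ}_ν`. -/
def raise2 (M : Ten2) (H : Ten3) : Ten3 := fun σ ρ ν => ∑ a, ∑ b,
  sgn (par a + par b + par σ * (par ρ + par b)) • (M ρ b * (M σ a * H a b ν))

/-- `H^{σρτ}`. -/
def raise3 (M : Ten2) (H : Ten3) : Ten3 := fun σ ρ τ => ∑ ν,
  sgn (par ν + (par σ + par ρ) * (par τ + par ν)) • (M τ ν * raise2 M H σ ρ ν)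

/-- `∇_μ X_ν = (-1)^μ ∂_μ X_ν - X_σ Γ^σ_{μν}`, for the Levi-Civita connection. -/
def cov1 (G M : Ten2) (X : Vec) : Ten2 := fun μ ν =>
  sgn (par μ) • pd μ (X ν) - ∑ s, X s * christoffel G M s μ ν

/-- `∇_κ H_{lμν}`, for the connection `Γ`. -/
def cov3 (Γ H : Ten3) (κ l μ ν : Fin 5) : SuperFun :=
  sgn (par κ) • pd κ (H l μ ν) - sgn (par κ * (par l + par μ + par ν)) •
    ∑ s, (H l μ s * Γ s ν κ
      + sgn (par ν * (par μ + par s)) • (H l s ν * Γ s μ κ)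
      + sgn ((par μ + par ν) * (par l + par s)) • (H s μ ν * Γ s l κ))

/-- `(-1)^l ∇^l H_{lμν}`. -/
def divFlux (G M : Ten2) (H : Ten3) : Ten2 := fun μ ν => ∑ l, ∑ κ,
  sgn (par l + par κ) • (M l κ * cov3 (christoffel G M) H κ l μ ν)

/-- Lowering an index: `I_μ = (-1)^l I^l G_{lμ}`. -/
def lower (G : Ten2) (V : Vec) : Vec := fun μ => ∑ l, sgn (par l) • (V l * G l μ)

/-- Raising an index: `X^μ = X_l G^{lμ}`. -/
def raise (M : Ten2) (X : Vec) : Vec := fun μ => ∑ l, X l * M l μ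

/-- The Lie derivative of `T_{μν}` along the even supervector field `V`. -/
def lieDeriv (V : Vec) (T : Ten2) : Ten2 := fun μ ν => ∑ l,
  (sgn (par l + par μ) • (pd μ (V l) * T l ν) + V l * pd l (T μ ν)
    + sgn (par μ * par ν + par μ * par l + par l + par ν) • (pd ν (V l) * T μ l))

/-- The contraction `(-1)^l V^l H_{lμν}`. -/
def interior (V : Vec) (H : Ten3) : Ten2 := fun μ ν => ∑ l, sgn (par l) • (V l * H l μ ν)

/-- The contraction `(-1)^l V^l Z_l`. -/
def pairing (V Z : Vec) : SuperFun := ∑ l, sgn (par l) • (V l * Z l)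

/-- The graded generalized supergravity equations (without Ramond-Ramond fields) over the domain
`U`, for the metric `G` with inverse `M`, the `B`-field `B`, the supervector field `I`, the super
one-forms `X`, `Z` and the cosmological constant `Λ`. -/
structure IsSolution (U : Set (Fin 3 → ℝ)) (G M B : Ten2) (I X Z : Vec) (Λ : SuperFun) :
    Prop where
  /-- `R_{μν} + ¼ H_{μρσ} H^{σρ}_ν + ∇_μ X_ν + (-1)^{μν} ∇_ν X_μ = 0` -/
  metric_eq : ∀ μ ν, EqOver U
    (ricci G M μ ν + (1 / 4 : ℝ) • (∑ ρ, ∑ σ, flux B μ ρ σ * raise2 M (flux B) σ ρ ν)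
      + cov1 G M X μ ν + sgn (par μ * par ν) • cov1 G M X ν μ) 0
  /-- `½ (-1)^l ∇^l H_{lμν} - (-1)^l X^l H_{lμν} - ∇_μ X_ν + (-1)^{μν} ∇_ν X_μ = 0` -/
  flux_eq : ∀ μ ν, EqOver U
    ((1 / 2 : ℝ) • divFlux G M (flux B) μ ν - interior (raise M X) (flux B) μ ν
      - cov1 G M X μ ν + sgn (par μ * par ν) • cov1 G M X ν μ) 0
  /-- `-4 Λ + R + (1/12) H_{μνρ} H^{ρνμ} + 4 ∇_μ X^μ - 4 X_μ X^μ = 0` -/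
  scalar_eq : EqOver U
    (-((4 : ℝ) • Λ) + scalarCurv G M
      + (1 / 12 : ℝ) • (∑ μ, ∑ ν, ∑ ρ, flux B μ ν ρ * raise3 M (flux B) ρ ν μ)
      + (4 : ℝ) • contract M (cov1 G M X) - (4 : ℝ) • ∑ μ, X μ * raise M X μ) 0
  /-- `L_I G = 0` -/
  killing_metric : ∀ μ ν, EqOver U (lieDeriv I G μ ν) 0
  /-- `L_I B = 0` -/
  killing_bfield : ∀ μ ν, EqOver U (lieDeriv I B μ ν) 0
  /-- `∇_μ Z_ν - (-1)^{μν} ∇_ν Z_μ + (-1)^l I^l H_{lμν} = 0` -/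
  dZ_eq : ∀ μ ν, EqOver U
    (cov1 G M Z μ ν - sgn (par μ * par ν) • cov1 G M Z ν μ + interior I (flux B) μ ν) 0
  /-- `(-1)^l I^l Z_l = 0` -/
  pairing_eq : EqOver U (pairing I Z) 0

/-- Over `U`, the background `(G, B)` can be completed to a solution of the graded generalized
supergravity equations by an even supervector field `I`, even super one-forms `Z` and `X` with
`X_μ = I_μ + Z_μ`, and a cosmological constant `Λ`. -/
def Admits (U : Set (Fin 3 → ℝ)) (G B : Ten2) : Prop :=
  ∃ (M : Ten2) (I X Z : Vec) (Λ : SuperFun),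
    IsInverse U G M ∧ IsEvenField U I ∧ IsEvenField U X ∧ IsEvenField U Z ∧ IsCNumber Λ ∧
    (∀ μ, EqOver U (X μ) (lower G I μ + Z μ)) ∧ IsSolution U G M B I X Z Λ

/-- The supermetric `G` is smooth and has a smooth inverse on the whole coordinate patch. -/
def IsMetric (G : Ten2) : Prop :=
  (∀ μ ν, Smooth Set.univ (G μ ν)) ∧ ∃ M, IsInverse Set.univ G M

/-! ### The backgrounds

In the tables below row and column `0, ..., 4` stand for `φ, y, u, ψ, χ`; the entry in row `i` and
column `j` is the coefficient of `dx^i dx^j`, respectively `dx^i ∧ dx^j`. -/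

/-- The superfunction `c * exp (-n φ / 2)`. -/
def ex (c : ℝ) (n : ℕ) : SuperFun := bos fun x => c * Real.exp (-(n * x 0) / 2)

/-- The superfunction `p(u) * exp (-n φ / 2)`. -/
def exu (p : ℝ → ℝ) (n : ℕ) : SuperFun := bos fun x => p (x 2) * Real.exp (-(n * x 0) / 2)

/-- The metric of the backgrounds `OSP(1|2)_{i,ε}` and `OSP(1|2)_{ii,ε}`. -/
def metricI (η : ℝ) : Ten2 := ofLineElement
  ![![ex (1 / 2) 0, 0, 0, 0, 0],
    ![0, ex (-(η ^ 2 / 2)) 4, ex 2 2, ex (-(η ^ 2 / 4)) 4 * psi, ex (1 / 2) 2 * chi],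
    ![0, 0, 0, ex (1 / 2) 2 * psi, 0],
    ![0, 0, 0, 0, -(ex 1 1 + ex (1 / 8) 2 * (psi * chi))],
    ![0, 0, 0, 0, 0]]

/-- The `B`-field of the background `OSP(1|2)_{i,ε}`. -/
def bfieldI (ε A κ : ℝ) : Ten2 := ofTwoForm
  ![![0, ex (-(ε * A / 2)) 2, 0, ex (-(ε * A / 8)) 2 * psi, 0],
    ![0, 0, ex (-κ) 2, ex (ε * A / 4) 3 * chi, ex (-(κ / 4)) 2 * chi],
    ![0, 0, 0, ex (κ / 4) 2 * psi, 0],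
    ![0, 0, 0, ex (-(ε * A / 16)) 3 * (psi * chi), ex (κ / 2) 1 + ex (κ / 16) 2 * (psi * chi)],
    ![0, 0, 0, 0, 0]]

/-- The `B`-field of the background `OSP(1|2)_{ii,ε}`. -/
def bfieldII (ε A κ : ℝ) : Ten2 := ofTwoForm
  ![![0, ex (-(ε * A / 2)) 2, 0, ex (-(ε * A / 8)) 2 * psi, 0],
    ![0, 0, ex (-κ) 2, ex (-(ε * A / 4)) 3 * chi, ex (-(κ / 4)) 2 * chi],
    ![0, 0, 0, ex (κ / 4) 2 * psi, 0],
    ![0, 0, 0, ex (ε * A / 4) 2 + ex (ε * A / 16) 3 * (psi * chi),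
      ex (κ / 2) 1 + ex (κ / 16) 2 * (psi * chi)],
    ![0, 0, 0, 0, 0]]

/-- The metric of the background `OSP(1|2)_ω`. -/
def metricOmega (w η : ℝ) : Ten2 := ofLineElement
  ![![exu (fun u => 1 / 2 * (1 - η ^ 2 * u ^ 2)) 0,
      exu (fun u => -(η ^ 2 * (w + u ^ 2) * u)) 2,
      exu (fun u => η ^ 2 * u) 0,
      exu (fun u => -(η ^ 2 / 2 * u ^ 2)) 1 * chi
        + exu (fun u => -(η ^ 2 / 4 * (w + u ^ 2) * u)) 2 * psi,
      exu (fun u => -(η ^ 2 / 4 * u)) 0 * chi],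
    ![0,
      exu (fun u => -(η ^ 2 / 2 * (w + u ^ 2) ^ 2)) 4,
      exu (fun u => 2 + (w + u ^ 2) * η ^ 2) 2,
      exu (fun u => -(η ^ 2 / 4 * (w + u ^ 2) ^ 2)) 4 * psi
        + exu (fun u => -(η ^ 2 / 2 * (w + u ^ 2) * u)) 3 * chi,
      exu (fun u => 1 / 2 * (1 - η ^ 2 / 2 * (w + u ^ 2))) 2 * chi],
    ![0, 0,
      ex (-(η ^ 2 / 2)) 0,
      exu (fun u => 1 / 2 * (1 + η ^ 2 / 2 * (w + u ^ 2))) 2 * psi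
        + exu (fun u => η ^ 2 / 2 * u) 1 * chi,
      ex (η ^ 2 / 4) 0 * chi],
    ![0, 0, 0, 0,
      -(ex 1 1 + ex (1 / 8) 2 * (psi * chi)
        - exu (fun u => η ^ 2 / 16 * (w + u ^ 2)) 2 * (psi * chi))],
    ![0, 0, 0, 0, 0]]

/-- The `B`-field of the background `OSP(1|2)_ω`. -/
def bfieldOmega (w A κ : ℝ) : Ten2 := ofTwoForm
  ![![0,
      exu (fun u => -(A / 2 * (w + u ^ 2))) 2,
      ex (-(A / 2)) 0,
      exu (fun u => -(A / 4 * u)) 1 * chi + exu (fun u => -(A / 8 * (w + u ^ 2))) 2 * psi,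
      ex (-(A / 8)) 0 * chi],
    ![0, 0,
      exu (fun u => -(κ + A * u)) 2,
      exu (fun u => -(A / 4 * (w + u ^ 2))) 3 * chi,
      exu (fun u => -(1 / 4 * (κ + A * u))) 2 * chi],
    ![0, 0, 0,
      exu (fun u => 1 / 4 * (κ + A * u)) 2 * psi + ex (A / 4) 1 * chi,
      0],
    ![0, 0, 0,
      exu (fun u => A / 4 * (w + u ^ 2)) 2 + exu (fun u => A / 16 * (w + u ^ 2)) 3 * (psi * chi),
      exu (fun u => 1 / 2 * (κ + A * u)) 1 + exu (fun u => 1 / 16 * (κ + A * u)) 2 * (psi * chi)],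
    ![0, 0, 0, 0, ex (A / 4) 0]]

end OSp

end

namespace OSp

/-! ### Formal polynomials -/

/-! Setting the auxiliary generators `θ 2, θ 3, ...` to zero is a homomorphism onto the Grassmann
algebra of `ψ, χ` and commutes with the coordinate derivatives. So only the coefficients of `1, ψ,
χ, ψχ` need to be considered, and a contradiction among them suffices.

All backgrounds belong to one family with `q = b + a u²` and `g = η²`: `a = 1, b = ω` for the third,
`a = 0` with `b = ε` in case ii and `b = -ε` in case i. (In case i only the flux agrees with the
family, not the `B`-field.) Everything is homogeneous under a shift of `φ` combined with a rescaling
of `y` and `ψ`. Hence each component is a power of `exp (-φ / 2)`, fixed by its indices, times a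
polynomial in `u` and the parameters; this is `Rep`. Connection, flux and the curvature terms are
thereby reduced to polynomial identities, which are decided by evaluation (`gamma_check`,
`field_check`, `raised_check`, `source_check`) and transported back by `Rep.of_isZero`.

The metric equation minus the flux equation is a single equation `fieldEq` in which `X` is
differentiated only through `2 ∇_μ X_ν`. For odd `μ` the derivative is algebraic in the coefficients
of `X`, so these equations hold pointwise among finitely many numbers. Those with two odd indices
determine the four linear coefficients of `X_ψ, X_χ`; the `ψ`-parts of those with indices `χ, i`
determine the three `ψχ`-coefficients of `X_φ, X_y, X_u`. Nine equations remain for the three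
leading coefficients. The latter are taken along `∂_φ + u ∂_u`, `exp φ ∂_y - 2u ∂_φ - u² ∂_u` and
`∂_u`, which span `sl(2)` with constant structure coefficients; the components are `ξ 0, ξ 1, ξ 2`.
In this frame the nine equations are equivalent to equations free of `u`
(`polyEval_eq_zero_of_fieldEq`).

For `a = 1` put `K = 1 - κ² - b A² - 2 b g`. If `K = 0`, elimination from the linear equations gives
a contradiction (`omega_false_of_eq_zero`). If `K ≠ 0`, then `ξ 0 = 0` and `ξ 1 + b ξ 2 = 0`
throughout `U` (`omega_mul_eq_zero`); differentiating the first turns two combinations of the purely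
bosonic equations into algebraic ones, which contradict the rest (`omega_false_of_constant`).

For `a = 0` the linear equations make `ξ 0, ξ 2` constant, and the bosonic equations then exclude
everything except `κ = 1, A = 0, g ≠ 0`. There the field equations alone do not suffice. The Killing
equations and the equation for `dZ` force `∂_y I^u` to be a nonzero multiple of `exp (-φ)` while
`∂_φ I^u = 0`, against the symmetry of second derivatives (`not_isSolution_of_flat`). -/

/-- A monomial, given by the list of its exponents. -/
abbrev Mono := List ℕ

/-- A polynomial with integer coefficients, as a list of terms. -/
abbrev Poly := List (ℤ × Mono)

/-- The value of a monomial. -/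
def monoEval : (ℕ → ℝ) → Mono → ℝ
  | _, [] => 1
  | v, n :: m => v 0 ^ n * monoEval (fun i => v (i + 1)) m

/-- The value of a polynomial. -/
def polyEval (v : ℕ → ℝ) : Poly → ℝ
  | [] => 0
  | t :: p => t.1 * monoEval v t.2 + polyEval v p

/-- Product of monomials. -/
def monoMul (m : Mono) : Mono → Mono :=
  @List.rec ℕ (fun _ => Mono → Mono) (fun n => n)
    (fun i m ih n => @List.rec ℕ (fun _ => Mono) (i :: m) (fun j n _ => Nat.add i j :: ih n) n) m

/-- Product of a term and a polynomial. -/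
def termMul (t : ℤ × Mono) : Poly → Poly
  | [] => []
  | s :: p => (t.1 * s.1, monoMul t.2 s.2) :: termMul t p

theorem monoEval_mul (v : ℕ → ℝ) (m n : Mono) :
    monoEval v (monoMul m n) = monoEval v m * monoEval v n := by
  induction m generalizing v n with
  | nil => simp [monoMul, monoEval]
  | cons i m ih =>
    cases n with
    | nil => simp [monoMul, monoEval]
    | cons j n =>
      show v 0 ^ (i + j) * monoEval _ (monoMul m n) = _
      rw [ih, pow_add, monoEval, monoEval]; ring

@[simp] theorem polyEval_nil (v : ℕ → ℝ) : polyEval v [] = 0 := rfl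

@[simp] theorem polyEval_append (v : ℕ → ℝ) (p q : Poly) :
    polyEval v (p ++ q) = polyEval v p + polyEval v q := by
  induction p with
  | nil => simp
  | cons t p ih => simp only [List.cons_append, polyEval, ih]; ring

theorem polyEval_termMul (v : ℕ → ℝ) (t : ℤ × Mono) (p : Poly) :
    polyEval v (termMul t p) = t.1 * monoEval v t.2 * polyEval v p := by
  induction p with
  | nil => simp [termMul]
  | cons s p ih => simp only [termMul, polyEval, ih, monoEval_mul, Int.cast_mul]; ring

/-- The scalar multiples of a polynomial. -/
def polySmul (c : ℤ) (p : Poly) : Poly := termMul (c, []) p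

@[simp] theorem polyEval_smul (v : ℕ → ℝ) (c : ℤ) (p : Poly) :
    polyEval v (polySmul c p) = c * polyEval v p := by
  simp [polySmul, polyEval_termMul, monoEval]

/-! ### A test for zero -/

/-- The parameters of a background: `g = η²`, and `D` is the inverse of `1 + a b η²`. -/
structure Params where
  g : ℝ
  a : ℝ
  b : ℝ
  A : ℝ
  k : ℝ
  D : ℝ
  hD : D * (1 + a * b * g) = 1

/-- The values of the variables of the polynomials: the number `1/2`, the coordinate `u`, the
parameters, and further constants `ξ`. -/
noncomputable def Params.env (P : Params) (ξ : ℕ → ℝ) (u : ℝ) : ℕ → ℝ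
  | 0 => 1 / 2
  | 1 => u
  | 2 => P.g
  | 3 => P.a
  | 4 => P.b
  | 5 => P.A
  | 6 => P.k
  | 7 => P.D
  | n + 8 => ξ n

/-- Reduction of a term by means of `a b g D = 1 - D`. -/
def reduceTerm : ℕ → ℤ × Mono → Poly
  | n + 1, (c, i :: j :: (g + 1) :: (a + 1) :: (b + 1) :: k :: l :: (d + 1) :: m) =>
    reduceTerm n (c, i :: j :: g :: a :: b :: k :: l :: d :: m) ++
      reduceTerm n (-c, i :: j :: g :: a :: b :: k :: l :: (d + 1) :: m)
  | _, t => [t]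

/-- The relation `hD`, multiplied by the remaining monomial, justifies each replacement. The value
is preserved for every bound `n`: a bound that is too small leaves terms unreduced and can only make
the zero test fail. -/
theorem polyEval_reduceTerm (P : Params) (ξ : ℕ → ℝ) (u : ℝ) (n : ℕ) (t : ℤ × Mono) :
    polyEval (P.env ξ u) (reduceTerm n t) = t.1 * monoEval (P.env ξ u) t.2 := by
  induction n, t using reduceTerm.induct with
  | case1 n c i j g a b k l d m ih1 ih2 =>
    have h := P.hD
    simp only [reduceTerm, polyEval_append, ih1, ih2]
    simp only [monoEval, Params.env, Int.cast_neg, Nat.succ_eq_add_one]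
    linear_combination (-c * (1 / 2) ^ i * u ^ j * P.g ^ g * P.a ^ a * P.b ^ b * P.A ^ k * P.k ^ l
      * P.D ^ d * monoEval (fun n => ξ n) m) * h
  | case2 n t h =>
    rw [reduceTerm]
    · simp [polyEval]
    · exact h

/-- The code of a monomial with exponents below `32`. -/
def monoKey (m : Mono) : ℕ :=
  @List.rec ℕ (fun _ => ℕ) 0 (fun n _ ih => Nat.add n (Nat.mul 32 ih)) m

/-- The exponents are below `32`. -/
def isSmall (m : Mono) : Bool :=
  @List.rec ℕ (fun _ => Bool) true (fun n _ ih => cond (Nat.ble n 31) ih false) m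

theorem isSmall_cons {n : ℕ} {m : Mono} (h : isSmall (n :: m) = true) :
    n ≤ 31 ∧ isSmall m = true := by
  have h : cond (Nat.ble n 31) (isSmall m) false = true := h
  cases hn : Nat.ble n 31 with
  | false => rw [hn] at h; exact absurd h (by simp)
  | true => rw [hn] at h; exact ⟨Nat.le_of_ble_eq_true hn, h⟩

theorem monoEval_eq_one (v : ℕ → ℝ) (m : Mono) (h : monoKey m = 0) : monoEval v m = 1 := by
  induction m generalizing v with
  | nil => rfl
  | cons n m ih =>
    have h : n + 32 * monoKey m = 0 := h
    rw [monoEval, ih _ (by omega), show n = 0 by omega, pow_zero, one_mul]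

/-- Exponents below 32 are base-32 digits, so the code determines them. The lists may differ in
length; trailing zero exponents contribute the factor 1. -/
theorem monoEval_eq_of_key (v : ℕ → ℝ) (m n : Mono) (hm : isSmall m = true) (hn : isSmall n = true)
    (h : monoKey m = monoKey n) : monoEval v m = monoEval v n := by
  induction m generalizing v n with
  | nil => exact (monoEval_eq_one v n h.symm).symm
  | cons i m ih => cases n with
    | nil => exact monoEval_eq_one v _ h
    | cons j n =>
      have hm := isSmall_cons hm
      have hn := isSmall_cons hn
      have h : i + 32 * monoKey m = j + 32 * monoKey n := h
      rw [monoEval, monoEval, ih _ n hm.2 hn.2 (by omega), show i = j by omega]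

/-- A polynomial whose monomials are given together with their codes. -/
abbrev KeyPoly := List (ℕ × ℤ × Mono)

/-- The value of a polynomial with codes. -/
def keyEval (v : ℕ → ℝ) : KeyPoly → ℝ
  | [] => 0
  | t :: p => t.2.1 * monoEval v t.2.2 + keyEval v p

/-- Insertion of a term into a list of terms. -/
def insertTerm (k : ℕ) (c : ℤ) (m : Mono) (p : KeyPoly) : KeyPoly :=
  @List.rec (ℕ × ℤ × Mono) (fun _ => KeyPoly) [(k, c, m)]
    (fun t p ih => cond (Nat.beq k t.1) ((k, Int.add c t.2.1, m) :: p) (t :: ih)) p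

theorem insertTerm_cons (k : ℕ) (c : ℤ) (m : Mono) (t : ℕ × ℤ × Mono) (p : KeyPoly) :
    insertTerm k c m (t :: p) =
      bif Nat.beq k t.1 then (k, Int.add c t.2.1, m) :: p else t :: insertTerm k c m p := rfl

/-- The codes are correct. -/
def IsKeyed (p : KeyPoly) : Prop := ∀ t ∈ p, t.1 = monoKey t.2.2 ∧ isSmall t.2.2 = true

theorem isKeyed_insertTerm (c : ℤ) (m : Mono) (p : KeyPoly) (hm : isSmall m = true)
    (hp : IsKeyed p) : IsKeyed (insertTerm (monoKey m) c m p) := by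
  induction p with
  | nil =>
    intro t ht
    have ht := List.mem_singleton.1 ht
    subst ht
    exact ⟨rfl, hm⟩
  | cons s p ih =>
    have hp' : IsKeyed p := fun t ht => hp t (List.mem_cons_of_mem _ ht)
    intro t ht
    rw [insertTerm_cons] at ht
    cases h : Nat.beq (monoKey m) s.1 with
    | false =>
      rw [h, cond_false, List.mem_cons] at ht
      rcases ht with rfl | ht
      exacts [hp _ List.mem_cons_self, ih hp' t ht]
    | true =>
      rw [h, cond_true, List.mem_cons] at ht
      rcases ht with rfl | ht
      exacts [⟨rfl, hm⟩, hp' t ht]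

theorem keyEval_insertTerm (v : ℕ → ℝ) (c : ℤ) (m : Mono) (p : KeyPoly) (hm : isSmall m = true)
    (hp : IsKeyed p) :
    keyEval v (insertTerm (monoKey m) c m p) = c * monoEval v m + keyEval v p := by
  induction p with
  | nil => simp [insertTerm, keyEval]
  | cons t p ih =>
    have ih := ih fun t ht => hp t (List.mem_cons_of_mem _ ht)
    rw [insertTerm_cons]
    cases h : Nat.beq (monoKey m) t.1 with
    | false => simp only [cond_false, keyEval, ih]; ring
    | true =>
      obtain ⟨h1, h2⟩ := hp t List.mem_cons_self
      have := monoEval_eq_of_key v m t.2.2 hm h2 ((Nat.eq_of_beq_eq_true h).trans h1)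
      simp only [cond_true, keyEval, Int.add_def, Int.cast_add, ← this]; ring

/-- Collection of the terms with the same monomial. The first variable, whose value is `1/2`, is
eliminated by means of the factor `2 ^ 20`. -/
def collect (p : Poly) (q : KeyPoly) : KeyPoly :=
  @List.rec (ℤ × Mono) (fun _ => KeyPoly) q (fun t _ ih => @List.rec ℕ (fun _ => KeyPoly)
    (insertTerm (monoKey []) (Int.mul t.1 (Int.ofNat (Nat.pow 2 20))) [] ih)
    (fun n m _ => insertTerm (monoKey (0 :: m))
      (Int.mul t.1 (Int.ofNat (Nat.pow 2 (Nat.sub 20 n)))) (0 :: m) ih) t.2) p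

/-- The exponent of the first variable is at most `20`, and the other exponents are below `32`. -/
def lowDegree (p : Poly) : Bool :=
  @List.rec (ℤ × Mono) (fun _ => Bool) true (fun t _ ih => @List.rec ℕ (fun _ => Bool) ih
    (fun n m _ => cond (Nat.ble n 20) (cond (isSmall m) ih false) false) t.2) p

theorem isKeyed_collect (p : Poly) (q : KeyPoly) (hp : lowDegree p = true) (hq : IsKeyed q) :
    IsKeyed (collect p q) := by
  induction p with
  | nil => exact hq
  | cons t p ih =>
    obtain ⟨c, m⟩ := t
    cases m with
    | nil => exact isKeyed_insertTerm _ [] _ rfl (ih hp)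
    | cons n m =>
      have hp : cond (Nat.ble n 20) (cond (isSmall m) (lowDegree p) false) false = true := hp
      simp only [Bool.cond_false_right, Bool.and_eq_true] at hp
      exact isKeyed_insertTerm _ (0 :: m) _ hp.2.1 (ih hp.2.2)

/-- Terms such as `2 · (1/2)` and `1` are different monomials with the same value. Multiplying by `2
^ 20` turns every power of `1/2` into an integer coefficient and makes such terms cancel. -/
theorem keyEval_collect (v : ℕ → ℝ) (hv : v 0 = 1 / 2) (p : Poly) (q : KeyPoly)
    (hp : lowDegree p = true) (hq : IsKeyed q) :
    keyEval v (collect p q) = 2 ^ 20 * polyEval v p + keyEval v q := by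
  induction p with
  | nil => simp [collect]
  | cons t p ih =>
    obtain ⟨c, m⟩ := t
    cases m with
    | nil =>
      show keyEval v (insertTerm (monoKey []) (Int.mul c (Int.ofNat (Nat.pow 2 20))) []
        (collect p q)) = _
      rw [keyEval_insertTerm v _ [] _ rfl (isKeyed_collect p q hp hq), ih hp]
      simp only [polyEval, monoEval, Nat.pow_eq, Int.ofNat_eq_natCast, Int.mul_def]
      push_cast; ring
    | cons n m =>
      have hp : cond (Nat.ble n 20) (cond (isSmall m) (lowDegree p) false) false = true := hp
      simp only [Bool.cond_false_right, Bool.and_eq_true] at hp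
      have hn : n ≤ 20 := Nat.le_of_ble_eq_true hp.1
      have hm : isSmall (0 :: m) = true := hp.2.1
      show keyEval v (insertTerm (monoKey (0 :: m)) (Int.mul c (Int.ofNat (Nat.pow 2 (20 - n))))
        (0 :: m) (collect p q)) = _
      rw [keyEval_insertTerm v _ _ _ hm (isKeyed_collect p q hp.2.2 hq), ih hp.2.2]
      simp only [polyEval, monoEval, hv, Int.mul_def]
      have h2 : (2 : ℝ) ^ (20 - n) = 2 ^ 20 * (1 / 2) ^ n := by
        rw [pow_sub₀ _ two_ne_zero hn]; simp
      simp only [Nat.pow_eq, Int.ofNat_eq_natCast]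
      push_cast
      rw [h2]; ring

/-- All terms are zero. -/
def allZero (p : KeyPoly) : Bool :=
  @List.rec (ℕ × ℤ × Mono) (fun _ => Bool) true
    (fun t _ ih => cond (Nat.beq (Int.natAbs t.2.1) 0) ih false) p

theorem keyEval_of_allZero (v : ℕ → ℝ) (p : KeyPoly) (hp : allZero p = true) :
    keyEval v p = 0 := by
  induction p with
  | nil => rfl
  | cons t p ih =>
    have hp : cond (Nat.beq (Int.natAbs t.2.1) 0) (allZero p) false = true := hp
    simp only [Bool.cond_false_right, Bool.and_eq_true, Nat.beq_eq, Int.natAbs_eq_zero] at hp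
    simp [keyEval, ih hp.2, hp.1]

/-- Reduction of a polynomial by means of `a b g D = 1 - D`. -/
def reduce : KeyPoly → Poly
  | [] => []
  | t :: p => bif Nat.beq t.2.1.natAbs 0 then reduce p else reduceTerm 12 t.2 ++ reduce p

/-- A sufficient condition for a polynomial to vanish. -/
def isZero (p : Poly) : Bool :=
  lowDegree p && (lowDegree (reduce (collect p [])) && allZero (collect (reduce (collect p [])) []))

theorem polyEval_reduce (P : Params) (ξ : ℕ → ℝ) (u : ℝ) (p : KeyPoly) :
    polyEval (P.env ξ u) (reduce p) = keyEval (P.env ξ u) p := by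
  induction p with
  | nil => rfl
  | cons t p ih =>
    cases h : Nat.beq t.2.1.natAbs 0 with
    | false => simp [reduce, h, polyEval_append, polyEval_reduceTerm, keyEval, ih]
    | true =>
      have h0 : t.2.1 = 0 := Int.natAbs_eq_zero.1 (Nat.eq_of_beq_eq_true h)
      simp [reduce, keyEval, ih, h0]

/-- Soundness is all that is needed. The list is collected once before the reduction, to keep it
short, and once after it; each pass contributes a harmless factor `2 ^ 20`. -/
theorem polyEval_of_isZero (P : Params) (ξ : ℕ → ℝ) (u : ℝ) (p : Poly) (hp : isZero p = true) :
    polyEval (P.env ξ u) p = 0 := by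
  simp only [isZero, Bool.and_eq_true] at hp
  obtain ⟨h1, h2, h3⟩ := hp
  have h0 : IsKeyed [] := fun _ ht => absurd ht List.not_mem_nil
  have h := keyEval_of_allZero (P.env ξ u) _ h3
  rw [keyEval_collect _ rfl _ _ h2 h0, polyEval_reduce, keyEval_collect _ rfl _ _ h1 h0] at h
  simpa [keyEval] using h

end OSp

namespace OSp

/-! ### The coefficients of superfunctions -/

theorem coeff_eq (f : SuperFun) (S : Finset ℕ) (x : Fin 3 → ℝ) : coeff f S x = f S x := rfl

@[simp] theorem add_apply (f g : SuperFun) (S : Finset ℕ) (x : Fin 3 → ℝ) :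
    (f + g) S x = f S x + g S x := rfl

@[simp] theorem sub_apply (f g : SuperFun) (S : Finset ℕ) (x : Fin 3 → ℝ) :
    (f - g) S x = f S x - g S x := rfl

@[simp] theorem neg_apply (f : SuperFun) (S : Finset ℕ) (x : Fin 3 → ℝ) : (-f) S x = -f S x := rfl

@[simp] theorem zero_apply (S : Finset ℕ) (x : Fin 3 → ℝ) : (0 : SuperFun) S x = 0 := rfl

@[simp] theorem smul_apply (c : ℝ) (f : SuperFun) (S : Finset ℕ) (x : Fin 3 → ℝ) :
    (c • f) S x = c * f S x := rfl

theorem mul_apply (f g : SuperFun) (S : Finset ℕ) (x : Fin 3 → ℝ) :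
    (f * g) S x = ∑ T ∈ S.powerset, sgn (inversions T (S \ T)) * (f T x * g (S \ T) x) := rfl

@[simp] theorem mul_empty (f g : SuperFun) (x : Fin 3 → ℝ) : (f * g) ∅ x = f ∅ x * g ∅ x := by
  rw [mul_apply]
  simp [inversions, sgn]

theorem mul_singleton (f g : SuperFun) (n : ℕ) (x : Fin 3 → ℝ) :
    (f * g) {n} x = f ∅ x * g {n} x + f {n} x * g ∅ x := by
  have h : ({n} : Finset ℕ).powerset = {∅, {n}} := by
    ext S; simp [Finset.subset_singleton_iff]
  rw [mul_apply, h, Finset.sum_pair (Finset.singleton_ne_empty n).symm]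
  simp [inversions, sgn]

/-- With `mul_empty` and `mul_singleton` this shows that the coefficients at subsets of `{0, 1}`
multiply among themselves, whatever supernumber terms are present. This is the truncation that
removes the auxiliary generators. -/
theorem mul_pair (f g : SuperFun) (x : Fin 3 → ℝ) :
    (f * g) {0, 1} x = f ∅ x * g {0, 1} x + f {0} x * g {1} x - f {1} x * g {0} x
      + f {0, 1} x * g ∅ x := by
  have h : ({0, 1} : Finset ℕ).powerset = {∅, {0}, {1}, {0, 1}} := by decide
  have h0 : ({0, 1} : Finset ℕ) \ {0} = {1} := by decide
  have h1 : ({0, 1} : Finset ℕ) \ {1} = {0} := by decide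
  have i0 : inversions {0} {1} = 0 := by decide
  have i1 : inversions {1} {0} = 1 := by decide
  have i2 : inversions ∅ {0, 1} = 0 := by decide
  have i3 : inversions {0, 1} ∅ = 0 := by decide
  rw [mul_apply, h, Finset.sum_insert (by decide), Finset.sum_insert (by decide),
    Finset.sum_insert (by decide), Finset.sum_singleton, h0, h1, Finset.sdiff_self,
    Finset.sdiff_empty, i0, i1, i2, i3]
  simp [sgn]
  ring

/-- The superfunction depends only on the odd generators `ψ` and `χ`. -/
def Supported (f : SuperFun) : Prop := ∀ S, ¬S ⊆ {0, 1} → ∀ x, f S x = 0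

theorem Supported.zero : Supported 0 := fun _ _ _ => rfl

theorem Supported.add {f g : SuperFun} (hf : Supported f) (hg : Supported g) :
    Supported (f + g) := fun S hS x => by simp [hf S hS x, hg S hS x]

theorem Supported.sub {f g : SuperFun} (hf : Supported f) (hg : Supported g) :
    Supported (f - g) := fun S hS x => by simp [hf S hS x, hg S hS x]

theorem Supported.neg {f : SuperFun} (hf : Supported f) : Supported (-f) :=
  fun S hS x => by simp [hf S hS x]

theorem Supported.smul (c : ℝ) {f : SuperFun} (hf : Supported f) : Supported (c • f) :=
  fun S hS x => by simp [hf S hS x]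

theorem Supported.mul {f g : SuperFun} (hf : Supported f) (hg : Supported g) :
    Supported (f * g) := fun S hS x => by
  rw [mul_apply]
  refine Finset.sum_eq_zero fun T hT => ?_
  by_cases h : T ⊆ {0, 1}
  · rw [hg (S \ T) (fun h' => hS fun s hs => ?_) x]
    · simp
    · by_cases hsT : s ∈ T
      · exact h hsT
      · exact h' (Finset.mem_sdiff.2 ⟨hs, hsT⟩)
  · rw [hf T h x]; simp

theorem Supported.sum {f : Fin 5 → SuperFun} (hf : ∀ i, Supported (f i)) :
    Supported (∑ i, f i) := by
  rw [Fin.sum_univ_five]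
  exact ((((hf 0).add (hf 1)).add (hf 2)).add (hf 3)).add (hf 4)

theorem supported_bos (f : (Fin 3 → ℝ) → ℝ) : Supported (bos f) := fun S hS x => by
  have : S ≠ ∅ := fun h => hS (by simp [h])
  simp [bos, this]

theorem supported_psi : Supported psi := fun S hS x => by
  have : S ≠ {0} := fun h => hS (by rw [h]; decide)
  simp [psi, theta, this]

theorem supported_chi : Supported chi := fun S hS x => by
  have : S ≠ {1} := fun h => hS (by rw [h]; decide)
  simp [chi, theta, this]

theorem Supported.ext {f g : SuperFun} (hf : Supported f) (hg : Supported g)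
    (h : ∀ x, f ∅ x = g ∅ x ∧ f {0} x = g {0} x ∧ f {1} x = g {1} x ∧ f {0, 1} x = g {0, 1} x) :
    f = g := by
  funext S x
  by_cases hS : S ⊆ {0, 1}
  · have hm : S ∈ ({∅, {0}, {1}, {0, 1}} : Finset (Finset ℕ)) := by
      have := Finset.mem_powerset.2 hS
      have h : ({0, 1} : Finset ℕ).powerset = {∅, {0}, {1}, {0, 1}} := by decide
      rwa [h] at this
    obtain ⟨h0, h1, h2, h3⟩ := h x
    simp only [Finset.mem_insert, Finset.mem_singleton] at hm
    rcases hm with rfl | rfl | rfl | rfl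
    exacts [h0, h1, h2, h3]
  · rw [hf S hS x, hg S hS x]

/-! ### Superfunctions with polynomial coefficients -/

/-- The products of the odd coordinates: `1`, `ψ`, `χ` and `ψ χ`. -/
inductive Mask where
  | one
  | psi
  | chi
  | top

/-- A formal superfunction: a list of terms with integer coefficients. -/
abbrev Form := List (Mask × ℤ × Mono)

/-- Case distinction by the product of odd coordinates. -/
def Mask.elim {α : Type} (a : Mask) (x y z w : α) : α := @Mask.casesOn (fun _ => α) a x y z w

/-- Recursion on the terms. -/
def Form.fold {α : Type} (z : α) (f : Mask → ℤ → Mono → α → α) (F : Form) : α :=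
  @List.rec (Mask × ℤ × Mono) (fun _ => α) z (fun t _ ih => f t.1 t.2.1 t.2.2 ih) F

namespace Form

def zero : Form := []

def add (F G : Form) : Form := fold G (fun a c m r => (a, c, m) :: r) F

def term (t : ℤ × Mono) (F : Form) : Form :=
  fold [] (fun a c m r => (a, Int.mul t.1 c, monoMul t.2 m) :: r) F

def neg (F : Form) : Form := fold [] (fun a c m r => (a, Int.neg c, m) :: r) F

def sub (F G : Form) : Form := F.add G.neg

def sign (n : ℕ) (F : Form) : Form :=
  fold [] (fun _ _ _ _ => cond (Nat.beq (Nat.mod n 2) 0) F F.neg) F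

/-- The product with a term on the left, followed by the terms of `acc`. -/
def termMul (a : Mask) (c : ℤ) (m : Mono) (G acc : Form) : Form :=
  fold acc (fun b d n r => a.elim ((b, Int.mul c d, monoMul m n) :: r)
    (b.elim ((.psi, Int.mul c d, monoMul m n) :: r) r ((.top, Int.mul c d, monoMul m n) :: r) r)
    (b.elim ((.chi, Int.mul c d, monoMul m n) :: r)
      ((.top, Int.neg (Int.mul c d), monoMul m n) :: r) r r)
    (b.elim ((.top, Int.mul c d, monoMul m n) :: r) r r r)) G

def mul (F G : Form) : Form := fold [] (fun a c m r => termMul a c m G r) F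

def sum (F : Fin 5 → Form) : Form := (F 0).add ((F 1).add ((F 2).add ((F 3).add (F 4))))

/-- The part with a given product of odd coordinates. -/
def part (a : Mask) (F : Form) : Poly :=
  fold [] (fun b c m r =>
    a.elim (b.elim ((c, m) :: r) r r r) (b.elim r ((c, m) :: r) r r)
      (b.elim r r ((c, m) :: r) r) (b.elim r r r ((c, m) :: r))) F

/-- The derivative of a term in the coordinate `u`, followed by the terms of `r`. -/
def derivTerm (a : Mask) (c : ℤ) (m : Mono) (r : Form) : Form :=
  @List.rec ℕ (fun _ => Form) r (fun i n _ => @List.rec ℕ (fun _ => Form) r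
    (fun j n _ => @Nat.rec (fun _ => Form) r
      (fun j _ => (a, Int.mul c (Int.ofNat (Nat.succ j)), i :: j :: n) :: r) j) n) m

/-- The partial derivatives of a superfunction of weight `W`. -/
def pd (W : ℤ) : Fin 5 → Form → Form
  | 0, F => fold [] (fun a c m r =>
      (a, Int.mul (Int.neg (a.elim W (Int.add W 1) W (Int.add W 1))) c, monoMul [1] m) :: r) F
  | 1, _ => zero
  | 2, F => fold [] derivTerm F
  | 3, F => fold [] (fun a c m r => a.elim r ((.one, c, m) :: r) r ((.chi, c, m) :: r)) F
  | 4, F => fold [] (fun a c m r => a.elim r r ((.one, c, m) :: r) ((.psi, Int.neg c, m) :: r)) F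

def rpd (p : ℕ) (W : ℤ) (μ : Fin 5) (F : Form) : Form := (pd W μ F).sign (par μ * (p + 1))

/-- A sufficient condition for a formal superfunction to vanish. -/
def isZero (F : Form) : Bool :=
  OSp.isZero (F.part .one) && (OSp.isZero (F.part .psi) &&
    (OSp.isZero (F.part .chi) && OSp.isZero (F.part .top)))

/-- The value of a part of a formal superfunction. -/
noncomputable def eval (v : ℕ → ℝ) (a : Mask) (F : Form) : ℝ := polyEval v (F.part a)

section eval

variable (v : ℕ → ℝ) (a b : Mask) (c d : ℤ) (m n : Mono) (F G : Form)

@[simp] theorem eval_nil : eval v a [] = 0 := rfl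

theorem eval_cons : eval v a ((b, c, m) :: F) =
    (a.elim (b.elim 1 0 0 0) (b.elim 0 1 0 0) (b.elim 0 0 1 0) (b.elim 0 0 0 1)) *
      (c * monoEval v m) + eval v a F := by
  cases a <;> cases b <;> simp [eval, part, fold, Mask.elim, polyEval]

theorem cast_int_neg : ((Int.neg c : ℤ) : ℝ) = -c := Int.cast_neg c

theorem eval_add : eval v a (F.add G) = eval v a F + eval v a G := by
  induction F with
  | nil => simp [add, fold]
  | cons t F ih =>
    obtain ⟨b, c, m⟩ := t
    show eval v a ((b, c, m) :: add F G) = _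
    rw [eval_cons, eval_cons, ih]; ring

theorem eval_term (t : ℤ × Mono) : eval v a (F.term t) = t.1 * monoEval v t.2 * eval v a F := by
  induction F with
  | nil => simp [term, fold]
  | cons s F ih =>
    obtain ⟨b, c, m⟩ := s
    show eval v a ((b, Int.mul t.1 c, monoMul t.2 m) :: term t F) = _
    rw [eval_cons, eval_cons, ih, monoEval_mul, Int.mul_def, Int.cast_mul]; ring

theorem eval_neg : eval v a F.neg = -eval v a F := by
  induction F with
  | nil => simp [neg, fold]
  | cons s F ih =>
    obtain ⟨b, c, m⟩ := s
    show eval v a ((b, Int.neg c, m) :: neg F) = _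
    rw [eval_cons, eval_cons, ih, cast_int_neg]; ring

theorem sign_eq (k : ℕ) : F.sign k = if k % 2 = 0 then F else F.neg := by
  cases F with
  | nil => simp [sign, fold, neg]
  | cons t F =>
    show cond (Nat.beq (k % 2) 0) (t :: F) (neg (t :: F)) = _
    by_cases h : k % 2 = 0
    · rw [if_pos h, h]; rfl
    · have h' : Nat.beq (k % 2) 0 = false := by
        rw [show k % 2 = 1 by omega]; rfl
      rw [if_neg h, h']; rfl

theorem eval_termMul (G acc : Form) : eval v b (termMul a c m G acc) =
    c * monoEval v m * (a.elim (eval v b G)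
      (b.elim 0 (eval v .one G) 0 (eval v .chi G))
      (b.elim 0 0 (eval v .one G) (-eval v .psi G))
      (b.elim 0 0 0 (eval v .one G))) + eval v b acc := by
  induction G with
  | nil => cases a <;> cases b <;> simp [termMul, fold, Mask.elim]
  | cons s G ih =>
    obtain ⟨e, d, n⟩ := s
    have h : termMul a c m ((e, d, n) :: G) acc = a.elim
      ((e, Int.mul c d, monoMul m n) :: termMul a c m G acc)
      (e.elim ((.psi, Int.mul c d, monoMul m n) :: termMul a c m G acc) (termMul a c m G acc)
        ((.top, Int.mul c d, monoMul m n) :: termMul a c m G acc) (termMul a c m G acc))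
      (e.elim ((.chi, Int.mul c d, monoMul m n) :: termMul a c m G acc)
        ((.top, Int.neg (Int.mul c d), monoMul m n) :: termMul a c m G acc)
        (termMul a c m G acc) (termMul a c m G acc))
      (e.elim ((.top, Int.mul c d, monoMul m n) :: termMul a c m G acc) (termMul a c m G acc)
        (termMul a c m G acc) (termMul a c m G acc)) := rfl
    rw [h]
    cases a <;> cases e <;> cases b <;>
      simp only [Mask.elim, eval_cons, monoEval_mul, Int.mul_def, Int.cast_mul,
        cast_int_neg] at ih ⊢ <;>
      rw [ih] <;> ring

theorem eval_mul : eval v a (F.mul G) = a.elim (eval v .one F * eval v .one G)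
    (eval v .one F * eval v .psi G + eval v .psi F * eval v .one G)
    (eval v .one F * eval v .chi G + eval v .chi F * eval v .one G)
    (eval v .one F * eval v .top G + eval v .psi F * eval v .chi G
      - eval v .chi F * eval v .psi G + eval v .top F * eval v .one G) := by
  induction F with
  | nil => cases a <;> simp [mul, fold, Mask.elim]
  | cons t F ih =>
    obtain ⟨b, c, m⟩ := t
    have h : mul ((b, c, m) :: F) G = termMul b c m G (mul F G) := rfl
    rw [h, eval_termMul, ih]
    cases a <;> cases b <;> simp only [Mask.elim, eval_cons] <;> ring

end eval

end Form

/-- A formal superfunction `c0 + c1 ψ + c2 χ + c3 ψ χ`. -/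
structure SPoly where
  c0 : Poly
  c1 : Poly
  c2 : Poly
  c3 : Poly

namespace SPoly

def zero : SPoly := ⟨[], [], [], []⟩

/-- The terms of `p`, multiplied by `a`, followed by the terms of `F`. -/
def cons (a : Mask) (p : Poly) (F : Form) : Form :=
  @List.rec (ℤ × Mono) (fun _ => Form) F (fun t _ r => (a, t.1, t.2) :: r) p

/-- The list of terms. -/
def form (F : SPoly) : Form := cons .one F.c0 (cons .psi F.c1 (cons .chi F.c2 (cons .top F.c3 [])))

theorem eval_consTerms (v : ℕ → ℝ) (a b : Mask) (p : Poly) (F : Form) :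
    (cons a p F).eval v b = (b.elim (a.elim 1 0 0 0) (a.elim 0 1 0 0) (a.elim 0 0 1 0)
      (a.elim 0 0 0 1)) * polyEval v p + F.eval v b := by
  induction p with
  | nil => simp [cons]
  | cons t p ih =>
    show Form.eval v b ((a, t.1, t.2) :: cons a p F) = _
    rw [Form.eval_cons, ih, polyEval]; ring

theorem eval_form (v : ℕ → ℝ) (a : Mask) (F : SPoly) :
    F.form.eval v a =
      a.elim (polyEval v F.c0) (polyEval v F.c1) (polyEval v F.c2) (polyEval v F.c3) := by
  cases a <;> simp [form, eval_consTerms, Mask.elim]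

end SPoly

/-! ### Homogeneous superfunctions and their formal counterparts -/

/-- The exponential `exp (-W φ / 2)`. -/
noncomputable def scale (W : ℤ) (x : Fin 3 → ℝ) : ℝ := Real.exp (-(W * x 0) / 2)

theorem scale_add (V W : ℤ) (x : Fin 3 → ℝ) : scale (V + W) x = scale V x * scale W x := by
  rw [scale, scale, scale, ← Real.exp_add]
  push_cast
  congr 1
  ring

theorem scale_ne_zero (W : ℤ) (x : Fin 3 → ℝ) : scale W x ≠ 0 := (Real.exp_pos _).ne'

@[simp] theorem scale_zero (x : Fin 3 → ℝ) : scale 0 x = 1 := by simp [scale]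

/-- At the point `x` the superfunction `f` has the weight `W` and is given by the formal
superfunction `F`. -/
def Rep (P : Params) (ξ : ℕ → ℝ) (x : Fin 3 → ℝ) (W : ℤ) (f : SuperFun) (F : Form) : Prop :=
  f ∅ x = scale W x * F.eval (P.env ξ (x 2)) .one ∧
  f {0} x = scale (W + 1) x * F.eval (P.env ξ (x 2)) .psi ∧
  f {1} x = scale W x * F.eval (P.env ξ (x 2)) .chi ∧
  f {0, 1} x = scale (W + 1) x * F.eval (P.env ξ (x 2)) .top

section Rep

variable {P : Params} {ξ : ℕ → ℝ} {x : Fin 3 → ℝ} {V W U' : ℤ} {f g : SuperFun} {F G : Form}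

theorem rep_form_iff {F : SPoly} : Rep P ξ x W f F.form ↔
    f ∅ x = scale W x * polyEval (P.env ξ (x 2)) F.c0 ∧
    f {0} x = scale (W + 1) x * polyEval (P.env ξ (x 2)) F.c1 ∧
    f {1} x = scale W x * polyEval (P.env ξ (x 2)) F.c2 ∧
    f {0, 1} x = scale (W + 1) x * polyEval (P.env ξ (x 2)) F.c3 := by
  simp only [Rep, SPoly.eval_form, Mask.elim]

theorem Rep.cast (hf : Rep P ξ x W f F) (e : W = V) : Rep P ξ x V f F := e ▸ hf

theorem Rep.add (hf : Rep P ξ x W f F) (hg : Rep P ξ x W g G) : Rep P ξ x W (f + g) (F.add G) := by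
  obtain ⟨f0, f1, f2, f3⟩ := hf
  obtain ⟨g0, g1, g2, g3⟩ := hg
  simp only [Rep, Form.eval_add, add_apply, f0, f1, f2, f3, g0, g1, g2, g3, mul_add, and_self]

theorem Rep.term (hf : Rep P ξ x W f F) (t : ℤ × Mono) (c : ℝ)
    (hc : t.1 * monoEval (P.env ξ (x 2)) t.2 = c) : Rep P ξ x W (c • f) (F.term t) := by
  obtain ⟨f0, f1, f2, f3⟩ := hf
  simp only [Rep, smul_apply, Form.eval_term, f0, f1, f2, f3, hc]
  refine ⟨?_, ?_, ?_, ?_⟩ <;> ring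

theorem Rep.neg (hf : Rep P ξ x W f F) : Rep P ξ x W (-f) F.neg := by
  obtain ⟨f0, f1, f2, f3⟩ := hf
  simp only [Rep, neg_apply, Form.eval_neg, f0, f1, f2, f3, mul_neg, and_self]

theorem Rep.sub (hf : Rep P ξ x W f F) (hg : Rep P ξ x W g G) : Rep P ξ x W (f - g) (F.sub G) := by
  rw [sub_eq_add_neg]
  exact hf.add hg.neg

theorem sgn_eq (n : ℕ) : sgn n = if n % 2 = 0 then 1 else -1 := by
  rw [sgn]
  rcases Nat.even_or_odd n with h | h
  · rw [h.neg_one_pow, if_pos (Nat.even_iff.1 h)]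
  · rw [h.neg_one_pow, if_neg (by rw [Nat.odd_iff.1 h]; simp)]

theorem Rep.sign (hf : Rep P ξ x W f F) (n : ℕ) : Rep P ξ x W (sgn n • f) (F.sign n) := by
  rw [sgn_eq, Form.sign_eq]
  split_ifs
  · rw [one_smul]; exact hf
  · rw [neg_one_smul]; exact hf.neg

theorem Rep.half (hf : Rep P ξ x W f F) : Rep P ξ x W ((1 / 2 : ℝ) • f) (F.term (1, [1])) :=
  hf.term _ _ (by simp [monoEval, Params.env])

/-- Weights add, and a factor `ψ` accounts for one extra unit. Since `ψ² = 0`, the extra unit occurs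
at most once in any product, so the four-coefficient shape of `Rep` is preserved. -/
theorem Rep.mul (hf : Rep P ξ x V f F) (hg : Rep P ξ x W g G) (e : V + W = U') :
    Rep P ξ x U' (f * g) (F.mul G) := by
  subst e
  obtain ⟨f0, f1, f2, f3⟩ := hf
  obtain ⟨g0, g1, g2, g3⟩ := hg
  simp only [Rep, mul_empty, mul_singleton, mul_pair, Form.eval_mul, Mask.elim,
    f0, f1, f2, f3, g0, g1, g2, g3, scale_add]
  refine ⟨?_, ?_, ?_, ?_⟩ <;> ring

theorem smul_mul_eq (c : ℝ) (f g : SuperFun) : c • f * g = c • (f * g) := by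
  funext S x
  rw [smul_apply, mul_apply, mul_apply, Finset.mul_sum]
  exact Finset.sum_congr rfl fun T _ => by rw [smul_apply]; ring

/-- The representation of a product with a sign. -/
theorem Rep.signMul (hf : Rep P ξ x V f F) (hg : Rep P ξ x W g G) (n : ℕ) (e : V + W = U') :
    Rep P ξ x U' (sgn n • (f * g)) ((F.sign n).mul G) := by
  rw [← smul_mul_eq]
  exact (hf.sign n).mul hg e

theorem Rep.sum {f : Fin 5 → SuperFun} {F : Fin 5 → Form} (h : ∀ i, Rep P ξ x W (f i) (F i)) :
    Rep P ξ x W (∑ i, f i) (Form.sum F) := by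
  rw [Fin.sum_univ_five, add_assoc, add_assoc, add_assoc]
  exact (h 0).add ((h 1).add ((h 2).add ((h 3).add (h 4))))

/-- The bridge from computation to analysis: an unsimplified formal expression may be replaced by a
tabulated one once the test accepts their difference. -/
theorem Rep.of_isZero (hf : Rep P ξ x W f F) (h : (F.sub G).isZero = true) :
    Rep P ξ x W f G := by
  simp only [Form.isZero, Bool.and_eq_true] at h
  obtain ⟨h0, h1, h2, h3⟩ := h
  have key : ∀ a, isZero ((F.sub G).part a) = true →
      F.eval (P.env ξ (x 2)) a = G.eval (P.env ξ (x 2)) a := fun a h => by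
    have : (F.sub G).eval (P.env ξ (x 2)) a = 0 := polyEval_of_isZero P ξ (x 2) _ h
    rw [Form.sub, Form.eval_add, Form.eval_neg] at this
    linarith
  obtain ⟨f0, f1, f2, f3⟩ := hf
  exact ⟨f0.trans (by rw [key _ h0]), f1.trans (by rw [key _ h1]), f2.trans (by rw [key _ h2]),
    f3.trans (by rw [key _ h3])⟩

theorem Form.eval_pd_three (v : ℕ → ℝ) (F : Form) (a : Mask) : (pd W 3 F).eval v a =
    a.elim (F.eval v .psi) 0 (F.eval v .top) 0 := by
  induction F with
  | nil => cases a <;> rfl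
  | cons t F ih =>
    obtain ⟨b, c, m⟩ := t
    have h : pd W 3 ((b, c, m) :: F) = b.elim (pd W 3 F) ((.one, c, m) :: pd W 3 F) (pd W 3 F)
      ((.chi, c, m) :: pd W 3 F) := rfl
    rw [h]
    cases a <;> cases b <;> simp only [Mask.elim, eval_cons] at ih ⊢ <;> rw [ih] <;> ring

theorem Form.eval_pd_four (v : ℕ → ℝ) (F : Form) (a : Mask) : (pd W 4 F).eval v a =
    a.elim (F.eval v .chi) (-F.eval v .top) 0 0 := by
  induction F with
  | nil => cases a <;> simp [pd, fold, Mask.elim]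
  | cons t F ih =>
    obtain ⟨b, c, m⟩ := t
    have h : pd W 4 ((b, c, m) :: F) = b.elim (pd W 4 F) (pd W 4 F) ((.one, c, m) :: pd W 4 F)
      ((.psi, Int.neg c, m) :: pd W 4 F) := rfl
    rw [h]
    cases a <;> cases b <;>
      simp only [Mask.elim, eval_cons, cast_int_neg] at ih ⊢ <;> rw [ih] <;> ring

/-- Removing `ψ` exposes coefficients of weight `W + 1`, whence the weight 1 of the index `ψ` in
`wt`. The formal odd derivatives do not depend on their weight argument, so `V` is free. -/
theorem Rep.derivOdd_zero (hf : Rep P ξ x W f F) :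
    Rep P ξ x (W + 1) (derivOdd 0 f) (Form.pd V 3 F) := by
  obtain ⟨f0, f1, f2, f3⟩ := hf
  simp [Rep, Form.eval_pd_three, Mask.elim, derivOdd, sgn, f1, f3]

theorem Rep.derivOdd_one (hf : Rep P ξ x W f F) :
    Rep P ξ x W (derivOdd 1 f) (Form.pd V 4 F) := by
  obtain ⟨f0, f1, f2, f3⟩ := hf
  have h : Finset.filter (fun n => n = 0) ({0} : Finset ℕ) = {0} := by decide
  have h' : insert 1 ({0} : Finset ℕ) = {0, 1} := by decide
  simp [Rep, Form.eval_pd_four, Mask.elim, derivOdd, sgn, f2, f3, h, h']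

end Rep

/-! ### Derivatives along the bosonic coordinates -/

/-- Only the variable with index 1 depends on `u`; the remaining ones can be evaluated at `u = 0`,
which leaves a power of `u` times a constant. -/
theorem monoEval_env (P : Params) (ξ : ℕ → ℝ) (i j : ℕ) (m : Mono) (u : ℝ) :
    monoEval (P.env ξ u) (i :: j :: m) =
      (1 / 2) ^ i * (u ^ j * monoEval (fun n => P.env ξ 0 (n + 2)) m) := by
  have h : (fun n => P.env ξ u (n + 2)) = fun n => P.env ξ 0 (n + 2) := by
    funext n; rcases n with _ | _ | _ | _ | _ | _ | n <;> rfl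
  rw [← h]
  rfl

theorem hasDerivAt_monoEval (P : Params) (ξ : ℕ → ℝ) (i j : ℕ) (m : Mono) (u : ℝ) :
    HasDerivAt (fun u => monoEval (P.env ξ u) (i :: j :: m))
      (monoEval (P.env ξ u) (i :: (j - 1) :: m) * j) u := by
  have h : HasDerivAt (fun u : ℝ => u ^ j) (j * u ^ (j - 1)) u := by simpa using hasDerivAt_pow j u
  simp only [monoEval_env]
  refine ((h.mul_const _).const_mul _).congr_deriv ?_
  ring

theorem hasDerivAt_eval {W : ℤ} (P : Params) (ξ : ℕ → ℝ) (F : Form) (a : Mask) (u : ℝ) :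
    HasDerivAt (fun u => F.eval (P.env ξ u) a) ((Form.pd W 2 F).eval (P.env ξ u) a) u := by
  induction F with
  | nil => exact hasDerivAt_const u 0
  | cons t F ih =>
    obtain ⟨b, c, m⟩ := t
    have h : Form.pd W 2 ((b, c, m) :: F) = Form.derivTerm b c m (Form.pd W 2 F) := rfl
    simp only [h, Form.eval_cons]
    rcases m with _ | ⟨i, _ | ⟨j, m⟩⟩
    · simp only [monoEval]
      exact ih.const_add _
    · simp only [monoEval, Params.env]
      exact ih.const_add _
    · refine ((((hasDerivAt_monoEval P ξ i j m u).const_mul (c : ℝ)).const_mul _).add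
        ih).congr_deriv ?_
      rcases j with _ | j
      · simp [Form.derivTerm]
      · show _ = Form.eval (P.env ξ u) a
          ((b, Int.mul c (Int.ofNat (Nat.succ j)), i :: j :: m) :: Form.pd W 2 F)
        rw [Form.eval_cons, Int.mul_def, Int.cast_mul]
        simp only [Nat.add_sub_cancel, Nat.succ_eq_add_one, Int.ofNat_eq_natCast]
        push_cast; ring

theorem Form.eval_pd_zero (P : Params) (ξ : ℕ → ℝ) (u : ℝ) (W : ℤ) (F : Form) (a : Mask) :
    (Form.pd W 0 F).eval (P.env ξ u) a =
      -(a.elim W (W + 1) W (W + 1) : ℝ) / 2 * F.eval (P.env ξ u) a := by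
  induction F with
  | nil => simp [Form.pd, Form.fold]
  | cons t F ih =>
    obtain ⟨b, c, m⟩ := t
    have h : pd W 0 ((b, c, m) :: F) =
      (b, Int.mul (Int.neg (b.elim W (Int.add W 1) W (Int.add W 1))) c, monoMul [1] m) ::
        pd W 0 F := rfl
    rw [h, eval_cons, eval_cons, ih, monoEval_mul]
    cases a <;> cases b <;>
      simp [Mask.elim, Int.mul_def, cast_int_neg, Int.add_def, monoEval, Params.env] <;> ring

theorem fderiv_scale_mul (W : ℤ) (p : ℝ → ℝ) (p' : ℝ) (x : Fin 3 → ℝ)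
    (hp : HasDerivAt p p' (x 2)) (v : Fin 3 → ℝ) :
    fderiv ℝ (fun y => scale W y * p (y 2)) x v =
      v 0 * (-W / 2 * (scale W x * p (x 2))) + v 2 * (scale W x * p') := by
  have h0 : HasFDerivAt (fun y : Fin 3 → ℝ => y 0)
      (ContinuousLinearMap.proj (R := ℝ) (φ := fun _ : Fin 3 => ℝ) 0) x :=
    hasFDerivAt_apply 0 x
  have h2 : HasFDerivAt (fun y : Fin 3 → ℝ => y 2)
      (ContinuousLinearMap.proj (R := ℝ) (φ := fun _ : Fin 3 => ℝ) 2) x :=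
    hasFDerivAt_apply 2 x
  have he : HasDerivAt (fun t : ℝ => Real.exp (-(W * t) / 2)) (scale W x * (-W / 2)) (x 0) := by
    have : HasDerivAt (fun t : ℝ => -(W * t) / 2) (-W / 2 : ℝ) (x 0) := by
      simpa using (((hasDerivAt_id (x 0)).const_mul (W : ℝ)).neg).div_const 2
    simpa [scale] using this.exp
  have h := (he.comp_hasFDerivAt x h0).mul (hp.comp_hasFDerivAt x h2)
  have h' : HasFDerivAt (fun y => scale W y * p (y 2)) _ x := h
  rw [h'.fderiv]
  simp [scale]
  ring

theorem derivEven_apply_congr {U : Set (Fin 3 → ℝ)} (hU : IsOpen U) {h : (Fin 3 → ℝ) → ℝ}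
    {f : SuperFun} {S : Finset ℕ} (hf : ∀ y ∈ U, f S y = h y) {x : Fin 3 → ℝ} (hx : x ∈ U)
    (i : Fin 3) : derivEven i f S x = fderiv ℝ h x (Pi.single i 1) := by
  have : f S =ᶠ[nhds x] h := Filter.eventually_of_mem (hU.mem_nhds hx) hf
  rw [derivEven, this.fderiv_eq]

/-- A representation at one point says nothing about derivatives, so it is required on an open set
with the same `ξ`. Nothing represented in this way depends on `y`, hence the `y`-derivative vanishes
and has every weight. -/
theorem Rep.derivEven {P : Params} {ξ : ℕ → ℝ} {U : Set (Fin 3 → ℝ)} (hU : IsOpen U) {W : ℤ}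
    {f : SuperFun} {F : Form} (hf : ∀ y ∈ U, Rep P ξ y W f F) {x : Fin 3 → ℝ} (hx : x ∈ U) :
    Rep P ξ x W (derivEven 0 f) (Form.pd W 0 F) ∧
    (∀ V, Rep P ξ x V (derivEven 1 f) (Form.pd W 1 F)) ∧
    Rep P ξ x W (derivEven 2 f) (Form.pd W 2 F) := by
  have key : ∀ i S V a, (∀ y ∈ U, f S y = scale V y * F.eval (P.env ξ (y 2)) a) →
      OSp.derivEven i f S x = fderiv ℝ (fun y => scale V y * F.eval (P.env ξ (y 2)) a) x
        (Pi.single i 1) := fun i S V a h => derivEven_apply_congr hU h hx i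
  have h0 := fun i => key i ∅ W .one fun y hy => (hf y hy).1
  have h1 := fun i => key i {0} (W + 1) .psi fun y hy => (hf y hy).2.1
  have h2 := fun i => key i {1} W .chi fun y hy => (hf y hy).2.2.1
  have h3 := fun i => key i {0, 1} (W + 1) .top fun y hy => (hf y hy).2.2.2
  have e := fun V a => fderiv_scale_mul V (fun u => F.eval (P.env ξ u) a) _ x
    (hasDerivAt_eval (W := W) P ξ F a (x 2))
  refine ⟨⟨?_, ?_, ?_, ?_⟩, fun V => ⟨?_, ?_, ?_, ?_⟩, ⟨?_, ?_, ?_, ?_⟩⟩ <;>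
    simp only [h0, h1, h2, h3, e, Form.eval_pd_zero, Mask.elim] <;>
    simp [Form.pd, Form.zero] <;> ring

/-- The weights of the coordinate differentials. -/
def wt : Fin 5 → ℤ
  | 0 => 0
  | 1 => 2
  | 2 => 0
  | 3 => 1
  | 4 => 0

theorem Rep.pd {P : Params} {ξ : ℕ → ℝ} {U : Set (Fin 3 → ℝ)} (hU : IsOpen U) {V W : ℤ}
    {f : SuperFun} {F : Form} (hf : ∀ y ∈ U, Rep P ξ y W f F) {x : Fin 3 → ℝ} (hx : x ∈ U)
    (μ : Fin 5) (e : W + wt μ = V) : Rep P ξ x V (pd μ f) (Form.pd W μ F) := by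
  subst e
  fin_cases μ
  · exact (Rep.derivEven hU hf hx).1.cast (by simp [wt])
  · exact (Rep.derivEven hU hf hx).2.1 _
  · exact (Rep.derivEven hU hf hx).2.2.cast (by simp [wt])
  · exact (hf x hx).derivOdd_zero
  · exact (hf x hx).derivOdd_one.cast (by simp [wt])

theorem Rep.rpd {P : Params} {ξ : ℕ → ℝ} {U : Set (Fin 3 → ℝ)} (hU : IsOpen U) {V W : ℤ}
    {f : SuperFun} {F : Form} (hf : ∀ y ∈ U, Rep P ξ y W f F) {x : Fin 3 → ℝ} (hx : x ∈ U)
    (p : ℕ) (μ : Fin 5) (e : W + wt μ = V) : Rep P ξ x V (rpd p μ f) (Form.rpd p W μ F) :=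
  (Rep.pd hU hf hx μ e).sign _

end OSp

namespace OSp

/-! ### The tensor calculus for formal superfunctions -/

namespace Form

def christoffelLow (G : Fin 5 → Fin 5 → Form) (i j k : Fin 5) : Form :=
  (((rpd (par i + par j) (wt i + wt j) k (G i j)).add
    ((rpd (par i + par k) (wt i + wt k) j (G i k)).sign (par j * par k))).sub
    ((rpd (par j + par k) (wt j + wt k) i (G j k)).sign (par i * (par j + par k)))).term (1, [1])

def christoffel (G M : Fin 5 → Fin 5 → Form) (l j k : Fin 5) : Form :=
  sum fun i => ((M l i).sign (par i)).mul (christoffelLow G i j k)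

def riemann (Γ : Fin 5 → Fin 5 → Fin 5 → Form) (m i j k : Fin 5) : Form :=
  (((rpd (par m + par i + par k) (wt i + wt k - wt m) j (Γ m i k)).sign (par j * par k)).sub
    (rpd (par m + par i + par j) (wt i + wt j - wt m) k (Γ m i j))).add
    (sum fun l => (((Γ m l j).sign (par j * (par i + par l))).mul (Γ l i k)).sub
      (((Γ m l k).sign (par k * (par i + par j + par l))).mul (Γ l i j)))

def ricci (Γ : Fin 5 → Fin 5 → Fin 5 → Form) (i j : Fin 5) : Form :=
  sum fun k => (riemann Γ k i k j).sign (par k * (par i + 1))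

def flux (B : Fin 5 → Fin 5 → Form) (μ ν ρ : Fin 5) : Form :=
  (((pd (wt ν + wt ρ) μ (B ν ρ)).sign (par μ)).add
    ((pd (wt ρ + wt μ) ν (B ρ μ)).sign (par ν + par μ * (par ν + par ρ)))).add
    ((pd (wt μ + wt ν) ρ (B μ ν)).sign (par ρ * (1 + par μ + par ν)))

def raise2 (M : Fin 5 → Fin 5 → Form) (H : Fin 5 → Fin 5 → Fin 5 → Form)
    (σ ρ ν : Fin 5) : Form :=
  sum fun a => sum fun b =>
    ((M ρ b).sign (par a + par b + par σ * (par ρ + par b))).mul ((M σ a).mul (H a b ν))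

def cov1 (Γ : Fin 5 → Fin 5 → Fin 5 → Form) (X : Fin 5 → Form) (DX : Fin 5 → Fin 5 → Form)
    (μ ν : Fin 5) : Form :=
  ((DX μ ν).sign (par μ)).sub (sum fun s => (X s).mul (Γ s μ ν))

def cov3 (Γ H : Fin 5 → Fin 5 → Fin 5 → Form) (κ l μ ν : Fin 5) : Form :=
  ((pd (wt l + wt μ + wt ν) κ (H l μ ν)).sign (par κ)).sub
    ((sum fun s => ((H l μ s).mul (Γ s ν κ)).add
      ((((H l s ν).sign (par ν * (par μ + par s))).mul (Γ s μ κ)).add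
      (((H s μ ν).sign ((par μ + par ν) * (par l + par s))).mul (Γ s l κ)))).sign
      (par κ * (par l + par μ + par ν)))

def divFlux (M : Fin 5 → Fin 5 → Form) (Γ H : Fin 5 → Fin 5 → Fin 5 → Form)
    (μ ν : Fin 5) : Form :=
  sum fun l => sum fun κ => ((M l κ).sign (par l + par κ)).mul (cov3 Γ H κ l μ ν)

def raise (M : Fin 5 → Fin 5 → Form) (X : Fin 5 → Form) (μ : Fin 5) : Form :=
  sum fun l => (X l).mul (M l μ)

def interior (V : Fin 5 → Form) (H : Fin 5 → Fin 5 → Fin 5 → Form) (μ ν : Fin 5) : Form :=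
  sum fun l => ((V l).sign (par l)).mul (H l μ ν)

end Form

section

variable {P : Params} {ξ : ℕ → ℝ} {U : Set (Fin 3 → ℝ)} {x : Fin 3 → ℝ}
  {G M B : Ten2} {Γ H : Ten3} {X : Vec} {Gp Mp Bp : Fin 5 → Fin 5 → Form}
  {Γp Hp : Fin 5 → Fin 5 → Fin 5 → Form} {Xp : Fin 5 → Form}

theorem rep_christoffelLow (hU : IsOpen U)
    (hG : ∀ i j, ∀ y ∈ U, Rep P ξ y (wt i + wt j) (G i j) (Gp i j)) (hx : x ∈ U) (i j k : Fin 5) :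
    Rep P ξ x (wt i + wt j + wt k) (christoffelLow G i j k) (Form.christoffelLow Gp i j k) :=
  (((Rep.rpd hU (hG i j) hx _ k rfl).add
    ((Rep.rpd hU (hG i k) hx _ j (by ring)).sign _)).sub
    ((Rep.rpd hU (hG j k) hx _ i (by ring)).sign _)).half

/-- Stated on all of `U`, because the curvature differentiates the connection once more. -/
theorem rep_christoffel (hU : IsOpen U)
    (hG : ∀ i j, ∀ y ∈ U, Rep P ξ y (wt i + wt j) (G i j) (Gp i j))
    (hM : ∀ i j, ∀ y ∈ U, Rep P ξ y (-wt i - wt j) (M i j) (Mp i j)) (l j k : Fin 5) :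
    ∀ y ∈ U, Rep P ξ y (wt j + wt k - wt l) (christoffel G M l j k)
      (Form.christoffel Gp Mp l j k) := fun y hy =>
  Rep.sum fun i => (hM l i y hy).signMul (rep_christoffelLow hU hG hy i j k) _ (by ring)

theorem rep_riemann (hU : IsOpen U)
    (hΓ : ∀ l j k, ∀ y ∈ U, Rep P ξ y (wt j + wt k - wt l) (Γ l j k) (Γp l j k)) (hx : x ∈ U)
    (m i j k : Fin 5) : Rep P ξ x (wt i + wt j + wt k - wt m) (riemann Γ m i j k)
      (Form.riemann Γp m i j k) :=
  (((Rep.rpd hU (hΓ m i k) hx _ j (by ring)).sign _).sub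
    (Rep.rpd hU (hΓ m i j) hx _ k (by ring))).add
    (Rep.sum fun l => ((hΓ m l j x hx).signMul (hΓ l i k x hx) _ (by ring)).sub
      ((hΓ m l k x hx).signMul (hΓ l i j x hx) _ (by ring)))

theorem rep_ricci (hU : IsOpen U) (hΓ : ∀ l j k, ∀ y ∈ U,
      Rep P ξ y (wt j + wt k - wt l) (christoffel G M l j k) (Γp l j k)) (hx : x ∈ U)
    (i j : Fin 5) : Rep P ξ x (wt i + wt j) (ricci G M i j) (Form.ricci Γp i j) :=
  Rep.sum fun k => ((rep_riemann hU hΓ hx k i k j).cast (by ring)).sign _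

theorem rep_flux (hU : IsOpen U)
    (hB : ∀ i j, ∀ y ∈ U, Rep P ξ y (wt i + wt j) (B i j) (Bp i j)) (μ ν ρ : Fin 5) :
    ∀ y ∈ U, Rep P ξ y (wt μ + wt ν + wt ρ) (flux B μ ν ρ) (Form.flux Bp μ ν ρ) := fun y hy =>
  (((Rep.pd hU (hB ν ρ) hy μ (by ring)).sign _).add
    ((Rep.pd hU (hB ρ μ) hy ν (by ring)).sign _)).add
    ((Rep.pd hU (hB μ ν) hy ρ (by ring)).sign _)

theorem rep_raise2 (hM : ∀ i j, Rep P ξ x (-wt i - wt j) (M i j) (Mp i j))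
    (hH : ∀ i j k, Rep P ξ x (wt i + wt j + wt k) (H i j k) (Hp i j k)) (σ ρ ν : Fin 5) :
    Rep P ξ x (wt ν - wt σ - wt ρ) (raise2 M H σ ρ ν) (Form.raise2 Mp Hp σ ρ ν) :=
  Rep.sum fun a => Rep.sum fun b =>
    (hM ρ b).signMul ((hM σ a).mul (hH a b ν) rfl) _ (by ring)

theorem rep_cov1 {DX : Fin 5 → Fin 5 → Form} (hΓ : ∀ l j k,
      Rep P ξ x (wt j + wt k - wt l) (christoffel G M l j k) (Γp l j k))
    (hX : ∀ i, Rep P ξ x (wt i) (X i) (Xp i)) (μ ν : Fin 5)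
    (hDX : Rep P ξ x (wt μ + wt ν) (pd μ (X ν)) (DX μ ν)) :
    Rep P ξ x (wt μ + wt ν) (cov1 G M X μ ν) (Form.cov1 Γp Xp DX μ ν) :=
  (hDX.sign _).sub (Rep.sum fun s => (hX s).mul (hΓ s μ ν) (by ring))

theorem Rep.add₃ {W : ℤ} {f g h : SuperFun} {F G H : Form} (hf : Rep P ξ x W f F)
    (hg : Rep P ξ x W g G) (hh : Rep P ξ x W h H) : Rep P ξ x W (f + g + h) (F.add (G.add H)) := by
  rw [add_assoc f g h]
  exact hf.add (hg.add hh)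

theorem rep_cov3 (hU : IsOpen U)
    (hΓ : ∀ l j k, ∀ y ∈ U, Rep P ξ y (wt j + wt k - wt l) (Γ l j k) (Γp l j k))
    (hH : ∀ i j k, ∀ y ∈ U, Rep P ξ y (wt i + wt j + wt k) (H i j k) (Hp i j k)) (hx : x ∈ U)
    (κ l μ ν : Fin 5) : Rep P ξ x (wt κ + wt l + wt μ + wt ν) (cov3 Γ H κ l μ ν)
      (Form.cov3 Γp Hp κ l μ ν) :=
  ((Rep.pd hU (hH l μ ν) hx κ (by ring)).sign _).sub
    ((Rep.sum fun s => Rep.add₃ ((hH l μ s x hx).mul (hΓ s ν κ x hx) (by ring))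
      ((hH l s ν x hx).signMul (hΓ s μ κ x hx) _ (by ring))
      ((hH s μ ν x hx).signMul (hΓ s l κ x hx) _ (by ring))).sign _)

theorem rep_divFlux (hU : IsOpen U)
    (hM : ∀ i j, Rep P ξ x (-wt i - wt j) (M i j) (Mp i j)) (hΓ : ∀ l j k, ∀ y ∈ U,
      Rep P ξ y (wt j + wt k - wt l) (christoffel G M l j k) (Γp l j k))
    (hH : ∀ i j k, ∀ y ∈ U, Rep P ξ y (wt i + wt j + wt k) (H i j k) (Hp i j k)) (hx : x ∈ U)
    (μ ν : Fin 5) : Rep P ξ x (wt μ + wt ν) (divFlux G M H μ ν) (Form.divFlux Mp Γp Hp μ ν) :=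
  Rep.sum fun l => Rep.sum fun κ =>
    (hM l κ).signMul (rep_cov3 hU hΓ hH hx κ l μ ν) _ (by ring)

theorem rep_raise (hM : ∀ i j, Rep P ξ x (-wt i - wt j) (M i j) (Mp i j))
    (hX : ∀ i, Rep P ξ x (wt i) (X i) (Xp i)) (μ : Fin 5) :
    Rep P ξ x (-wt μ) (raise M X μ) (Form.raise Mp Xp μ) :=
  Rep.sum fun l => (hX l).mul (hM l μ) (by ring)

theorem rep_interior {V : Vec} {Vp : Fin 5 → Form} (hV : ∀ i, Rep P ξ x (-wt i) (V i) (Vp i))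
    (hH : ∀ i j k, Rep P ξ x (wt i + wt j + wt k) (H i j k) (Hp i j k)) (μ ν : Fin 5) :
    Rep P ξ x (wt μ + wt ν) (interior V H μ ν) (Form.interior Vp Hp μ ν) :=
  Rep.sum fun l => (hV l).signMul (hH l μ ν) _ (by ring)

/-- The left-hand side of the difference of the metric equation and the flux equation. -/
noncomputable def fieldEq (G M : Ten2) (H : Ten3) (X : Vec) (μ ν : Fin 5) : SuperFun :=
  ((ricci G M μ ν + (1 / 4 : ℝ) • ∑ ρ, ∑ σ, H μ ρ σ * raise2 M H σ ρ ν)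
    - (1 / 2 : ℝ) • divFlux G M H μ ν + interior (raise M X) H μ ν) + (2 : ℝ) • cov1 G M X μ ν

end

end OSp

namespace OSp

/-! ### Tables for the backgrounds -/

namespace SPoly

/-- The metric of the backgrounds, for `q = b + a u²`. -/
def metricTable : List (List SPoly) :=
  [[⟨[(1, [1]), (-1, [1, 2, 1, 2])], [], [], []⟩,
    ⟨[(-1, [1, 1, 1, 1, 1]), (-1, [1, 3, 1, 2])], [], [], []⟩,
    ⟨[(1, [1, 1, 1, 2])], [], [], []⟩,
    ⟨[], [(-1, [3, 1, 1, 1, 1]), (-1, [3, 3, 1, 2])], [(-1, [2, 2, 1, 2])], []⟩,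
    ⟨[], [], [(-1, [3, 1, 1, 2])], []⟩],
   [⟨[(-1, [1, 1, 1, 1, 1]), (-1, [1, 3, 1, 2])], [], [], []⟩,
    ⟨[(-1, [1, 0, 1, 0, 2]), (-1, [0, 2, 1, 1, 1]), (-1, [1, 4, 1, 2])], [], [], []⟩,
    ⟨[(1, []), (1, [1, 0, 1, 1, 1]), (1, [1, 2, 1, 2])], [], [], []⟩,
    ⟨[], [(-1, [3, 0, 1, 0, 2]), (-1, [2, 2, 1, 1, 1]), (-1, [3, 4, 1, 2])],
      [(-1, [2, 1, 1, 1, 1]), (-1, [2, 3, 1, 2])], []⟩,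
    ⟨[], [], [(1, [2]), (-1, [3, 0, 1, 1, 1]), (-1, [3, 2, 1, 2])], []⟩],
   [⟨[(1, [1, 1, 1, 2])], [], [], []⟩,
    ⟨[(1, []), (1, [1, 0, 1, 1, 1]), (1, [1, 2, 1, 2])], [], [], []⟩,
    ⟨[(-1, [1, 0, 1, 2])], [], [], []⟩,
    ⟨[], [(1, [2]), (1, [3, 0, 1, 1, 1]), (1, [3, 2, 1, 2])], [(1, [2, 1, 1, 2])], []⟩,
    ⟨[], [], [(1, [3, 0, 1, 2])], []⟩],
   [⟨[], [(-1, [3, 1, 1, 1, 1]), (-1, [3, 3, 1, 2])], [(-1, [2, 2, 1, 2])], []⟩,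
    ⟨[], [(-1, [3, 0, 1, 0, 2]), (-1, [2, 2, 1, 1, 1]), (-1, [3, 4, 1, 2])],
      [(-1, [2, 1, 1, 1, 1]), (-1, [2, 3, 1, 2])], []⟩,
    ⟨[], [(1, [2]), (1, [3, 0, 1, 1, 1]), (1, [3, 2, 1, 2])], [(1, [2, 1, 1, 2])], []⟩,
    zero,
    ⟨[(1, [1])], [], [], [(1, [4]), (-1, [5, 0, 1, 1, 1]), (-1, [5, 2, 1, 2])]⟩],
   [⟨[], [], [(-1, [3, 1, 1, 2])], []⟩,
    ⟨[], [], [(1, [2]), (-1, [3, 0, 1, 1, 1]), (-1, [3, 2, 1, 2])], []⟩,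
    ⟨[], [], [(1, [3, 0, 1, 2])], []⟩,
    ⟨[(-1, [1])], [], [], [(-1, [4]), (1, [5, 0, 1, 1, 1]), (1, [5, 2, 1, 2])]⟩,
    zero]]

/-- The `B`-field of the backgrounds, for `q = b + a u²`. -/
def bfieldTable : List (List SPoly) :=
  [[zero,
    ⟨[(-1, [1, 0, 0, 0, 1, 1]), (-1, [1, 2, 0, 1, 0, 1])], [], [], []⟩,
    ⟨[(-1, [1, 0, 0, 1, 0, 1])], [], [], []⟩,
    ⟨[], [(-1, [3, 0, 0, 0, 1, 1]), (-1, [3, 2, 0, 1, 0, 1])], [(-1, [2, 1, 0, 1, 0, 1])], []⟩,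
    ⟨[], [], [(-1, [3, 0, 0, 1, 0, 1])], []⟩],
   [⟨[(1, [1, 0, 0, 0, 1, 1]), (1, [1, 2, 0, 1, 0, 1])], [], [], []⟩,
    zero,
    ⟨[(-1, [0, 0, 0, 0, 0, 0, 1]), (-1, [0, 1, 0, 1, 0, 1])], [], [], []⟩,
    ⟨[], [], [(-1, [2, 0, 0, 0, 1, 1]), (-1, [2, 2, 0, 1, 0, 1])], []⟩,
    ⟨[], [], [(-1, [2, 0, 0, 0, 0, 0, 1]), (-1, [2, 1, 0, 1, 0, 1])], []⟩],
   [⟨[(1, [1, 0, 0, 1, 0, 1])], [], [], []⟩,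
    ⟨[(1, [0, 0, 0, 0, 0, 0, 1]), (1, [0, 1, 0, 1, 0, 1])], [], [], []⟩,
    zero,
    ⟨[], [(1, [2, 0, 0, 0, 0, 0, 1]), (1, [2, 1, 0, 1, 0, 1])], [(1, [2, 0, 0, 1, 0, 1])], []⟩,
    zero],
   [⟨[], [(1, [3, 0, 0, 0, 1, 1]), (1, [3, 2, 0, 1, 0, 1])], [(1, [2, 1, 0, 1, 0, 1])], []⟩,
    ⟨[], [], [(1, [2, 0, 0, 0, 1, 1]), (1, [2, 2, 0, 1, 0, 1])], []⟩,
    ⟨[], [(-1, [2, 0, 0, 0, 0, 0, 1]), (-1, [2, 1, 0, 1, 0, 1])], [(-1, [2, 0, 0, 1, 0, 1])], []⟩,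
    ⟨[(-1, [1, 0, 0, 0, 1, 1]), (-1, [1, 2, 0, 1, 0, 1])], [], [], [(-1, [3, 0, 0, 0, 1, 1]),
      (-1, [3, 2, 0, 1, 0, 1])]⟩,
    ⟨[(-1, [1, 0, 0, 0, 0, 0, 1]), (-1, [1, 1, 0, 1, 0, 1])], [], [],
      [(-1, [4, 0, 0, 0, 0, 0, 1]), (-1, [4, 1, 0, 1, 0, 1])]⟩],
   [⟨[], [], [(1, [3, 0, 0, 1, 0, 1])], []⟩,
    ⟨[], [], [(1, [2, 0, 0, 0, 0, 0, 1]), (1, [2, 1, 0, 1, 0, 1])], []⟩,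
    zero,
    ⟨[(-1, [1, 0, 0, 0, 0, 0, 1]), (-1, [1, 1, 0, 1, 0, 1])], [], [],
      [(-1, [4, 0, 0, 0, 0, 0, 1]), (-1, [4, 1, 0, 1, 0, 1])]⟩,
    ⟨[(-1, [1, 0, 0, 1, 0, 1])], [], [], []⟩]]

/-- The inverse of the metric. -/
def inverseTable : List (List SPoly) :=
  [[⟨[(2, []), (2, [0, 2, 1, 2, 0, 0, 0, 1])], [], [], []⟩,
    ⟨[(-1, [0, 1, 1, 2, 0, 0, 0, 1])], [], [], [(1, [2, 1, 1, 2, 0, 0, 0, 1])]⟩,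
    ⟨[(1, [0, 1]), (-1, [0, 1, 0, 0, 0, 0, 0, 1]), (1, [0, 3, 1, 2, 0, 0, 0, 1])], [], [], []⟩,
    ⟨[], [], [(-1, [0, 1, 1, 2, 0, 0, 0, 1])], []⟩,
    ⟨[], [], [(1, [0, 2, 1, 2, 0, 0, 0, 1])], []⟩],
   [⟨[(-1, [0, 1, 1, 2, 0, 0, 0, 1])], [], [], [(1, [2, 1, 1, 2, 0, 0, 0, 1])]⟩,
    ⟨[(1, [1, 0, 1, 2, 0, 0, 0, 1])], [], [], [(-1, [2, 0, 1, 2, 0, 0, 0, 1])]⟩,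
    ⟨[(1, [1]), (1, [1, 0, 0, 0, 0, 0, 0, 1]), (-1, [1, 2, 1, 2, 0, 0, 0, 1])], [], [],
      [(-1, [3, 0, 0, 0, 0, 0, 0, 1]), (1, [3, 2, 1, 2, 0, 0, 0, 1])]⟩,
    ⟨[], [], [(1, [1, 0, 1, 2, 0, 0, 0, 1])], []⟩,
    ⟨[], [(-1, [1])], [(-1, [1, 1, 1, 2, 0, 0, 0, 1])], []⟩],
   [⟨[(1, [0, 1]), (-1, [0, 1, 0, 0, 0, 0, 0, 1]), (1, [0, 3, 1, 2, 0, 0, 0, 1])], [], [], []⟩,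
    ⟨[(1, [1]), (1, [1, 0, 0, 0, 0, 0, 0, 1]), (-1, [1, 2, 1, 2, 0, 0, 0, 1])], [], [],
      [(-1, [3, 0, 0, 0, 0, 0, 0, 1]), (1, [3, 2, 1, 2, 0, 0, 0, 1])]⟩,
    ⟨[(1, [1, 0, 1, 0, 2, 0, 0, 1]), (1, [0, 2]), (-1, [0, 2, 0, 0, 0, 0, 0, 1]),
      (1, [1, 4, 1, 2, 0, 0, 0, 1])], [], [], []⟩,
    ⟨[], [], [(1, [1, 0, 0, 0, 0, 0, 0, 1]), (-1, [1, 2, 1, 2, 0, 0, 0, 1])], []⟩,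
    ⟨[], [], [(1, [1, 1]), (-1, [1, 1, 0, 0, 0, 0, 0, 1]), (1, [1, 3, 1, 2, 0, 0, 0, 1])], []⟩],
   [⟨[], [], [(-1, [0, 1, 1, 2, 0, 0, 0, 1])], []⟩,
    ⟨[], [], [(1, [1, 0, 1, 2, 0, 0, 0, 1])], []⟩,
    ⟨[], [], [(1, [1, 0, 0, 0, 0, 0, 0, 1]), (-1, [1, 2, 1, 2, 0, 0, 0, 1])], []⟩,
    zero,
    ⟨[(2, [])], [], [], []⟩],
   [⟨[], [], [(1, [0, 2, 1, 2, 0, 0, 0, 1])], []⟩,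
    ⟨[], [(-1, [1])], [(-1, [1, 1, 1, 2, 0, 0, 0, 1])], []⟩,
    ⟨[], [], [(1, [1, 1]), (-1, [1, 1, 0, 0, 0, 0, 0, 1]), (1, [1, 3, 1, 2, 0, 0, 0, 1])], []⟩,
    ⟨[(-2, [])], [], [], []⟩,
    zero]]

/-- The Levi-Civita connection `Γ^l_{jk}`, `j ≤ k`. -/
def christoffelTable : List (List SPoly) :=
  [[zero,
    ⟨[(-1, [1, 1, 1, 1, 1]), (-1, [1, 3, 1, 2])], [], [], []⟩,
    ⟨[(-1, [1, 1, 1, 2])], [], [], []⟩,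
    ⟨[], [(-1, [3, 1, 1, 1, 1]), (-1, [3, 3, 1, 2])], [(-1, [3, 2, 1, 2])], []⟩,
    zero,
    ⟨[(-1, [0, 0, 1, 0, 2]), (-2, [0, 2, 1, 1, 1]), (-1, [0, 4, 1, 2])], [], [], []⟩,
    ⟨[(1, [])], [], [], []⟩,
    ⟨[], [(-1, [2, 0, 1, 0, 2]), (-1, [1, 2, 1, 1, 1]), (-1, [2, 4, 1, 2])],
      [(-3, [3, 1, 1, 1, 1]), (-3, [3, 3, 1, 2])], []⟩,
    ⟨[], [], [(1, [2]), (-1, [3, 0, 1, 1, 1]), (-1, [3, 2, 1, 2])], []⟩,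
    ⟨[(1, [0, 0, 1, 2])], [], [], []⟩,
    ⟨[], [(1, [2])], [(-1, [3, 1, 1, 2])], []⟩,
    ⟨[], [], [(-1, [3, 0, 1, 2])], []⟩,
    zero,
    ⟨[(1, [2])], [], [], [(1, [4]), (-1, [5, 0, 1, 1, 1]), (-1, [5, 2, 1, 2])]⟩,
    zero],
   [⟨[(1, [1, 1, 1, 2])], [], [], [(-1, [4, 1, 1, 2])]⟩,
    ⟨[(-1, [1]), (1, [2, 0, 1, 1, 1]), (3, [2, 2, 1, 2])], [], [], [(-1, [5, 0, 1, 1, 1]),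
      (-3, [5, 2, 1, 2])]⟩,
    ⟨[(-1, [2, 0, 1, 2])], [], [], [(1, [5, 0, 1, 2])]⟩,
    ⟨[], [(-1, [4]), (1, [4, 0, 1, 1, 1]), (1, [3, 2, 1, 2])], [(1, [2, 1, 1, 2])], []⟩,
    ⟨[], [(-1, [4, 1, 1, 2])], [(1, [4, 0, 1, 2])], []⟩,
    ⟨[(1, [0, 1, 1, 1, 1]), (1, [0, 3, 1, 2])], [], [], [(-1, [3, 1, 1, 1, 1]),
      (-1, [3, 3, 1, 2])]⟩,
    ⟨[(-1, [1, 1, 1, 2])], [], [], [(1, [4, 1, 1, 2])]⟩,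
    ⟨[], [(3, [4, 1, 1, 1, 1]), (3, [4, 3, 1, 2])], [(1, [3, 0, 1, 1, 1]), (3, [3, 2, 1, 2])],
      []⟩,
    ⟨[], [(1, [3]), (-1, [4, 0, 1, 1, 1]), (-1, [4, 2, 1, 2])], [(1, [3, 1, 1, 2])], []⟩,
    zero,
    ⟨[], [(-1, [4, 1, 1, 2])], [(-1, [3, 0, 1, 2])], []⟩,
    ⟨[], [(1, [4, 0, 1, 2])], [], []⟩,
    zero,
    ⟨[], [], [], [(3, [6, 1, 1, 2])]⟩,
    zero],
   [⟨[(1, [1, 1, 1, 1, 1]), (1, [1, 3, 1, 2])], [], [], []⟩,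
    ⟨[(1, [2, 0, 1, 0, 2]), (1, [1, 2, 1, 1, 1]), (1, [2, 4, 1, 2])], [], [], []⟩,
    ⟨[(-1, [1]), (-1, [2, 0, 1, 1, 1]), (-3, [2, 2, 1, 2])], [], [], []⟩,
    ⟨[], [(1, [4, 0, 1, 0, 2]), (1, [3, 2, 1, 1, 1]), (1, [4, 4, 1, 2])], [(3, [4, 1, 1, 1, 1]),
      (3, [4, 3, 1, 2])], []⟩,
    ⟨[], [], [(-1, [4]), (1, [4, 0, 1, 1, 1]), (1, [3, 2, 1, 2])], []⟩,
    zero,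
    ⟨[(-1, [1, 1, 1, 1, 1]), (-1, [1, 3, 1, 2])], [], [], []⟩,
    ⟨[], [], [(1, [4, 0, 1, 0, 2]), (1, [3, 2, 1, 1, 1]), (1, [4, 4, 1, 2])], []⟩,
    ⟨[], [], [(1, [4, 1, 1, 1, 1]), (1, [4, 3, 1, 2])], []⟩,
    ⟨[(1, [0, 1, 1, 2])], [], [], []⟩,
    ⟨[], [(-1, [3, 1, 1, 1, 1]), (-1, [3, 3, 1, 2])], [(-1, [3]), (-1, [4, 0, 1, 1, 1]),
      (-5, [4, 2, 1, 2])], []⟩,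
    ⟨[], [], [(-3, [4, 1, 1, 2])], []⟩,
    zero,
    ⟨[], [], [], [(1, [6, 1, 1, 1, 1]), (1, [6, 3, 1, 2])]⟩,
    zero],
   [⟨[], [], [(1, [2, 1, 1, 2])], []⟩,
    ⟨[], [], [(1, [3, 0, 1, 1, 1]), (3, [3, 2, 1, 2])], []⟩,
    ⟨[], [], [(-1, [3, 0, 1, 2])], []⟩,
    ⟨[(-1, [2]), (1, [2, 2, 1, 2])], [], [], [(-1, [5, 0, 1, 1, 1]), (-3, [5, 2, 1, 2])]⟩,
    ⟨[(1, [2, 1, 1, 2])], [], [], []⟩,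
    ⟨[], [], [(1, [1, 1, 1, 1, 1]), (1, [1, 3, 1, 2])], []⟩,
    ⟨[], [], [(-1, [2, 1, 1, 2])], []⟩,
    ⟨[(1, [2, 1, 1, 1, 1]), (1, [2, 3, 1, 2])], [], [], [(-1, [3, 1, 1, 1, 1]),
      (-1, [3, 3, 1, 2])]⟩,
    ⟨[(-1, [1]), (1, [2, 0, 1, 1, 1]), (1, [2, 2, 1, 2])], [], [], []⟩,
    zero,
    ⟨[(-1, [2, 1, 1, 2])], [], [], [(1, [4, 1, 1, 2])]⟩,
    ⟨[(-1, [2, 0, 1, 2])], [], [], []⟩,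
    zero,
    ⟨[], [(1, [3]), (-1, [4, 0, 1, 1, 1]), (-1, [4, 2, 1, 2])], [(-1, [4, 1, 1, 2])], []⟩,
    zero],
   [⟨[], [], [(1, [2, 2, 1, 2])], []⟩,
    ⟨[], [], [(1, [3, 1, 1, 1, 1]), (1, [3, 3, 1, 2])], []⟩,
    ⟨[], [], [(-3, [3, 1, 1, 2])], []⟩,
    ⟨[(-1, [2, 1, 1, 1, 1]), (-1, [2, 3, 1, 2])], [], [], [(-1, [5, 1, 1, 1, 1]),
      (-1, [5, 3, 1, 2])]⟩,
    ⟨[(-1, [2]), (-1, [2, 2, 1, 2])], [], [], []⟩,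
    zero,
    ⟨[], [], [(-1, [2, 0, 1, 1, 1]), (-1, [2, 2, 1, 2])], []⟩,
    ⟨[(-1, [2, 0, 1, 0, 2]), (-1, [1, 2, 1, 1, 1]), (-1, [2, 4, 1, 2])], [], [], []⟩,
    ⟨[(-1, [2, 1, 1, 1, 1]), (-1, [2, 3, 1, 2])], [], [], []⟩,
    ⟨[], [], [(1, [1, 0, 1, 2])], []⟩,
    ⟨[(1, [1]), (1, [2, 0, 1, 1, 1]), (1, [2, 2, 1, 2])], [], [], [(1, [4, 0, 1, 1, 1]),
      (1, [4, 2, 1, 2])]⟩,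
    ⟨[(1, [2, 1, 1, 2])], [], [], []⟩,
    zero,
    ⟨[], [(1, [4, 1, 1, 1, 1]), (1, [4, 3, 1, 2])], [(1, [3]), (-1, [4, 0, 1, 1, 1]),
      (1, [4, 2, 1, 2])], []⟩,
    zero]]

/-- The components `H^{jk}_l`, `j ≤ k`. -/
def raise2Table : List (List SPoly) :=
  [[zero,
    ⟨[(-1, [0, 1, 1, 2, 0, 0, 1, 1])], [], [], [(1, [3, 1, 1, 2, 0, 0, 1, 1])]⟩,
    ⟨[(-1, [0, 1, 0, 0, 0, 0, 1]), (1, [0, 1, 0, 0, 0, 0, 1, 1]),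
      (-1, [0, 3, 1, 2, 0, 0, 1, 1])], [], [], []⟩,
    ⟨[], [], [(-1, [1, 1, 1, 2, 0, 0, 1, 1])], []⟩,
    ⟨[], [], [(-1, [1, 2, 1, 2, 0, 0, 1, 1])], []⟩,
    zero,
    ⟨[(-1, [0, 0, 0, 0, 0, 0, 1, 1]), (1, [0, 2, 1, 2, 0, 0, 1, 1])], [], [],
      [(-1, [3, 0, 0, 0, 0, 0, 1]), (3, [4, 0, 0, 0, 0, 0, 1, 1]), (-1, [3, 1, 0, 1, 0, 1]),
      (-3, [4, 2, 1, 2, 0, 0, 1, 1])]⟩,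
    ⟨[], [(1, [2, 0, 0, 1, 0, 1])], [(-1, [2, 0, 1, 2, 0, 0, 1, 1])], []⟩,
    ⟨[], [(1, [2, 0, 0, 0, 0, 0, 1])], [(1, [2, 0, 0, 1, 0, 1]), (3, [2, 1, 1, 2, 0, 0, 1, 1])],
      []⟩,
    zero,
    ⟨[], [], [(-1, [1, 0, 0, 0, 0, 0, 1]), (3, [2, 0, 0, 0, 0, 0, 1, 1]),
      (-1, [1, 1, 0, 1, 0, 1]), (-3, [2, 2, 1, 2, 0, 0, 1, 1])], []⟩,
    ⟨[], [], [(1, [1, 0, 0, 0, 1, 1]), (1, [2, 1, 0, 0, 0, 0, 1]),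
      (-1, [2, 1, 0, 0, 0, 0, 1, 1]), (1, [1, 2, 0, 1, 0, 1]), (1, [2, 3, 1, 2, 0, 0, 1, 1])],
      []⟩,
    ⟨[(-1, [0, 0, 0, 1, 0, 1])], [], [], []⟩,
    ⟨[(-1, [0, 0, 0, 0, 0, 0, 1])], [], [], []⟩,
    ⟨[(1, [0, 0, 0, 0, 1, 1]), (1, [0, 2, 0, 1, 0, 1])], [], [], []⟩],
   [zero,
    ⟨[(-1, [0, 0, 0, 0, 0, 0, 1]), (-1, [0, 0, 0, 0, 0, 0, 1, 1]),
      (-1, [0, 2, 1, 2, 0, 0, 1, 1])], [], [], [(-1, [2, 0, 0, 0, 0, 0, 1]),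
      (1, [2, 0, 0, 0, 0, 0, 1, 1]), (-1, [2, 1, 0, 1, 0, 1])]⟩,
    ⟨[(-1, [0, 0, 1, 0, 2, 0, 1, 1]), (-2, [0, 2, 0, 0, 0, 0, 1]), (2, [0, 2, 0, 0, 0, 0, 1, 1]),
      (-1, [0, 4, 1, 2, 0, 0, 1, 1])], [], [], []⟩,
    ⟨[], [], [(1, [0, 0, 0, 0, 0, 0, 1]), (-1, [0, 0, 0, 0, 0, 0, 1, 1]),
      (1, [0, 1, 0, 1, 0, 1])], []⟩,
    ⟨[], [], [(-3, [1, 0, 0, 0, 1, 1]), (-1, [0, 1, 0, 0, 0, 0, 1]),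
      (1, [0, 1, 0, 0, 0, 0, 1, 1]), (-3, [1, 2, 0, 1, 0, 1]), (-1, [0, 3, 1, 2, 0, 0, 1, 1])],
      []⟩,
    zero,
    ⟨[(1, [0, 1, 0, 0, 0, 0, 1]), (-1, [0, 1, 0, 0, 0, 0, 1, 1]), (1, [0, 3, 1, 2, 0, 0, 1, 1])],
      [], [], [(-1, [4, 0, 0, 0, 1, 1]), (-1, [3, 1, 0, 0, 0, 0, 1]),
      (1, [3, 1, 0, 0, 0, 0, 1, 1]), (-1, [4, 2, 0, 1, 0, 1]), (-1, [3, 3, 1, 2, 0, 0, 1, 1])]⟩,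
    ⟨[], [(1, [1, 0, 0, 0, 0, 0, 1]), (1, [1, 1, 0, 1, 0, 1])], [(-1, [1, 0, 0, 1, 0, 1]),
      (-1, [1, 1, 1, 2, 0, 0, 1, 1])], []⟩,
    ⟨[], [(-1, [2, 0, 0, 0, 1, 1]), (-1, [2, 2, 0, 1, 0, 1])], [(1, [0, 1, 0, 1, 0, 1]),
      (1, [0, 2, 1, 2, 0, 0, 1, 1])], []⟩,
    zero,
    ⟨[], [], [(-1, [2, 0, 0, 0, 1, 1]), (-1, [1, 1, 0, 0, 0, 0, 1]),
      (1, [1, 1, 0, 0, 0, 0, 1, 1]), (-1, [2, 2, 0, 1, 0, 1]), (-1, [1, 3, 1, 2, 0, 0, 1, 1])],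
      []⟩,
    zero,
    ⟨[(-2, [0, 0, 0, 0, 0, 0, 1]), (-2, [0, 1, 0, 1, 0, 1])], [], [], []⟩,
    ⟨[(1, [0, 0, 0, 0, 1, 1]), (1, [0, 2, 0, 1, 0, 1])], [], [], []⟩,
    zero],
   [zero,
    ⟨[(1, [0, 0, 1, 2, 0, 0, 1, 1])], [], [], [(-1, [2, 0, 1, 2, 0, 0, 1, 1])]⟩,
    ⟨[(1, [0, 0, 0, 0, 0, 0, 1]), (1, [0, 0, 0, 0, 0, 0, 1, 1]), (1, [0, 2, 1, 2, 0, 0, 1, 1])],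
      [], [], []⟩,
    ⟨[], [], [(1, [0, 0, 1, 2, 0, 0, 1, 1])], []⟩,
    ⟨[], [], [(-1, [1, 0, 0, 1, 0, 1])], []⟩,
    zero,
    ⟨[(-1, [0, 1, 1, 2, 0, 0, 1, 1])], [], [], [(1, [4, 0, 0, 1, 0, 1]),
      (1, [2, 1, 1, 2, 0, 0, 1, 1])]⟩,
    zero,
    ⟨[], [(-1, [2, 0, 0, 1, 0, 1])], [(-1, [1, 0, 1, 2, 0, 0, 1, 1])], []⟩,
    zero,
    ⟨[], [], [(1, [2, 0, 0, 1, 0, 1]), (1, [0, 1, 1, 2, 0, 0, 1, 1])], []⟩,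
    ⟨[], [], [(-1, [1, 0, 0, 0, 0, 0, 1, 1]), (-1, [1, 1, 0, 1, 0, 1]),
      (-1, [1, 2, 1, 2, 0, 0, 1, 1])], []⟩,
    zero,
    ⟨[(1, [0, 0, 0, 1, 0, 1])], [], [], []⟩,
    ⟨[(2, [0, 0, 0, 0, 0, 0, 1]), (-2, [0, 1, 0, 1, 0, 1])], [], [], []⟩],
   [zero,
    ⟨[], [(-1, [2, 0, 0, 0, 0, 0, 1, 1])], [(1, [2, 0, 0, 1, 0, 1]),
      (-1, [2, 1, 1, 2, 0, 0, 1, 1])], []⟩,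
    ⟨[], [(-1, [2, 0, 1, 0, 2, 0, 1, 1]), (-1, [1, 2, 0, 0, 0, 0, 1]),
      (1, [1, 2, 0, 0, 0, 0, 1, 1]), (-1, [2, 4, 1, 2, 0, 0, 1, 1])], [(1, [1, 0, 0, 0, 1, 1]),
      (-1, [1, 1, 0, 0, 0, 0, 1]), (1, [1, 1, 0, 0, 0, 0, 1, 1]), (1, [1, 2, 0, 1, 0, 1]),
      (-1, [1, 3, 1, 2, 0, 0, 1, 1])], []⟩,
    ⟨[(-1, [0, 0, 0, 0, 0, 0, 1]), (-1, [0, 2, 1, 2, 0, 0, 1, 1])], [], [],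
      [(-1, [2, 0, 0, 0, 0, 0, 1]), (1, [2, 0, 0, 0, 0, 0, 1, 1]), (-1, [2, 1, 0, 1, 0, 1])]⟩,
    ⟨[(1, [0, 0, 0, 0, 1, 1]), (1, [0, 1, 0, 0, 0, 0, 1]), (-1, [0, 1, 0, 0, 0, 0, 1, 1]),
      (1, [0, 2, 0, 1, 0, 1]), (1, [0, 3, 1, 2, 0, 0, 1, 1])], [], [], [(3, [3, 0, 0, 0, 1, 1]),
      (1, [2, 1, 0, 0, 0, 0, 1]), (-1, [2, 1, 0, 0, 0, 0, 1, 1]), (3, [3, 2, 0, 1, 0, 1]),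
      (1, [2, 3, 1, 2, 0, 0, 1, 1])]⟩,
    zero,
    ⟨[], [(1, [3, 0, 0, 0, 1, 1]), (1, [3, 1, 0, 0, 0, 0, 1]), (-1, [3, 1, 0, 0, 0, 0, 1, 1]),
      (1, [3, 2, 0, 1, 0, 1]), (1, [3, 3, 1, 2, 0, 0, 1, 1])], [(1, [3, 0, 0, 0, 0, 0, 1]),
      (-3, [3, 0, 0, 0, 0, 0, 1, 1]), (-1, [2, 1, 0, 1, 0, 1]), (3, [3, 2, 1, 2, 0, 0, 1, 1])],
      []⟩,
    ⟨[(1, [1, 0, 0, 1, 0, 1]), (1, [1, 1, 1, 2, 0, 0, 1, 1])], [], [],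
      [(-1, [3, 1, 1, 2, 0, 0, 1, 1])]⟩,
    ⟨[(1, [1, 0, 0, 0, 0, 0, 1]), (1, [1, 0, 0, 0, 0, 0, 1, 1]), (-1, [0, 1, 0, 1, 0, 1]),
      (-1, [1, 2, 1, 2, 0, 0, 1, 1])], [], [], [(1, [3, 0, 0, 0, 0, 0, 1]),
      (-1, [3, 0, 0, 0, 0, 0, 1, 1])]⟩,
    zero,
    ⟨[(1, [1, 0, 0, 0, 1, 1]), (-1, [1, 1, 0, 0, 0, 0, 1]), (1, [1, 1, 0, 0, 0, 0, 1, 1]),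
      (1, [1, 2, 0, 1, 0, 1]), (-1, [1, 3, 1, 2, 0, 0, 1, 1])], [], [], [(1, [4, 0, 0, 0, 1, 1]),
      (1, [3, 1, 0, 0, 0, 0, 1]), (-1, [3, 1, 0, 0, 0, 0, 1, 1]), (1, [4, 2, 0, 1, 0, 1]),
      (1, [3, 3, 1, 2, 0, 0, 1, 1])]⟩,
    ⟨[(1, [1, 0, 1, 0, 2, 0, 1, 1]), (1, [0, 2, 0, 0, 0, 0, 1]), (-1, [0, 2, 0, 0, 0, 0, 1, 1]),
      (1, [1, 4, 1, 2, 0, 0, 1, 1])], [], [], []⟩,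
    ⟨[], [(-1, [1, 0, 0, 0, 0, 0, 1]), (-1, [1, 1, 0, 1, 0, 1])], [(1, [1, 0, 0, 1, 0, 1]),
      (1, [0, 1, 1, 2, 0, 0, 1, 1])], []⟩,
    ⟨[], [(1, [2, 0, 0, 0, 1, 1]), (1, [2, 2, 0, 1, 0, 1])], [(-1, [1, 0, 0, 0, 0, 0, 1]),
      (1, [1, 0, 0, 0, 0, 0, 1, 1]), (-1, [0, 1, 0, 1, 0, 1]), (-1, [0, 2, 1, 2, 0, 0, 1, 1])],
      []⟩,
    ⟨[], [], [(3, [1, 0, 0, 0, 1, 1]), (1, [0, 1, 0, 0, 0, 0, 1]),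
      (-1, [0, 1, 0, 0, 0, 0, 1, 1]), (3, [1, 2, 0, 1, 0, 1]), (1, [0, 3, 1, 2, 0, 0, 1, 1])],
      []⟩],
   [zero,
    ⟨[], [(-1, [2, 0, 0, 1, 0, 1]), (1, [2, 1, 1, 2, 0, 0, 1, 1])], [], []⟩,
    ⟨[], [], [(1, [2, 0, 0, 0, 0, 0, 1]), (1, [1, 1, 0, 1, 0, 1]),
      (-1, [2, 2, 1, 2, 0, 0, 1, 1])], []⟩,
    ⟨[(1, [0, 0, 0, 1, 0, 1]), (-1, [0, 1, 1, 2, 0, 0, 1, 1])], [], [], []⟩,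
    ⟨[(1, [0, 0, 0, 0, 0, 0, 1]), (1, [0, 2, 1, 2, 0, 0, 1, 1])], [], [], []⟩,
    zero,
    ⟨[], [(1, [3, 0, 0, 0, 0, 0, 1]), (1, [3, 0, 0, 0, 0, 0, 1, 1]), (1, [2, 1, 0, 1, 0, 1]),
      (-1, [3, 2, 1, 2, 0, 0, 1, 1])], [(-1, [3, 0, 0, 1, 0, 1]), (1, [3, 1, 1, 2, 0, 0, 1, 1])],
      []⟩,
    ⟨[(1, [1, 0, 1, 2, 0, 0, 1, 1])], [], [], [(-1, [2, 0, 1, 2, 0, 0, 1, 1])]⟩,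
    ⟨[(-1, [1, 0, 0, 1, 0, 1]), (-1, [1, 1, 1, 2, 0, 0, 1, 1])], [], [],
      [(1, [4, 0, 0, 1, 0, 1]), (1, [2, 1, 1, 2, 0, 0, 1, 1])]⟩,
    zero,
    ⟨[(1, [1, 0, 0, 0, 0, 0, 1]), (1, [1, 0, 0, 0, 0, 0, 1, 1]), (1, [0, 1, 0, 1, 0, 1]),
      (-1, [1, 2, 1, 2, 0, 0, 1, 1])], [], [], []⟩,
    ⟨[(-1, [1, 0, 0, 0, 1, 1]), (1, [1, 1, 0, 0, 0, 0, 1]), (-1, [1, 1, 0, 0, 0, 0, 1, 1]),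
      (-1, [1, 2, 0, 1, 0, 1]), (1, [1, 3, 1, 2, 0, 0, 1, 1])], [], [], []⟩,
    ⟨[], [], [(1, [0, 0, 1, 2, 0, 0, 1, 1])], []⟩,
    ⟨[], [], [(-1, [2, 0, 0, 1, 0, 1]), (-1, [0, 1, 1, 2, 0, 0, 1, 1])], []⟩,
    ⟨[], [], [(1, [1, 0, 0, 0, 0, 0, 1]), (1, [1, 1, 0, 1, 0, 1]),
      (1, [0, 2, 1, 2, 0, 0, 1, 1])], []⟩]]

/-- The flux `H_{ijk}`, `i ≤ j ≤ k`, with the key `25 i + 5 j + k`. -/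
def fluxTable : List (ℕ × SPoly) :=
  [(7, ⟨[(1, [0, 0, 0, 0, 0, 0, 1])], [], [], []⟩),
   (8, ⟨[], [], [(3, [3, 0, 0, 0, 1, 1]), (3, [3, 2, 0, 1, 0, 1])], []⟩),
   (9, ⟨[], [], [(1, [2, 0, 0, 0, 0, 0, 1]), (1, [2, 1, 0, 1, 0, 1])], []⟩),
   (13, ⟨[], [(-1, [2, 0, 0, 0, 0, 0, 1])], [(1, [3, 0, 0, 1, 0, 1])], []⟩),
   (18, ⟨[(1, [2, 0, 0, 0, 1, 1]), (1, [2, 2, 0, 1, 0, 1])], [], [], [(3, [4, 0, 0, 0, 1, 1]),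
     (3, [4, 2, 0, 1, 0, 1])]⟩),
   (19, ⟨[(1, [2, 0, 0, 0, 0, 0, 1])], [], [], [(1, [4, 0, 0, 0, 0, 0, 1]),
     (1, [4, 1, 0, 1, 0, 1])]⟩),
   (24, ⟨[(-1, [2, 0, 0, 1, 0, 1])], [], [], []⟩),
   (38, ⟨[], [], [(1, [1, 1, 0, 1, 0, 1])], []⟩),
   (39, ⟨[], [], [(1, [2, 0, 0, 1, 0, 1])], []⟩),
   (44, ⟨[(-1, [2, 0, 0, 0, 1, 1]), (-1, [2, 2, 0, 1, 0, 1])], [], [], []⟩),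
   (49, ⟨[(-1, [1, 0, 0, 0, 0, 0, 1]), (-1, [1, 1, 0, 1, 0, 1])], [], [], []⟩),
   (68, ⟨[(1, [1, 0, 0, 0, 0, 0, 1]), (-1, [1, 1, 0, 1, 0, 1])], [], [],
     [(-1, [2, 1, 0, 1, 0, 1])]⟩),
   (69, ⟨[(-1, [2, 0, 0, 1, 0, 1])], [], [], [(-1, [4, 0, 0, 1, 0, 1])]⟩),
   (93, ⟨[], [], [(3, [3, 0, 0, 0, 1, 1]), (3, [3, 2, 0, 1, 0, 1])], []⟩),
   (94, ⟨[], [(-1, [3, 0, 0, 0, 1, 1]), (-1, [3, 2, 0, 1, 0, 1])], [(1, [3, 0, 0, 0, 0, 0, 1]),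
     (1, [3, 1, 0, 1, 0, 1])], []⟩),
   (99, ⟨[], [(-1, [3, 0, 0, 0, 0, 0, 1]), (-1, [3, 1, 0, 1, 0, 1])], [], []⟩)]

def entry (L : List (List SPoly)) (i j : ℕ) : SPoly := (L.getD i []).getD j zero

def lookup : List (ℕ × SPoly) → ℕ → SPoly
  | [], _ => zero
  | (m, F) :: L, n => bif Nat.beq m n then F else lookup L n

end SPoly

namespace Form

def metric (i j : Fin 5) : Form := (SPoly.entry SPoly.metricTable i j).form

def bfield (i j : Fin 5) : Form := (SPoly.entry SPoly.bfieldTable i j).form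

def inverse (i j : Fin 5) : Form := (SPoly.entry SPoly.inverseTable i j).form

/-- The position of the pair `j ≤ k`. -/
def pairIndex (j k : ℕ) : ℕ := j * (9 - j) / 2 + k

/-- Only ordered index pairs are stored. The others follow from the graded symmetry of the
connection in its lower indices; for `raised` and `field` the extra 1 in the exponent expresses
graded antisymmetry. -/
def gamma (l j k : Fin 5) : Form :=
  bif Nat.ble j k then (SPoly.entry SPoly.christoffelTable l (pairIndex j k)).form
  else (SPoly.entry SPoly.christoffelTable l (pairIndex k j)).form.sign (par j * par k)

def raised (j k l : Fin 5) : Form :=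
  bif Nat.ble j k then (SPoly.entry SPoly.raise2Table l (pairIndex j k)).form
  else (SPoly.entry SPoly.raise2Table l (pairIndex k j)).form.sign (1 + par j * par k)

/-- The flux `H_{ijk}` for `j ≤ k`. -/
def fluxAux (i j k : Fin 5) : Form :=
  bif Nat.ble i j then (SPoly.lookup SPoly.fluxTable (25 * i + 5 * j + k)).form
  else bif Nat.ble i k then
    (SPoly.lookup SPoly.fluxTable (25 * j + 5 * i + k)).form.sign (1 + par i * par j)
  else (SPoly.lookup SPoly.fluxTable (25 * j + 5 * k + i)).form.sign (par i * (par j + par k))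

def field (i j k : Fin 5) : Form :=
  bif Nat.ble j k then fluxAux i j k else (fluxAux i k j).sign (1 + par j * par k)

/-- Conjunction over the indices. -/
def all (p : Fin 5 → Bool) : Bool := p 0 && (p 1 && (p 2 && (p 3 && p 4)))

theorem of_all {p : Fin 5 → Bool} (h : all p = true) (i : Fin 5) : p i = true := by
  simp only [all, Bool.and_eq_true] at h
  obtain ⟨h0, h1, h2, h3, h4⟩ := h
  fin_cases i <;> assumption

/-- The tables are certified here and in the next checks by recomputation. Later computations start
from these short entries instead of nested unsimplified expressions. -/
theorem gamma_check : (all fun l => all fun j => all fun k =>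
    ((christoffel metric inverse l j k).sub (gamma l j k)).isZero) = true := by
  decide +kernel

theorem field_check : (all fun i => all fun j => all fun k =>
    ((flux bfield i j k).sub (field i j k)).isZero) = true := by
  decide +kernel

theorem raised_check : (all fun j => all fun k => all fun l =>
    ((raise2 inverse field j k l).sub (raised j k l)).isZero) = true := by
  decide +kernel

def unit : Form := [(.one, 1, [])]

theorem inverse_check : (all fun κ => all fun μ => (((sum fun l =>
      ((metric κ l).sign (par κ)).mul (inverse l μ)).sub
      (bif κ.val == μ.val then unit else zero)).isZero &&
    ((sum fun l => ((inverse κ l).sign (par l)).mul (metric l μ)).sub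
      (bif κ.val == μ.val then unit else zero)).isZero)) = true := by
  decide +kernel

end Form

end OSp

namespace OSp

/-! ### Superfunctions given by polynomials -/

/-- The superfunction of weight `W` given by a formal superfunction. -/
noncomputable def Form.toSuper (P : Params) (ξ : ℕ → ℝ) (W : ℤ) (F : Form) : SuperFun :=
  fun S x =>
  if S = ∅ then scale W x * F.eval (P.env ξ (x 2)) .one
  else if S = {0} then scale (W + 1) x * F.eval (P.env ξ (x 2)) .psi
  else if S = {1} then scale W x * F.eval (P.env ξ (x 2)) .chi
  else if S = {0, 1} then scale (W + 1) x * F.eval (P.env ξ (x 2)) .top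
  else 0

theorem rep_toSuper (P : Params) (ξ : ℕ → ℝ) (W : ℤ) (F : Form) (x : Fin 3 → ℝ) :
    Rep P ξ x W (F.toSuper P ξ W) F := by
  have h1 : ({1} : Finset ℕ) ≠ {0} := by decide
  have h2 : ({0, 1} : Finset ℕ) ≠ {0} := by decide
  have h3 : ({0, 1} : Finset ℕ) ≠ {1} := by decide
  have h4 : ({0, 1} : Finset ℕ) ≠ ∅ := by decide
  exact ⟨rfl, by simp [Form.toSuper], by simp [Form.toSuper, h1],
    by simp [Form.toSuper, h2, h3, h4]⟩

theorem supported_toSuper (P : Params) (ξ : ℕ → ℝ) (W : ℤ) (F : Form) :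
    Supported (F.toSuper P ξ W) := fun S hS x => by
  simp only [Form.toSuper]
  split_ifs with h0 h1 h2 h3
  · exact absurd (by rw [h0]; decide) hS
  · exact absurd (by rw [h1]; decide) hS
  · exact absurd (by rw [h2]; decide) hS
  · exact absurd (by rw [h3]) hS
  · rfl

/-- The derivative is again the value of a formal superfunction, so the order of differentiability
can be raised by induction for all `F` at once. -/
theorem Form.contDiff_eval (P : Params) (ξ : ℕ → ℝ) (F : Form) (a : Mask) :
    ContDiff ℝ (⊤ : ℕ∞) fun u => F.eval (P.env ξ u) a := by
  refine contDiff_infty.2 fun n => ?_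
  induction n generalizing F with
  | zero =>
    exact contDiff_zero.2 (continuous_iff_continuousAt.2 fun u =>
      (hasDerivAt_eval (W := 0) P ξ F a u).continuousAt)
  | succ n ih =>
    push_cast
    rw [contDiff_succ_iff_deriv]
    refine ⟨fun u => (hasDerivAt_eval (W := 0) P ξ F a u).differentiableAt, by simp, ?_⟩
    rw [funext fun u => (hasDerivAt_eval (W := 0) P ξ F a u).deriv]
    exact ih _

theorem contDiff_scale (W : ℤ) : ContDiff ℝ (⊤ : ℕ∞) (scale W) := by
  unfold scale
  fun_prop

theorem smooth_toSuper (P : Params) (ξ : ℕ → ℝ) (W : ℤ) (F : Form) (U : Set (Fin 3 → ℝ)) :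
    Smooth U (F.toSuper P ξ W) := fun S => by
  have hp : ∀ a, ContDiff ℝ (⊤ : ℕ∞) fun x : Fin 3 → ℝ => F.eval (P.env ξ (x 2)) a :=
    fun a => (F.contDiff_eval P ξ a).comp (contDiff_apply ℝ ℝ (2 : Fin 3))
  refine ContDiff.contDiffOn ?_
  show ContDiff ℝ (⊤ : ℕ∞) fun x => Form.toSuper P ξ W F S x
  simp only [Form.toSuper]
  split_ifs
  · exact (contDiff_scale _).mul (hp _)
  · exact (contDiff_scale _).mul (hp _)
  · exact (contDiff_scale _).mul (hp _)
  · exact (contDiff_scale _).mul (hp _)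
  · exact contDiff_const

theorem Supported.eq_of_rep {P : Params} {ξ : ℕ → ℝ} {W : ℤ} {f g : SuperFun} {F : Form}
    (hf : Supported f) (hg : Supported g) (h : ∀ x, Rep P ξ x W f F) (h' : ∀ x, Rep P ξ x W g F) :
    f = g :=
  hf.ext hg fun x => ⟨(h x).1.trans (h' x).1.symm, (h x).2.1.trans (h' x).2.1.symm,
    (h x).2.2.1.trans (h' x).2.2.1.symm, (h x).2.2.2.trans (h' x).2.2.2.symm⟩

/-! ### The inverse of a supermetric is unique -/

/-- The leading coefficients of a superfunction, in the Grassmann algebra with two generators. -/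
noncomputable def leading (x : Fin 3 → ℝ) (f : SuperFun) : QuaternionAlgebra ℝ 0 0 0 :=
  ⟨f ∅ x, f {0} x, f {1} x, f {0, 1} x⟩

/-- With all parameters zero the quaternion algebra has `i² = j² = 0` and `ij = -ji = k`: it is the
Grassmann algebra on two generators, and it comes with a ring structure over which matrices can be
formed. -/
theorem leading_mul (x : Fin 3 → ℝ) (f g : SuperFun) :
    leading x (f * g) = leading x f * leading x g := by
  ext <;> simp [leading, mul_singleton, mul_pair]

theorem leading_sum (x : Fin 3 → ℝ) (f : Fin 5 → SuperFun) :
    leading x (∑ i, f i) = ∑ i, leading x (f i) := by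
  simp only [Fin.sum_univ_five]
  ext <;> simp [leading]

theorem leading_smul (x : Fin 3 → ℝ) (c : ℝ) (f : SuperFun) :
    leading x (c • f) = c • leading x f := by
  ext <;> simp [leading]

theorem leading_congr {U : Set (Fin 3 → ℝ)} {x : Fin 3 → ℝ} (hx : x ∈ U) {f g : SuperFun}
    (h : EqOver U f g) : leading x f = leading x g := by
  ext
  exacts [h _ x hx, h _ x hx, h _ x hx, h _ x hx]

theorem leading_one (x : Fin 3 → ℝ) (κ μ : Fin 5) :
    leading x (bos fun _ => if κ = μ then 1 else 0) =
      (1 : Matrix (Fin 5) (Fin 5) (QuaternionAlgebra ℝ 0 0 0)) κ μ := by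
  have h4 : ({0, 1} : Finset ℕ) ≠ ∅ := by decide
  rw [Matrix.one_apply]
  split_ifs <;> ext <;> simp [leading, bos, h4]

/-- A left inverse of a matrix over a ring equals any right inverse. The inverse metric `M` of a
hypothetical solution is arbitrary and may contain auxiliary generators, but its truncation is
thereby the tabulated one. -/
theorem IsInverse.leading_eq {U : Set (Fin 3 → ℝ)} {G M N : Ten2} (hM : IsInverse U G M)
    (hN : IsInverse U G N) {x : Fin 3 → ℝ} (hx : x ∈ U) (i j : Fin 5) :
    leading x (M i j) = leading x (N i j) := by
  let A : Matrix (Fin 5) (Fin 5) (QuaternionAlgebra ℝ 0 0 0) :=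
    fun κ l => sgn (par κ) • leading x (G κ l)
  let m : Matrix (Fin 5) (Fin 5) (QuaternionAlgebra ℝ 0 0 0) := fun κ l => leading x (M κ l)
  let n : Matrix (Fin 5) (Fin 5) (QuaternionAlgebra ℝ 0 0 0) := fun κ l => leading x (N κ l)
  have h1 : m * A = 1 := by
    ext1 κ μ
    have := leading_congr hx (hM.2.2 κ μ)
    rw [leading_one, leading_sum] at this
    rw [← this, Matrix.mul_apply]
    exact Finset.sum_congr rfl fun l _ => by
      rw [leading_smul, leading_mul]; exact mul_smul_comm _ _ _
  have h2 : A * n = 1 := by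
    ext1 κ μ
    have := leading_congr hx (hN.2.1 κ μ)
    rw [leading_one, leading_sum] at this
    rw [← this, Matrix.mul_apply]
    exact Finset.sum_congr rfl fun l _ => by
      rw [leading_smul, leading_mul]; exact smul_mul_assoc _ _ _
  have h3 : m = n := by rw [← mul_one m, ← h2, ← mul_assoc, h1, one_mul]
  exact congrFun (congrFun h3 i) j

theorem Rep.of_leading_eq {P : Params} {ξ : ℕ → ℝ} {x : Fin 3 → ℝ} {W : ℤ} {f g : SuperFun}
    {F : Form} (hf : Rep P ξ x W f F) (h : leading x f = leading x g) : Rep P ξ x W g F := by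
  obtain ⟨f0, f1, f2, f3⟩ := hf
  rw [leading, leading, QuaternionAlgebra.mk.injEq] at h
  exact ⟨h.1 ▸ f0, h.2.1 ▸ f1, h.2.2.1 ▸ f2, h.2.2.2 ▸ f3⟩

/-! ### The common form of the backgrounds -/

/-- The metric and the flux have the common form with the parameters `P`. -/
structure IsBackground (P : Params) (G B : Ten2) : Prop where
  supported : ∀ i j, Supported (G i j)
  metric : ∀ ξ x i j, Rep P ξ x (wt i + wt j) (G i j) (Form.metric i j)
  flux : ∀ ξ x i j k, Rep P ξ x (wt i + wt j + wt k) (flux B i j k) (Form.field i j k)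

theorem rep_one (P : Params) (ξ : ℕ → ℝ) (x : Fin 3 → ℝ) (W : ℤ) (κ μ : Fin 5)
    (hW : κ = μ → W = 0) : Rep P ξ x W (bos fun _ => if κ = μ then 1 else 0)
      (bif κ.val == μ.val then Form.unit else Form.zero) := by
  have h4 : ({0, 1} : Finset ℕ) ≠ ∅ := by decide
  by_cases h : κ = μ
  · rw [hW h]
    subst h
    simp [Rep, bos, Form.unit, Form.eval_cons, Mask.elim, monoEval, h4]
  · have h' : (κ.val == μ.val) = false := beq_eq_false_iff_ne.2 fun h' => h (Fin.ext h')
    rw [h']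
    simp [Rep, bos, Form.zero, h]

/-- The formal check controls four coefficients only; `Supported` makes all others vanish, so the
identities hold exactly and on the whole patch. -/
theorem isInverse_of_rep {P : Params} {ξ : ℕ → ℝ} {G : Ten2} (hs : ∀ i j, Supported (G i j))
    (hG : ∀ x i j, Rep P ξ x (wt i + wt j) (G i j) (Form.metric i j)) (U : Set (Fin 3 → ℝ)) :
    IsInverse U G fun i j => (Form.inverse i j).toSuper P ξ (-wt i - wt j) := by
  refine ⟨fun _ _ => smooth_toSuper _ _ _ _ _, fun κ μ => ?_, fun κ μ => ?_⟩
  · have hc := Form.of_all (Form.of_all Form.inverse_check κ) μ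
    rw [Bool.and_eq_true] at hc
    rw [Supported.eq_of_rep (W := wt κ - wt μ)
      (.sum fun l => ((hs κ l).mul (supported_toSuper _ _ _ _)).smul _)
      (supported_bos _) (fun x => (Rep.sum fun l => (hG x κ l).signMul
        (rep_toSuper P ξ (-wt l - wt μ) (Form.inverse l μ) x) _ (by ring)).of_isZero hc.1)
      (rep_one P ξ · _ κ μ fun h => by rw [h, sub_self])]
    exact fun _ _ _ => rfl
  · have hc := Form.of_all (Form.of_all Form.inverse_check κ) μ
    rw [Bool.and_eq_true] at hc
    rw [Supported.eq_of_rep (W := wt μ - wt κ)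
      (.sum fun l => ((supported_toSuper _ _ _ _).mul (hs l μ)).smul _)
      (supported_bos _) (fun x => (Rep.sum fun l => (rep_toSuper P ξ (-wt κ - wt l)
        (Form.inverse κ l) x).signMul (hG x l μ) _ (by ring)).of_isZero hc.2)
      (rep_one P ξ · _ κ μ fun h => by rw [h, sub_self])]
    exact fun _ _ _ => rfl

section

variable {P : Params} {G B M : Ten2} {U : Set (Fin 3 → ℝ)} {x : Fin 3 → ℝ}

theorem IsBackground.isMetric (hb : IsBackground P G B) : IsMetric G := by
  refine ⟨fun μ ν => ?_, _, isInverse_of_rep (ξ := 0) hb.supported (hb.metric 0) _⟩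
  rw [(hb.supported μ ν).eq_of_rep (supported_toSuper P 0 _ _) (fun x => hb.metric 0 x μ ν)
    (rep_toSuper P 0 _ _)]
  exact smooth_toSuper _ _ _ _ _

theorem IsBackground.rep_inverse (hb : IsBackground P G B) (hM : IsInverse U G M)
    (ξ : ℕ → ℝ) (hx : x ∈ U) (i j : Fin 5) : Rep P ξ x (-wt i - wt j) (M i j) (Form.inverse i j) :=
  (rep_toSuper P ξ _ _ x).of_leading_eq
    ((isInverse_of_rep hb.supported (hb.metric ξ) U).leading_eq hM hx i j)

theorem IsBackground.rep_christoffel (hb : IsBackground P G B) (hM : IsInverse U G M)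
    (hU : IsOpen U) (ξ : ℕ → ℝ) (l j k : Fin 5) : ∀ x ∈ U,
      Rep P ξ x (wt j + wt k - wt l) (christoffel G M l j k) (Form.gamma l j k) :=
  fun x hx => (OSp.rep_christoffel hU (fun i j y _ => hb.metric ξ y i j)
    (fun i j _ hy => hb.rep_inverse hM ξ hy i j) l j k x hx).of_isZero
    (Form.of_all (Form.of_all (Form.of_all Form.gamma_check l) j) k)

theorem IsBackground.rep_raise2 (hb : IsBackground P G B) (hM : IsInverse U G M)
    (ξ : ℕ → ℝ) (hx : x ∈ U) (σ ρ ν : Fin 5) :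
      Rep P ξ x (wt ν - wt σ - wt ρ) (raise2 M (OSp.flux B) σ ρ ν) (Form.raised σ ρ ν) :=
  (OSp.rep_raise2 (hb.rep_inverse hM ξ hx) (hb.flux ξ x) σ ρ ν).of_isZero
    (Form.of_all (Form.of_all (Form.of_all Form.raised_check σ) ρ) ν)

end

end OSp

namespace OSp

/-! ### The backgrounds -/

namespace SPoly

/-- The `B`-field of the background `OSP(1|2)_{i,ε}`, for `b = -ε`. -/
def bfieldITable : List (List SPoly) :=
  [[zero,
    ⟨[(1, [1, 0, 0, 0, 1, 1])], [], [], []⟩,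
    zero,
    ⟨[], [(1, [3, 0, 0, 0, 1, 1])], [], []⟩,
    zero],
   [⟨[(-1, [1, 0, 0, 0, 1, 1])], [], [], []⟩,
    zero,
    ⟨[(-1, [0, 0, 0, 0, 0, 0, 1])], [], [], []⟩,
    ⟨[], [], [(-1, [2, 0, 0, 0, 1, 1])], []⟩,
    ⟨[], [], [(-1, [2, 0, 0, 0, 0, 0, 1])], []⟩],
   [zero,
    ⟨[(1, [0, 0, 0, 0, 0, 0, 1])], [], [], []⟩,
    zero,
    ⟨[], [(1, [2, 0, 0, 0, 0, 0, 1])], [], []⟩,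
    zero],
   [⟨[], [(-1, [3, 0, 0, 0, 1, 1])], [], []⟩,
    ⟨[], [], [(1, [2, 0, 0, 0, 1, 1])], []⟩,
    ⟨[], [(-1, [2, 0, 0, 0, 0, 0, 1])], [], []⟩,
    ⟨[], [], [], [(-1, [3, 0, 0, 0, 1, 1])]⟩,
    ⟨[(-1, [1, 0, 0, 0, 0, 0, 1])], [], [], [(-1, [4, 0, 0, 0, 0, 0, 1])]⟩],
   [zero,
    ⟨[], [], [(1, [2, 0, 0, 0, 0, 0, 1])], []⟩,
    zero,
    ⟨[(-1, [1, 0, 0, 0, 0, 0, 1])], [], [], [(-1, [4, 0, 0, 0, 0, 0, 1])]⟩,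
    zero]]

end SPoly

namespace Form

def bfieldI (i j : Fin 5) : Form := (SPoly.entry SPoly.bfieldITable i j).form

end Form

/-- The exponent of the fourth variable is zero. -/
def freeOfFourth : Mono → Bool
  | _ :: _ :: _ :: n :: _ => Nat.beq n 0
  | _ => true

/-- Removal of the terms that contain the fourth variable. -/
def Form.dropFourth (F : Form) : Form :=
  fold [] (fun a c m r => bif freeOfFourth m then (a, c, m) :: r else r) F

theorem Form.eval_dropFourth (v : ℕ → ℝ) (hv : v 3 = 0) (a : Mask) (F : Form) :
    F.dropFourth.eval v a = F.eval v a := by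
  induction F with
  | nil => rfl
  | cons t F ih =>
    obtain ⟨b, c, m⟩ := t
    have h' : dropFourth ((b, c, m) :: F) =
      bif freeOfFourth m then (b, c, m) :: dropFourth F else dropFourth F := rfl
    rw [h']
    cases h : freeOfFourth m with
    | true => rw [cond_true, eval_cons, eval_cons, ih]
    | false =>
      rcases m with _ | ⟨i, _ | ⟨j, _ | ⟨k, _ | ⟨n, m⟩⟩⟩⟩ <;> simp only [freeOfFourth] at h
      · exact absurd h (by decide)
      · exact absurd h (by decide)
      · exact absurd h (by decide)
      · exact absurd h (by decide)
      · have hn : n ≠ 0 := fun hn => by rw [hn] at h; exact absurd h (by decide)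
        simp [eval_cons, monoEval, ih, hv, hn]

theorem Rep.dropFourth {P : Params} {ξ : ℕ → ℝ} {x : Fin 3 → ℝ} {W : ℤ} {f : SuperFun} {F : Form}
    (hP : P.a = 0) : Rep P ξ x W f F.dropFourth ↔ Rep P ξ x W f F := by
  simp only [Rep, Form.eval_dropFourth (P.env ξ (x 2)) hP]

/-- For `a = 0` and `b = -ε` the `B`-field of case i has the flux of the common family although the
potentials differ. The terms containing `a` are dropped on both sides before the comparison. -/
theorem Form.bfieldI_check : (all fun i => all fun j => all fun k =>
    ((flux bfieldI i j k).dropFourth.sub (field i j k).dropFourth).isZero) = true := by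
  decide +kernel

theorem pair_ne_zero : ({0, 1} : Finset ℕ) ≠ {0} := by decide

section

variable (c : ℝ) (p : ℝ → ℝ) (n : ℕ) (x : Fin 3 → ℝ)

@[simp] theorem ex_empty : ex c n ∅ x = c * scale n x := by simp [ex, bos, scale]

@[simp] theorem exu_empty : exu p n ∅ x = p (x 2) * scale n x := by simp [exu, bos, scale]

@[simp] theorem ex_singleton (m : ℕ) : ex c n {m} x = 0 := by simp [ex, bos]

@[simp] theorem exu_singleton (m : ℕ) : exu p n {m} x = 0 := by simp [exu, bos]

@[simp] theorem ex_pair : ex c n {0, 1} x = 0 := by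
  simp [ex, bos]

@[simp] theorem exu_pair : exu p n {0, 1} x = 0 := by
  simp [exu, bos]

@[simp] theorem psi_empty : psi ∅ x = 0 := by simp [psi, theta]

@[simp] theorem psi_zero : psi {0} x = 1 := by simp [psi, theta]

@[simp] theorem psi_one : psi {1} x = 0 := by simp [psi, theta]

@[simp] theorem psi_pair : psi {0, 1} x = 0 := by
  simp [psi, theta, pair_ne_zero]

@[simp] theorem chi_empty : chi ∅ x = 0 := by simp [chi, theta]

@[simp] theorem chi_zero : chi {0} x = 0 := by simp [chi, theta]

@[simp] theorem chi_one : chi {1} x = 1 := by simp [chi, theta]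

@[simp] theorem chi_pair : chi {0, 1} x = 0 := by
  simp [chi, theta]

end

/-! ### The explicit backgrounds as members of the common family -/

theorem supported_ex (c : ℝ) (n : ℕ) : Supported (ex c n) := supported_bos _

theorem supported_exu (p : ℝ → ℝ) (n : ℕ) : Supported (exu p n) := supported_bos _

theorem Supported.ofLineElement {c : Ten2} (hc : ∀ i j, Supported (c i j)) (i j : Fin 5) :
    Supported (ofLineElement c i j) := by
  unfold OSp.ofLineElement
  split_ifs
  exacts [(hc _ _).smul _, (hc _ _).smul _, (hc _ _).smul _]

theorem supported_metricI (η : ℝ) (i j : Fin 5) : Supported (metricI η i j) := by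
  refine Supported.ofLineElement (fun i j => ?_) i j
  fin_cases i <;> fin_cases j <;>
  simp [-neg_add_rev, Supported.mul, Supported.zero, supported_ex, supported_psi, supported_chi]
  exact ((supported_ex _ _).add ((supported_ex _ _).mul (supported_psi.mul supported_chi))).neg

theorem supported_metricOmega (w η : ℝ) (i j : Fin 5) : Supported (metricOmega w η i j) := by
  refine Supported.ofLineElement (fun i j => ?_) i j
  fin_cases i <;> fin_cases j <;>
  simp [-neg_sub, Supported.mul, Supported.add, Supported.zero, supported_ex, supported_exu,
    supported_psi, supported_chi]
  exact (((supported_ex _ _).add ((supported_ex _ _).mul (supported_psi.mul supported_chi))).sub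
    ((supported_exu _ _).mul (supported_psi.mul supported_chi))).neg

/-- For `a = 0` the metric table contains `b` only through `b²`, which is why both cases and both
signs of `ε` share one metric. -/
theorem rep_metricI {P : Params} {η : ℝ} (ha : P.a = 0) (hb : P.b ^ 2 = 1) (hg : P.g = η ^ 2)
    (ξ : ℕ → ℝ) (x : Fin 3 → ℝ) (i j : Fin 5) :
    Rep P ξ x (wt i + wt j) (metricI η i j) (Form.metric i j) := by
  fin_cases i <;> fin_cases j <;>
  · simp [Form.metric, rep_form_iff, metricI, ofLineElement, SPoly.entry, SPoly.metricTable, wt, par, sgn,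
      polyEval, monoEval, Params.env, SPoly.zero, mul_singleton, mul_pair, ha, hb, hg]
    try (refine ⟨?_, ?_⟩ <;> ring)
    try ring

theorem rep_metricOmega {P : Params} {w η : ℝ} (ha : P.a = 1) (hb : P.b = w) (hg : P.g = η ^ 2)
    (ξ : ℕ → ℝ) (x : Fin 3 → ℝ) (i j : Fin 5) :
    Rep P ξ x (wt i + wt j) (metricOmega w η i j) (Form.metric i j) := by
  fin_cases i <;> fin_cases j <;>
  · simp [Form.metric, rep_form_iff, metricOmega, ofLineElement, SPoly.entry, SPoly.metricTable, wt, par,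
      sgn, polyEval, monoEval, Params.env, SPoly.zero, mul_singleton, mul_pair, ha, hb, hg]
    try (refine ⟨?_, ?_⟩ <;> ring)
    try ring

theorem rep_bfieldI {P : Params} {ε A κ : ℝ} (hb : P.b = -ε) (hA : P.A = A) (hk : P.k = κ)
    (ξ : ℕ → ℝ) (x : Fin 3 → ℝ) (i j : Fin 5) :
    Rep P ξ x (wt i + wt j) (bfieldI ε A κ i j) (Form.bfieldI i j) := by
  fin_cases i <;> fin_cases j <;>
  · simp [Form.bfieldI, rep_form_iff, bfieldI, ofTwoForm, SPoly.entry, SPoly.bfieldITable, wt, par, sgn,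
      polyEval, monoEval, Params.env, SPoly.zero, mul_singleton, mul_pair, hb, hA, hk]
    try (refine ⟨?_, ?_⟩ <;> ring)
    try ring

theorem rep_bfieldII {P : Params} {ε A κ : ℝ} (ha : P.a = 0) (hb : P.b = ε) (hA : P.A = A)
    (hk : P.k = κ) (ξ : ℕ → ℝ) (x : Fin 3 → ℝ) (i j : Fin 5) :
    Rep P ξ x (wt i + wt j) (bfieldII ε A κ i j) (Form.bfield i j) := by
  fin_cases i <;> fin_cases j <;>
  · simp [Form.bfield, rep_form_iff, bfieldII, ofTwoForm, SPoly.entry, SPoly.bfieldTable, wt, par, sgn,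
      polyEval, monoEval, Params.env, SPoly.zero, mul_singleton, mul_pair, ha, hb, hA, hk]
    try (refine ⟨?_, ?_⟩ <;> ring)
    try ring

theorem rep_bfieldOmega {P : Params} {w A κ : ℝ} (ha : P.a = 1) (hb : P.b = w) (hA : P.A = A)
    (hk : P.k = κ) (ξ : ℕ → ℝ) (x : Fin 3 → ℝ) (i j : Fin 5) :
    Rep P ξ x (wt i + wt j) (bfieldOmega w A κ i j) (Form.bfield i j) := by
  fin_cases i <;> fin_cases j <;>
  · simp [Form.bfield, rep_form_iff, bfieldOmega, ofTwoForm, SPoly.entry, SPoly.bfieldTable, wt, par, sgn,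
      polyEval, monoEval, Params.env, SPoly.zero, mul_singleton, mul_pair, ha, hb, hA, hk]
    try (refine ⟨?_, ?_⟩ <;> ring)
    try ring

theorem rep_flux_of_rep {P : Params} {B : Ten2}
    (hB : ∀ ξ x i j, Rep P ξ x (wt i + wt j) (B i j) (Form.bfield i j)) (ξ : ℕ → ℝ)
    (x : Fin 3 → ℝ) (i j k : Fin 5) :
    Rep P ξ x (wt i + wt j + wt k) (flux B i j k) (Form.field i j k) :=
  (rep_flux isOpen_univ (fun i j y _ => hB ξ y i j) i j k x (Set.mem_univ x)).of_isZero
    (Form.of_all (Form.of_all (Form.of_all Form.field_check i) j) k)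

/-- The parameters of the backgrounds `OSP(1|2)_{i,-b}` and `OSP(1|2)_{ii,b}`. -/
noncomputable def paramsI (η b A κ : ℝ) : Params where
  g := η ^ 2
  a := 0
  b := b
  A := A
  k := κ
  D := 1
  hD := by ring

/-- The parameters of the background `OSP(1|2)_ω`. -/
noncomputable def paramsOmega (η w A κ : ℝ) (h : 1 + w * η ^ 2 ≠ 0) : Params where
  g := η ^ 2
  a := 1
  b := w
  A := A
  k := κ
  D := (1 + w * η ^ 2)⁻¹
  hD := by rw [one_mul, inv_mul_cancel₀ h]

theorem isBackground_omega (η w A κ : ℝ) (h : 1 + w * η ^ 2 ≠ 0) :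
    IsBackground (paramsOmega η w A κ h) (metricOmega w η) (bfieldOmega w A κ) where
  supported := supported_metricOmega w η
  metric := rep_metricOmega rfl rfl rfl
  flux := rep_flux_of_rep (rep_bfieldOmega rfl rfl rfl rfl)

theorem isBackground_II (η ε A κ : ℝ) (h : ε ^ 2 = 1) :
    IsBackground (paramsI η ε A κ) (metricI η) (bfieldII ε A κ) where
  supported := supported_metricI η
  metric := rep_metricI rfl h rfl
  flux := rep_flux_of_rep (rep_bfieldII rfl rfl rfl rfl)

theorem isBackground_I (η ε A κ : ℝ) (h : ε ^ 2 = 1) :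
    IsBackground (paramsI η (-ε) A κ) (metricI η) (bfieldI ε A κ) where
  supported := supported_metricI η
  metric := rep_metricI rfl (by simpa [paramsI] using h) rfl
  flux ξ x i j k := by
    have h := rep_flux isOpen_univ (fun i j y _ => rep_bfieldI (P := paramsI η (-ε) A κ)
      (ε := ε) rfl rfl rfl ξ y i j) i j k x (Set.mem_univ x)
    have ha : (paramsI η (-ε) A κ).a = 0 := rfl
    exact (Rep.dropFourth ha).1 (((Rep.dropFourth ha).2 h).of_isZero
      (Form.of_all (Form.of_all (Form.of_all Form.bfieldI_check i) j) k))

end OSp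

namespace OSp

/-! ### The field equations -/

namespace SPoly

/-- The part of the field equations that does not contain the one-form `X`, with the key
`5 μ + ν`. -/
def sourceTable : List (ℕ × SPoly) :=
  [(0, ⟨[(-3, [3]), (-1, [3, 0, 0, 0, 0, 0, 2]), (1, [1, 0, 0, 0, 0, 0, 2, 1]),
     (-1, [3, 0, 0, 1, 1, 2]), (1, [1, 0, 1, 1, 1]), (-1, [3, 2, 0, 2, 0, 2]), (5, [2, 2, 1, 2]),
     (-1, [1, 2, 1, 2, 0, 0, 2, 1]), (3, [3, 2, 2, 3, 1])], [], [], []⟩),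
   (5, ⟨[(-1, [2, 0, 0, 0, 1, 1]), (-1, [1, 1, 0, 0, 0, 0, 2]), (1, [1, 1, 0, 0, 0, 0, 2, 1]),
     (-1, [3, 1, 0, 1, 1, 2]), (5, [2, 1, 1, 1, 1]), (3, [3, 1, 2, 2, 2]),
     (-1, [2, 2, 0, 1, 0, 1]), (-1, [3, 3, 0, 2, 0, 2]), (5, [2, 3, 1, 2]),
     (-1, [1, 3, 1, 2, 0, 0, 2, 1]), (3, [3, 3, 2, 3, 1])], [], [], []⟩),
   (10, ⟨[(-1, [2, 0, 0, 1, 0, 1]), (1, [3, 1, 0, 2, 0, 2]), (-5, [2, 1, 1, 2]),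
     (1, [1, 1, 1, 2, 0, 0, 2, 1]), (-3, [3, 1, 2, 3, 1])], [], [], []⟩),
   (2, ⟨[(1, [2, 0, 0, 1, 0, 1]), (1, [3, 1, 0, 2, 0, 2]), (-5, [2, 1, 1, 2]),
     (1, [1, 1, 1, 2, 0, 0, 2, 1]), (-3, [3, 1, 2, 3, 1])], [], [], []⟩),
   (7, ⟨[(-3, [2]), (1, [2, 0, 0, 0, 0, 0, 2]), (1, [1, 0, 0, 0, 0, 0, 2, 1]),
     (-1, [3, 0, 0, 1, 1, 2]), (-1, [2, 0, 1, 1, 1]), (-3, [3, 0, 2, 2, 2]),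
     (1, [1, 1, 0, 1, 0, 1]), (1, [3, 2, 0, 2, 0, 2]), (-5, [2, 2, 1, 2]),
     (1, [1, 2, 1, 2, 0, 0, 2, 1]), (-3, [3, 2, 2, 3, 1])], [], [], []⟩),
   (12, ⟨[(-1, [3, 0, 0, 2, 0, 2]), (5, [2, 0, 1, 2]), (-1, [1, 0, 1, 2, 0, 0, 2, 1]),
     (3, [3, 0, 2, 3, 1])], [], [], []⟩),
   (11, ⟨[(-3, [2]), (1, [2, 0, 0, 0, 0, 0, 2]), (1, [1, 0, 0, 0, 0, 0, 2, 1]),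
     (-1, [3, 0, 0, 1, 1, 2]), (-1, [2, 0, 1, 1, 1]), (-3, [3, 0, 2, 2, 2]),
     (-1, [1, 1, 0, 1, 0, 1]), (1, [3, 2, 0, 2, 0, 2]), (-5, [2, 2, 1, 2]),
     (1, [1, 2, 1, 2, 0, 0, 2, 1]), (-3, [3, 2, 2, 3, 1])], [], [], []⟩),
   (18, ⟨[(1, [1, 0, 0, 0, 1, 1]), (1, [1, 2, 0, 1, 0, 1])], [], [], [(3, [4, 0, 0, 0, 1, 1]),
     (3, [4, 2, 0, 1, 0, 1])]⟩),
   (19, ⟨[(-3, [3]), (1, [2, 0, 0, 0, 0, 0, 2]), (1, [3, 0, 0, 0, 0, 0, 2, 1]),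
     (1, [2, 0, 0, 1, 1, 2]), (1, [3, 0, 1, 1, 1]), (1, [1, 1, 0, 1, 0, 1])], [], [], [(-3, [6]),
     (3, [6, 0, 0, 0, 0, 0, 2]), (9, [7, 0, 0, 1, 1, 2]), (3, [6, 0, 1, 1, 1]),
     (3, [7, 0, 2, 2, 2]), (3, [5, 1, 0, 1, 0, 1]), (-1, [7, 2, 0, 2, 0, 2]), (5, [6, 2, 1, 2]),
     (-1, [5, 2, 1, 2, 0, 0, 2, 1]), (3, [7, 2, 2, 3, 1])]⟩),
   (23, ⟨[(3, [3]), (-1, [2, 0, 0, 0, 0, 0, 2]), (-1, [3, 0, 0, 0, 0, 0, 2, 1]),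
     (-1, [2, 0, 0, 1, 1, 2]), (-1, [3, 0, 1, 1, 1]), (1, [1, 1, 0, 1, 0, 1])], [], [],
     [(3, [6]), (-3, [6, 0, 0, 0, 0, 0, 2]), (-9, [7, 0, 0, 1, 1, 2]), (-3, [6, 0, 1, 1, 1]),
     (-3, [7, 0, 2, 2, 2]), (3, [5, 1, 0, 1, 0, 1]), (1, [7, 2, 0, 2, 0, 2]), (-5, [6, 2, 1, 2]),
     (1, [5, 2, 1, 2, 0, 0, 2, 1]), (-3, [7, 2, 2, 3, 1])]⟩),
   (24, ⟨[(1, [1, 0, 0, 1, 0, 1])], [], [], []⟩),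
   (15, ⟨[], [(-1, [4, 0, 0, 0, 1, 1]), (-1, [3, 1, 0, 0, 0, 0, 2]),
     (1, [3, 1, 0, 0, 0, 0, 2, 1]), (-1, [5, 1, 0, 1, 1, 2]), (5, [4, 1, 1, 1, 1]),
     (3, [5, 1, 2, 2, 2]), (-1, [4, 2, 0, 1, 0, 1]), (-1, [5, 3, 0, 2, 0, 2]), (5, [4, 3, 1, 2]),
     (-1, [3, 3, 1, 2, 0, 0, 2, 1]), (3, [5, 3, 2, 3, 1])], [(-3, [4, 0, 0, 0, 0, 0, 2]),
     (3, [4, 0, 0, 0, 0, 0, 2, 1]), (-3, [4, 0, 0, 1, 1, 2]), (3, [4, 0, 1, 1, 1]),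
     (-1, [2, 1, 0, 1, 0, 1]), (-1, [4, 2, 0, 2, 0, 2]), (5, [3, 2, 1, 2]),
     (-1, [2, 2, 1, 2, 0, 0, 2, 1]), (3, [4, 2, 2, 3, 1])], []⟩),
   (16, ⟨[], [(-1, [5, 0, 0, 0, 2, 2]), (5, [4, 0, 1, 0, 2]), (-1, [3, 0, 1, 0, 2, 0, 2, 1]),
     (3, [5, 0, 2, 1, 3]), (-1, [2, 2, 0, 0, 0, 0, 2]), (1, [2, 2, 0, 0, 0, 0, 2, 1]),
     (-1, [4, 2, 0, 1, 1, 2]), (5, [3, 2, 1, 1, 1]), (3, [4, 2, 2, 2, 2]),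
     (-1, [5, 4, 0, 2, 0, 2]), (5, [4, 4, 1, 2]), (-1, [3, 4, 1, 2, 0, 0, 2, 1]),
     (3, [5, 4, 2, 3, 1])], [(-3, [3, 0, 0, 0, 1, 1]), (-1, [2, 1, 0, 0, 0, 0, 2]),
     (1, [2, 1, 0, 0, 0, 0, 2, 1]), (-1, [4, 1, 0, 1, 1, 2]), (5, [3, 1, 1, 1, 1]),
     (3, [4, 1, 2, 2, 2]), (-3, [3, 2, 0, 1, 0, 1]), (-1, [4, 3, 0, 2, 0, 2]), (5, [3, 3, 1, 2]),
     (-1, [2, 3, 1, 2, 0, 0, 2, 1]), (3, [4, 3, 2, 3, 1])], []⟩),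
   (17, ⟨[], [(-3, [4]), (1, [4, 0, 0, 0, 0, 0, 2]), (1, [3, 0, 0, 0, 0, 0, 2, 1]),
     (-1, [5, 0, 0, 1, 1, 2]), (-1, [4, 0, 1, 1, 1]), (-3, [5, 0, 2, 2, 2]),
     (1, [3, 1, 0, 1, 0, 1]), (1, [5, 2, 0, 2, 0, 2]), (-5, [4, 2, 1, 2]),
     (1, [3, 2, 1, 2, 0, 0, 2, 1]), (-3, [5, 2, 2, 3, 1])], [(1, [3, 0, 0, 1, 0, 1]),
     (1, [4, 1, 0, 2, 0, 2]), (-5, [3, 1, 1, 2]), (1, [2, 1, 1, 2, 0, 0, 2, 1]),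
     (-3, [4, 1, 2, 3, 1])], []⟩),
   (20, ⟨[], [], [(-3, [4, 0, 0, 1, 0, 1]), (-1, [5, 1, 0, 2, 0, 2]), (5, [4, 1, 1, 2]),
     (-1, [3, 1, 1, 2, 0, 0, 2, 1]), (3, [5, 1, 2, 3, 1])], []⟩),
   (21, ⟨[], [], [(-3, [4]), (3, [4, 0, 0, 0, 0, 0, 2]), (9, [5, 0, 0, 1, 1, 2]),
     (3, [4, 0, 1, 1, 1]), (3, [5, 0, 2, 2, 2]), (-3, [3, 1, 0, 1, 0, 1]),
     (-1, [5, 2, 0, 2, 0, 2]), (5, [4, 2, 1, 2]), (-1, [3, 2, 1, 2, 0, 0, 2, 1]),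
     (3, [5, 2, 2, 3, 1])], []⟩),
   (22, ⟨[], [], [(1, [5, 0, 0, 2, 0, 2]), (-5, [4, 0, 1, 2]), (1, [3, 0, 1, 2, 0, 0, 2, 1]),
     (-3, [5, 0, 2, 3, 1])], []⟩)]

end SPoly

namespace Form

/-- The index pairs of the field equations that are used. -/
def usedPairs : List (Fin 5 × Fin 5) :=
  [(0, 0), (1, 0), (2, 0), (0, 2), (1, 2), (2, 2), (2, 1), (3, 3), (3, 4), (4, 3), (4, 4), (3, 0),
    (3, 1), (3, 2), (4, 0), (4, 1), (4, 2)]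

def source (μ ν : Fin 5) : Form :=
  ((ricci gamma μ ν).add ((sum fun ρ => sum fun σ =>
    (field μ ρ σ).mul (raised σ ρ ν)).term (1, [2]))).sub
    ((divFlux inverse gamma field μ ν).term (1, [1]))

def sourceEntry (μ ν : Fin 5) : Form := (SPoly.lookup SPoly.sourceTable (5 * μ + ν)).form

theorem source_check : (usedPairs.all fun m =>
    ((source m.1 m.2).sub (sourceEntry m.1 m.2)).isZero) = true := by
  decide +kernel

end Form

end OSp

/-! ### Successive elimination of the coefficients of the one-form -/

namespace OSp

/-- The coefficient of `ψ` in `X_ψ`. -/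
def psiPsi : Poly :=
  [(1, [3, 0, 0, 0, 0, 0, 1, 0, 0, 1]), (1, [3, 0, 0, 0, 0, 0, 1, 1, 0, 1]),
    (1, [2, 0, 0, 0, 1, 1]), (1, [2, 0, 0, 0, 1, 1, 0, 0, 1]),
    (1, [3, 0, 1, 0, 2, 0, 1, 1, 0, 0, 1]), (1, [1, 1, 0, 0, 0, 0, 1, 0, 1]),
    (-1, [2, 1, 0, 1, 0, 1, 0, 0, 0, 1]), (-1, [2, 1, 0, 0, 1, 1, 0, 0, 0, 0, 1]),
    (-1, [3, 2, 0, 0, 0, 0, 1, 0, 0, 0, 1]), (-1, [3, 2, 0, 0, 0, 0, 1, 1, 0, 0, 1]),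
    (1, [2, 2, 0, 1, 0, 1]), (-1, [2, 2, 0, 1, 0, 1, 0, 0, 1]),
    (-1, [3, 2, 1, 2, 0, 0, 1, 1, 0, 1])]

/-- The coefficient of `χ` in `X_ψ`. -/
def psiChi : Poly :=
  [(3, [4]), (1, [2, 0, 0, 0, 0, 0, 0, 0, 1]), (1, [2, 0, 0, 0, 0, 0, 1, 0, 1]),
    (-1, [3, 0, 0, 0, 0, 0, 2]), (-1, [4, 0, 0, 0, 0, 0, 2, 1]),
    (-1, [3, 0, 0, 1, 0, 1, 0, 0, 0, 1]), (-1, [3, 0, 0, 0, 1, 1, 0, 0, 0, 0, 1]),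
    (-1, [3, 0, 0, 1, 1, 2]), (-1, [4, 0, 1, 1, 1]), (-1, [2, 1, 0, 0, 0, 0, 0, 0, 0, 0, 1]),
    (-1, [3, 1, 0, 0, 0, 0, 1, 0, 0, 0, 1]), (-1, [3, 1, 0, 0, 0, 0, 1, 1, 0, 0, 1]),
    (1, [2, 1, 0, 1, 0, 1]), (-1, [2, 1, 0, 1, 0, 1, 0, 0, 1]),
    (-1, [3, 1, 1, 2, 0, 0, 1, 1, 0, 1])]

/-- The coefficient of `ψ` in `X_χ`. -/
def chiPsi : Poly :=
  [(-3, [4]), (-1, [2, 0, 0, 0, 0, 0, 0, 0, 1]), (1, [2, 0, 0, 0, 0, 0, 1, 0, 1]),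
    (1, [3, 0, 0, 0, 0, 0, 2]), (1, [4, 0, 0, 0, 0, 0, 2, 1]),
    (-1, [3, 0, 0, 1, 0, 1, 0, 0, 0, 1]), (-1, [3, 0, 0, 0, 1, 1, 0, 0, 0, 0, 1]),
    (1, [3, 0, 0, 1, 1, 2]), (1, [4, 0, 1, 1, 1]), (1, [2, 1, 0, 0, 0, 0, 0, 0, 0, 0, 1]),
    (-1, [3, 1, 0, 0, 0, 0, 1, 0, 0, 0, 1]), (-1, [3, 1, 0, 0, 0, 0, 1, 1, 0, 0, 1]),
    (1, [2, 1, 0, 1, 0, 1]), (-1, [2, 1, 0, 1, 0, 1, 0, 0, 1]),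
    (-1, [3, 1, 1, 2, 0, 0, 1, 1, 0, 1])]

/-- The coefficient of `χ` in `X_χ`. -/
def chiChi : Poly :=
  [(-1, [3, 0, 0, 0, 0, 0, 1, 0, 0, 0, 1]), (-1, [3, 0, 0, 0, 0, 0, 1, 1, 0, 0, 1]),
    (1, [2, 0, 0, 1, 0, 1]), (-1, [2, 0, 0, 1, 0, 1, 0, 0, 1]),
    (-1, [3, 0, 1, 2, 0, 0, 1, 1, 0, 1])]

/-- The coefficient of `ψ χ` in `X_φ`. -/
def phiTop : Poly :=
  [(3, [6]), (1, [4, 0, 0, 0, 0, 0, 0, 0, 1]), (3, [6, 0, 0, 0, 0, 0, 1]),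
    (-1, [5, 0, 0, 0, 0, 0, 2]), (-1, [4, 0, 0, 0, 0, 0, 2, 0, 1]),
    (-1, [6, 0, 0, 0, 0, 0, 2, 1]), (-1, [5, 0, 0, 0, 0, 0, 3]), (-1, [6, 0, 0, 0, 0, 0, 3, 1]),
    (3, [5, 0, 0, 1, 0, 1, 0, 0, 0, 1]), (1, [5, 0, 0, 0, 1, 1, 0, 0, 0, 0, 1]),
    (-1, [5, 0, 0, 1, 0, 1, 1, 1, 0, 1]), (1, [5, 0, 0, 0, 1, 1, 1, 1, 0, 0, 1]),
    (-3, [5, 0, 0, 1, 1, 2]), (-1, [4, 0, 0, 1, 1, 2, 0, 0, 1]), (-1, [5, 0, 0, 1, 1, 2, 1]),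
    (-1, [6, 0, 1, 1, 1]), (-1, [6, 0, 1, 1, 1, 0, 1]), (-1, [4, 1, 0, 0, 0, 0, 0, 0, 0, 0, 1]),
    (-1, [4, 1, 0, 0, 0, 0, 1, 0, 0, 0, 1]), (1, [4, 1, 0, 0, 0, 0, 1, 1, 0, 0, 1]),
    (1, [5, 1, 0, 0, 0, 0, 2, 0, 0, 0, 1]), (1, [5, 1, 0, 0, 0, 0, 2, 1, 0, 0, 1]),
    (-1, [4, 1, 0, 1, 0, 1]), (3, [4, 1, 0, 1, 0, 1, 0, 0, 1]), (-1, [4, 1, 0, 1, 0, 1, 1]),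
    (-1, [4, 1, 0, 1, 0, 1, 1, 0, 1]), (1, [4, 1, 0, 2, 0, 2, 0, 0, 0, 1]),
    (1, [4, 1, 0, 1, 1, 2, 0, 0, 0, 0, 1]), (-1, [4, 1, 1, 2, 0, 0, 0, 0, 0, 1]),
    (1, [5, 1, 1, 2, 0, 0, 1, 0, 0, 1]), (1, [4, 1, 1, 2, 0, 0, 1, 1, 0, 1]),
    (1, [5, 1, 1, 1, 1, 0, 1, 0, 0, 0, 1]), (1, [5, 1, 1, 2, 0, 0, 2, 1, 0, 1]),
    (1, [4, 1, 1, 2, 1, 1]), (1, [4, 1, 1, 2, 1, 1, 0, 0, 1]),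
    (-1, [4, 2, 0, 1, 0, 1, 0, 0, 0, 0, 1]), (1, [5, 2, 0, 1, 0, 1, 1, 0, 0, 0, 1]),
    (1, [5, 2, 0, 1, 0, 1, 1, 1, 0, 0, 1]), (-1, [4, 2, 0, 2, 0, 2]),
    (1, [4, 2, 0, 2, 0, 2, 0, 0, 1]), (3, [6, 2, 1, 2]), (-1, [4, 2, 1, 2, 0, 0, 0, 0, 1]),
    (1, [4, 2, 1, 2, 0, 0, 1, 0, 1]), (-1, [5, 2, 1, 2, 0, 0, 2]),
    (-1, [6, 2, 1, 2, 0, 0, 2, 1]), (-1, [5, 2, 1, 3, 0, 1, 0, 0, 0, 1]),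
    (-1, [5, 2, 1, 2, 1, 1, 0, 0, 0, 0, 1]), (1, [5, 2, 1, 3, 0, 1, 1, 1, 0, 1]),
    (-1, [5, 2, 1, 3, 1, 2]), (-1, [6, 2, 2, 3, 1])]

/-- The coefficient of `ψ χ` in `X_y`. -/
def yTop : Poly :=
  [(1, [3, 0, 0, 0, 0, 0, 0, 0, 0, 1]), (3, [5, 0, 0, 0, 0, 0, 1, 0, 0, 1]),
    (-3, [5, 0, 0, 0, 0, 0, 1, 1, 0, 1]), (-1, [4, 0, 0, 0, 0, 0, 2, 0, 0, 1]),
    (-1, [4, 0, 0, 0, 0, 0, 2, 1, 0, 1]), (-11, [6, 0, 0, 0, 1, 1]),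
    (-3, [4, 0, 0, 0, 1, 1, 0, 0, 1]), (-1, [3, 0, 0, 0, 1, 1, 1]),
    (-1, [4, 0, 0, 0, 1, 1, 1, 0, 1]), (1, [5, 0, 0, 0, 1, 1, 2]), (1, [6, 0, 0, 0, 1, 1, 2, 1]),
    (-1, [5, 0, 0, 1, 1, 2, 0, 0, 0, 1]), (-1, [5, 0, 0, 0, 2, 2, 0, 0, 0, 0, 1]),
    (1, [5, 0, 0, 1, 2, 3]), (-1, [4, 0, 1, 1, 1, 0, 0, 0, 0, 1]),
    (1, [5, 0, 1, 1, 1, 0, 1, 0, 0, 1]), (1, [5, 0, 1, 0, 2, 0, 1, 0, 0, 0, 1]),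
    (-3, [5, 0, 1, 0, 2, 0, 1, 1, 0, 0, 1]), (-1, [4, 0, 1, 0, 2, 0, 2, 1, 0, 0, 1]),
    (5, [6, 0, 1, 1, 2, 1]), (1, [4, 0, 1, 1, 2, 1, 0, 0, 1]), (1, [2, 1, 0, 0, 0, 0, 0, 0, 1]),
    (-1, [6, 1, 0, 0, 0, 0, 2]), (-1, [2, 1, 0, 0, 0, 0, 2, 0, 1]),
    (1, [6, 1, 0, 0, 0, 0, 2, 1]), (1, [2, 1, 0, 1, 0, 1, 0, 0, 0, 1]),
    (3, [4, 1, 0, 0, 1, 1, 0, 0, 0, 0, 1]), (1, [5, 1, 0, 1, 0, 1, 1, 0, 0, 1]),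
    (-1, [5, 1, 0, 1, 0, 1, 1, 1, 0, 1]), (1, [5, 1, 0, 0, 1, 1, 1, 0, 0, 0, 1]),
    (1, [5, 1, 0, 0, 1, 1, 1, 1, 0, 0, 1]), (-1, [4, 1, 0, 1, 1, 2]),
    (-3, [4, 1, 0, 1, 1, 2, 0, 0, 1]), (3, [6, 1, 1, 1, 1]), (-1, [4, 1, 1, 1, 1, 0, 0, 0, 1]),
    (1, [4, 1, 1, 1, 1, 0, 1, 0, 1]), (-1, [5, 1, 1, 1, 1, 0, 2]),
    (-1, [5, 1, 1, 2, 1, 1, 0, 0, 0, 1]), (-1, [5, 1, 1, 1, 2, 1, 0, 0, 0, 0, 1]),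
    (-1, [5, 1, 1, 2, 2, 2]), (-1, [6, 1, 2, 2, 2]), (-1, [3, 2, 0, 0, 0, 0, 0, 0, 0, 0, 1]),
    (-3, [5, 2, 0, 0, 0, 0, 1, 0, 0, 0, 1]), (3, [5, 2, 0, 0, 0, 0, 1, 1, 0, 0, 1]),
    (1, [4, 2, 0, 0, 0, 0, 2, 0, 0, 0, 1]), (1, [4, 2, 0, 0, 0, 0, 2, 1, 0, 0, 1]),
    (-11, [6, 2, 0, 1, 0, 1]), (5, [4, 2, 0, 1, 0, 1, 0, 0, 1]), (-1, [3, 2, 0, 1, 0, 1, 1]),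
    (-1, [4, 2, 0, 1, 0, 1, 1, 0, 1]), (1, [5, 2, 0, 1, 0, 1, 2]), (1, [6, 2, 0, 1, 0, 1, 2, 1]),
    (3, [5, 2, 0, 2, 0, 2, 0, 0, 0, 1]), (3, [5, 2, 0, 1, 1, 2, 0, 0, 0, 0, 1]),
    (1, [5, 2, 0, 2, 1, 3]), (-1, [4, 2, 1, 2, 0, 0, 0, 0, 0, 1]),
    (1, [5, 2, 1, 2, 0, 0, 1, 0, 0, 1]), (3, [5, 2, 1, 2, 0, 0, 1, 1, 0, 1]),
    (1, [5, 2, 1, 1, 1, 0, 1, 0, 0, 0, 1]), (1, [4, 2, 1, 2, 0, 0, 2, 1, 0, 1]),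
    (5, [6, 2, 1, 2, 1, 1]), (1, [4, 2, 1, 2, 1, 1, 0, 0, 1]),
    (-1, [4, 3, 0, 1, 0, 1, 0, 0, 0, 0, 1]), (1, [5, 3, 0, 1, 0, 1, 1, 0, 0, 0, 1]),
    (1, [5, 3, 0, 1, 0, 1, 1, 1, 0, 0, 1]), (-1, [4, 3, 0, 2, 0, 2]),
    (1, [4, 3, 0, 2, 0, 2, 0, 0, 1]), (3, [6, 3, 1, 2]), (-1, [4, 3, 1, 2, 0, 0, 0, 0, 1]),
    (1, [4, 3, 1, 2, 0, 0, 1, 0, 1]), (-1, [5, 3, 1, 2, 0, 0, 2]),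
    (-1, [6, 3, 1, 2, 0, 0, 2, 1]), (-1, [5, 3, 1, 3, 0, 1, 0, 0, 0, 1]),
    (-1, [5, 3, 1, 2, 1, 1, 0, 0, 0, 0, 1]), (1, [5, 3, 1, 3, 0, 1, 1, 1, 0, 1]),
    (-1, [5, 3, 1, 3, 1, 2]), (-1, [6, 3, 2, 3, 1])]

/-- The coefficient of `ψ χ` in `X_u`. -/
def uTop : Poly :=
  [(1, [5, 0, 0, 0, 0, 0, 1, 0, 0, 0, 1]), (-1, [5, 0, 0, 0, 0, 0, 1, 1, 0, 0, 1]),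
    (-3, [6, 0, 0, 1, 0, 1]), (-1, [4, 0, 0, 1, 0, 1, 0, 0, 1]),
    (1, [4, 0, 0, 1, 0, 1, 1, 0, 1]), (1, [5, 0, 0, 1, 0, 1, 2]), (1, [6, 0, 0, 1, 0, 1, 2, 1]),
    (-1, [5, 0, 0, 2, 0, 2, 0, 0, 0, 1]), (-1, [5, 0, 0, 1, 1, 2, 0, 0, 0, 0, 1]),
    (1, [5, 0, 0, 2, 1, 3]), (1, [4, 0, 1, 2, 0, 0, 0, 0, 0, 1]),
    (-1, [5, 0, 1, 2, 0, 0, 1, 0, 0, 1]), (-1, [5, 0, 1, 2, 0, 0, 1, 1, 0, 1]),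
    (-1, [5, 0, 1, 1, 1, 0, 1, 0, 0, 0, 1]), (-3, [6, 0, 1, 2, 1, 1]),
    (-1, [4, 0, 1, 2, 1, 1, 0, 0, 1]), (1, [4, 1, 0, 1, 0, 1, 0, 0, 0, 0, 1]),
    (-1, [5, 1, 0, 1, 0, 1, 1, 0, 0, 0, 1]), (-1, [5, 1, 0, 1, 0, 1, 1, 1, 0, 0, 1]),
    (1, [4, 1, 0, 2, 0, 2]), (-1, [4, 1, 0, 2, 0, 2, 0, 0, 1]), (-3, [6, 1, 1, 2]),
    (1, [4, 1, 1, 2, 0, 0, 0, 0, 1]), (-1, [4, 1, 1, 2, 0, 0, 1, 0, 1]),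
    (1, [5, 1, 1, 2, 0, 0, 2]), (1, [6, 1, 1, 2, 0, 0, 2, 1]),
    (1, [5, 1, 1, 3, 0, 1, 0, 0, 0, 1]), (1, [5, 1, 1, 2, 1, 1, 0, 0, 0, 0, 1]),
    (-1, [5, 1, 1, 3, 0, 1, 1, 1, 0, 1]), (1, [5, 1, 1, 3, 1, 2]), (1, [6, 1, 2, 3, 1])]

/-- The coefficient of `ψ` in the field equation `(3, 0)`, at `u = 0`. -/
def linear30Psi : Poly :=
  [(4, [0, 0, 0, 0, 0, 0, 0, 0, 0, 1]), (2, [0, 0, 0, 0, 0, 0, 1, 0, 0, 1]),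
    (-2, [0, 0, 0, 0, 0, 0, 1, 1, 0, 1]), (-2, [0, 0, 0, 0, 0, 0, 2, 0, 0, 1]),
    (-2, [0, 0, 0, 0, 0, 0, 2, 1, 0, 1]), (-1, [0, 0, 0, 0, 1, 1]), (-4, [0, 0, 0, 0, 1, 1, 1]),
    (2, [0, 0, 0, 0, 1, 1, 2]), (1, [0, 0, 0, 0, 1, 1, 2, 1]),
    (-2, [0, 0, 0, 1, 1, 2, 0, 0, 0, 1]), (-2, [0, 0, 0, 0, 2, 2, 0, 0, 0, 0, 1]),
    (2, [0, 0, 0, 1, 2, 3]), (-4, [0, 0, 1, 1, 1, 0, 0, 0, 0, 1]),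
    (-4, [0, 0, 1, 0, 2, 0, 0, 0, 0, 0, 1]), (-2, [0, 0, 1, 0, 2, 0, 1, 1, 0, 0, 1]),
    (-2, [0, 0, 1, 0, 2, 0, 2, 1, 0, 0, 1]), (1, [0, 0, 1, 1, 2, 1])]

/-- The coefficient of `χ` in the field equation `(3, 0)`, at `u = 0`. -/
def linear30Chi : Poly :=
  [(-6, [0, 0, 0, 0, 0, 0, 1]), (-6, [0, 0, 0, 0, 0, 0, 2]), (6, [0, 0, 0, 0, 0, 0, 2, 1]),
    (4, [0, 0, 0, 0, 0, 0, 3]), (2, [0, 0, 0, 0, 0, 0, 3, 1]),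
    (-4, [0, 0, 0, 1, 0, 1, 0, 0, 0, 1]), (4, [0, 0, 0, 0, 1, 1, 0, 0, 0, 0, 1]),
    (4, [0, 0, 0, 1, 0, 1, 1, 1, 0, 1]), (-4, [0, 0, 0, 0, 1, 1, 1, 1, 0, 0, 1]),
    (2, [0, 0, 0, 1, 1, 2]), (4, [0, 0, 0, 1, 1, 2, 1]), (6, [0, 0, 1, 1, 1]),
    (2, [0, 0, 1, 1, 1, 0, 1])]

/-- The coefficient of `ψ` in the field equation `(3, 1)`, at `u = 0`. -/
def linear31Psi : Poly :=
  [(-4, [0, 0, 0, 0, 1, 1, 0, 0, 0, 1]), (2, [0, 0, 0, 0, 1, 1, 1, 0, 0, 1]),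
    (2, [0, 0, 0, 0, 1, 1, 1, 1, 0, 1]), (3, [0, 0, 0, 0, 2, 2]),
    (4, [0, 0, 0, 0, 2, 2, 0, 0, 1]), (7, [0, 0, 1, 0, 2]), (12, [0, 0, 1, 0, 2, 0, 0, 0, 1]),
    (4, [0, 0, 1, 0, 2, 0, 1, 0, 1]), (2, [0, 0, 1, 0, 2, 0, 2]), (-3, [0, 0, 1, 0, 2, 0, 2, 1]),
    (-2, [0, 0, 1, 1, 2, 1, 0, 0, 0, 1]), (-2, [0, 0, 1, 0, 3, 1, 0, 0, 0, 0, 1]),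
    (2, [0, 0, 1, 0, 3, 1, 1, 1, 0, 0, 1]), (2, [0, 0, 1, 1, 3, 2]), (4, [0, 0, 2, 1, 3])]

/-- The coefficient of `χ` in the field equation `(3, 1)`, at `u = 0`. -/
def linear31Chi : Poly :=
  [(-8, [0, 0, 0, 0, 0, 0, 0, 0, 0, 1]), (-4, [0, 0, 0, 0, 0, 0, 1, 0, 0, 1]),
    (4, [0, 0, 0, 0, 0, 0, 1, 1, 0, 1]), (4, [0, 0, 0, 0, 0, 0, 2, 0, 0, 1]),
    (4, [0, 0, 0, 0, 0, 0, 2, 1, 0, 1]), (2, [0, 0, 0, 0, 1, 1]),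
    (-8, [0, 0, 0, 0, 1, 1, 0, 0, 1]), (8, [0, 0, 0, 0, 1, 1, 1]),
    (8, [0, 0, 0, 0, 1, 1, 1, 0, 1]), (-4, [0, 0, 0, 0, 1, 1, 2]),
    (-2, [0, 0, 0, 0, 1, 1, 2, 1]), (-4, [0, 0, 0, 1, 2, 3]),
    (-4, [0, 0, 1, 1, 1, 0, 0, 0, 0, 1]), (-4, [0, 0, 1, 0, 2, 0, 0, 0, 0, 0, 1]),
    (-4, [0, 0, 1, 1, 1, 0, 1, 0, 0, 1]), (-4, [0, 0, 1, 0, 2, 0, 1, 0, 0, 0, 1]),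
    (4, [0, 0, 1, 0, 2, 0, 1, 1, 0, 0, 1]), (4, [0, 0, 1, 0, 2, 0, 2, 1, 0, 0, 1]),
    (-2, [0, 0, 1, 1, 2, 1]), (-8, [0, 0, 1, 1, 2, 1, 0, 0, 1])]

/-- The coefficient of `ψ` in the field equation `(3, 2)`, at `u = 0`. -/
def linear32Psi : Poly :=
  [(-8, [0, 0, 0, 0, 0, 0, 0, 0, 1]), (-6, [0, 0, 0, 0, 0, 0, 1]), (-3, [0, 0, 0, 0, 0, 0, 2]),
    (8, [0, 0, 0, 0, 0, 0, 2, 0, 1]), (3, [0, 0, 0, 0, 0, 0, 2, 1]), (4, [0, 0, 0, 0, 0, 0, 3]),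
    (2, [0, 0, 0, 0, 0, 0, 3, 1]), (4, [0, 0, 0, 0, 1, 1, 0, 0, 0, 0, 1]),
    (-2, [0, 0, 0, 1, 0, 1, 1, 0, 0, 1]), (2, [0, 0, 0, 1, 0, 1, 1, 1, 0, 1]),
    (-2, [0, 0, 0, 0, 1, 1, 1, 0, 0, 0, 1]), (-2, [0, 0, 0, 0, 1, 1, 1, 1, 0, 0, 1]),
    (-1, [0, 0, 0, 1, 1, 2]), (4, [0, 0, 0, 1, 1, 2, 0, 0, 1]), (4, [0, 0, 0, 1, 1, 2, 1]),
    (-1, [0, 0, 1, 1, 1]), (4, [0, 0, 1, 1, 1, 0, 0, 0, 1]), (2, [0, 0, 1, 1, 1, 0, 1]),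
    (-4, [0, 0, 1, 1, 1, 0, 1, 0, 1]), (-2, [0, 0, 1, 1, 1, 0, 2]),
    (2, [0, 0, 1, 2, 1, 1, 0, 0, 0, 1]), (2, [0, 0, 1, 1, 2, 1, 0, 0, 0, 0, 1]),
    (-2, [0, 0, 1, 2, 2, 2]), (-4, [0, 0, 2, 2, 2])]

/-- The coefficient of `χ` in the field equation `(3, 2)`, at `u = 0`. -/
def linear32Chi : Poly :=
  [(8, [0, 0, 0, 0, 0, 0, 0, 0, 0, 0, 1]), (4, [0, 0, 0, 0, 0, 0, 1, 0, 0, 0, 1]),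
    (-4, [0, 0, 0, 0, 0, 0, 1, 1, 0, 0, 1]), (-4, [0, 0, 0, 0, 0, 0, 2, 0, 0, 0, 1]),
    (-4, [0, 0, 0, 0, 0, 0, 2, 1, 0, 0, 1]), (2, [0, 0, 0, 1, 0, 1]),
    (8, [0, 0, 0, 1, 0, 1, 0, 0, 1]), (8, [0, 0, 0, 1, 0, 1, 1]),
    (-8, [0, 0, 0, 1, 0, 1, 1, 0, 1]), (-4, [0, 0, 0, 1, 0, 1, 2]),
    (-2, [0, 0, 0, 1, 0, 1, 2, 1]), (-4, [0, 0, 0, 2, 1, 3]),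
    (4, [0, 0, 1, 2, 0, 0, 0, 0, 0, 1]), (4, [0, 0, 1, 1, 1, 0, 0, 0, 0, 0, 1]),
    (4, [0, 0, 1, 2, 0, 0, 1, 0, 0, 1]), (-4, [0, 0, 1, 2, 0, 0, 1, 1, 0, 1]),
    (4, [0, 0, 1, 1, 1, 0, 1, 0, 0, 0, 1]), (-4, [0, 0, 1, 2, 0, 0, 2, 1, 0, 1]),
    (-2, [0, 0, 1, 2, 1, 1]), (8, [0, 0, 1, 2, 1, 1, 0, 0, 1])]

/-- The coefficient of `χ` in the field equation `(4, 0)`, at `u = 0`. -/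
def linear40 : Poly :=
  [(4, [0, 0, 0, 0, 0, 0, 0, 0, 0, 0, 1]), (2, [0, 0, 0, 0, 0, 0, 1, 0, 0, 0, 1]),
    (-2, [0, 0, 0, 0, 0, 0, 1, 1, 0, 0, 1]), (-2, [0, 0, 0, 0, 0, 0, 2, 0, 0, 0, 1]),
    (-2, [0, 0, 0, 0, 0, 0, 2, 1, 0, 0, 1]), (1, [0, 0, 0, 1, 0, 1]), (4, [0, 0, 0, 1, 0, 1, 1]),
    (-2, [0, 0, 0, 1, 0, 1, 2]), (-1, [0, 0, 0, 1, 0, 1, 2, 1]),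
    (-2, [0, 0, 0, 2, 0, 2, 0, 0, 0, 1]), (-2, [0, 0, 0, 1, 1, 2, 0, 0, 0, 0, 1]),
    (-2, [0, 0, 0, 2, 1, 3]), (-4, [0, 0, 1, 2, 0, 0, 0, 0, 0, 1]),
    (-4, [0, 0, 1, 1, 1, 0, 0, 0, 0, 0, 1]), (-2, [0, 0, 1, 2, 0, 0, 1, 1, 0, 1]),
    (-2, [0, 0, 1, 2, 0, 0, 2, 1, 0, 1]), (-1, [0, 0, 1, 2, 1, 1])]

/-- The coefficient of `χ` in the field equation `(4, 1)`, at `u = 0`. -/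
def linear41 : Poly :=
  [(-8, [0, 0, 0, 0, 0, 0, 0, 0, 1]), (6, [0, 0, 0, 0, 0, 0, 1]), (3, [0, 0, 0, 0, 0, 0, 2]),
    (8, [0, 0, 0, 0, 0, 0, 2, 0, 1]), (-3, [0, 0, 0, 0, 0, 0, 2, 1]),
    (-4, [0, 0, 0, 0, 0, 0, 3]), (-2, [0, 0, 0, 0, 0, 0, 3, 1]),
    (4, [0, 0, 0, 1, 0, 1, 0, 0, 0, 1]), (-2, [0, 0, 0, 1, 0, 1, 1, 0, 0, 1]),
    (-2, [0, 0, 0, 1, 0, 1, 1, 1, 0, 1]), (-2, [0, 0, 0, 0, 1, 1, 1, 0, 0, 0, 1]),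
    (2, [0, 0, 0, 0, 1, 1, 1, 1, 0, 0, 1]), (1, [0, 0, 0, 1, 1, 2]),
    (4, [0, 0, 0, 1, 1, 2, 0, 0, 1]), (-4, [0, 0, 0, 1, 1, 2, 1]), (1, [0, 0, 1, 1, 1]),
    (4, [0, 0, 1, 1, 1, 0, 0, 0, 1]), (-2, [0, 0, 1, 1, 1, 0, 1]),
    (-4, [0, 0, 1, 1, 1, 0, 1, 0, 1]), (2, [0, 0, 1, 1, 1, 0, 2]),
    (2, [0, 0, 1, 2, 1, 1, 0, 0, 0, 1]), (2, [0, 0, 1, 1, 2, 1, 0, 0, 0, 0, 1]),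
    (2, [0, 0, 1, 2, 2, 2]), (4, [0, 0, 2, 2, 2])]

/-- The coefficient of `χ` in the field equation `(4, 2)`, at `u = 0`. -/
def linear42 : Poly :=
  [(-4, [0, 0, 0, 1, 0, 1, 0, 0, 0, 0, 1]), (2, [0, 0, 0, 1, 0, 1, 1, 0, 0, 0, 1]),
    (2, [0, 0, 0, 1, 0, 1, 1, 1, 0, 0, 1]), (-3, [0, 0, 0, 2, 0, 2]),
    (4, [0, 0, 0, 2, 0, 2, 0, 0, 1]), (-7, [0, 0, 1, 2]), (12, [0, 0, 1, 2, 0, 0, 0, 0, 1]),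
    (4, [0, 0, 1, 2, 0, 0, 1, 0, 1]), (-2, [0, 0, 1, 2, 0, 0, 2]), (3, [0, 0, 1, 2, 0, 0, 2, 1]),
    (-2, [0, 0, 1, 3, 0, 1, 0, 0, 0, 1]), (-2, [0, 0, 1, 2, 1, 1, 0, 0, 0, 0, 1]),
    (2, [0, 0, 1, 3, 0, 1, 1, 1, 0, 1]), (-2, [0, 0, 1, 3, 1, 2]), (-4, [0, 0, 2, 3, 1])]

/-- The leading coefficient of the field equation `(0, 0)`. -/
def body00 : Poly :=
  [(-3, [3]), (2, [0, 0, 0, 0, 0, 0, 0, 0, 0, 0, 0, 0, 0, 0, 0, 0, 0, 0, 1]),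
    (-1, [3, 0, 0, 0, 0, 0, 2]), (1, [1, 0, 0, 0, 0, 0, 2, 1]), (-1, [3, 0, 0, 1, 1, 2]),
    (1, [1, 0, 1, 1, 1]), (-1, [0, 1, 1, 2, 0, 0, 0, 0, 0, 1]),
    (-1, [0, 1, 1, 1, 1, 0, 0, 0, 0, 0, 1]), (-1, [3, 2, 0, 2, 0, 2]), (5, [2, 2, 1, 2]),
    (-2, [0, 2, 1, 2, 0, 0, 0, 0, 1]), (-1, [1, 2, 1, 2, 0, 0, 2, 1]), (3, [3, 2, 2, 3, 1])]

/-- The leading coefficient of the field equation `(1, 0)`. -/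
def body10 : Poly :=
  [(2, [0, 0, 0, 0, 0, 0, 0, 0, 0, 0, 0, 0, 0, 0, 0, 0, 0, 0, 0, 0, 0, 1]),
    (1, [0, 0, 0, 0, 0, 0, 0, 0, 0, 1]), (-1, [1, 0, 0, 0, 0, 0, 1, 0, 0, 1]),
    (-1, [1, 0, 0, 0, 0, 0, 1, 1, 0, 1]), (-1, [2, 0, 0, 0, 1, 1]),
    (-1, [1, 0, 1, 1, 1, 0, 0, 0, 0, 1]), (-1, [1, 0, 1, 0, 2, 0, 0, 0, 0, 0, 1]),
    (-1, [1, 0, 1, 0, 2, 0, 1, 1, 0, 0, 1]), (2, [0, 1, 0, 0, 0, 0, 0, 0, 1]),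
    (-2, [0, 1, 0, 0, 0, 0, 1, 0, 1]), (-1, [1, 1, 0, 0, 0, 0, 2]),
    (1, [1, 1, 0, 0, 0, 0, 2, 1]), (-1, [3, 1, 0, 1, 1, 2]), (5, [2, 1, 1, 1, 1]),
    (3, [3, 1, 2, 2, 2]), (-1, [0, 2, 0, 0, 0, 0, 0, 0, 0, 0, 1]),
    (1, [1, 2, 0, 0, 0, 0, 1, 0, 0, 0, 1]), (1, [1, 2, 0, 0, 0, 0, 1, 1, 0, 0, 1]),
    (-1, [2, 2, 0, 1, 0, 1]), (-3, [1, 2, 1, 2, 0, 0, 0, 0, 0, 1]),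
    (-3, [1, 2, 1, 1, 1, 0, 0, 0, 0, 0, 1]), (1, [1, 2, 1, 2, 0, 0, 1, 1, 0, 1]),
    (-1, [3, 3, 0, 2, 0, 2]), (5, [2, 3, 1, 2]), (-2, [0, 3, 1, 2, 0, 0, 0, 0, 1]),
    (-1, [1, 3, 1, 2, 0, 0, 2, 1]), (3, [3, 3, 2, 3, 1])]

/-- The leading coefficient of the field equation `(2, 0)`. -/
def body20 : Poly :=
  [(2, [0, 0, 0, 0, 0, 0, 0, 0, 0, 0, 0, 0, 0, 0, 0, 0, 0, 0, 0, 0, 0, 0, 0, 0, 1]),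
    (1, [0, 0, 0, 0, 0, 0, 0, 0, 0, 0, 1]), (1, [1, 0, 0, 0, 0, 0, 1, 0, 0, 0, 1]),
    (1, [1, 0, 0, 0, 0, 0, 1, 1, 0, 0, 1]), (-1, [2, 0, 0, 1, 0, 1]),
    (1, [1, 0, 1, 2, 0, 0, 0, 0, 0, 1]), (1, [1, 0, 1, 1, 1, 0, 0, 0, 0, 0, 1]),
    (1, [1, 0, 1, 2, 0, 0, 1, 1, 0, 1]), (1, [3, 1, 0, 2, 0, 2]), (-5, [2, 1, 1, 2]),
    (2, [0, 1, 1, 2, 0, 0, 0, 0, 1]), (1, [1, 1, 1, 2, 0, 0, 2, 1]), (-3, [3, 1, 2, 3, 1])]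

/-- The leading coefficient of the field equation `(0, 2)`. -/
def body02 : Poly :=
  [(2, [0, 0, 0, 0, 0, 0, 0, 0, 0, 0, 0, 0, 0, 0, 0, 0, 0, 0, 0, 0, 1]),
    (1, [0, 0, 0, 0, 0, 0, 0, 0, 0, 0, 1]), (-1, [1, 0, 0, 0, 0, 0, 1, 0, 0, 0, 1]),
    (-1, [1, 0, 0, 0, 0, 0, 1, 1, 0, 0, 1]), (1, [2, 0, 0, 1, 0, 1]),
    (1, [1, 0, 1, 2, 0, 0, 0, 0, 0, 1]), (1, [1, 0, 1, 1, 1, 0, 0, 0, 0, 0, 1]),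
    (-1, [1, 0, 1, 2, 0, 0, 1, 1, 0, 1]), (1, [3, 1, 0, 2, 0, 2]), (-5, [2, 1, 1, 2]),
    (2, [0, 1, 1, 2, 0, 0, 0, 0, 1]), (1, [1, 1, 1, 2, 0, 0, 2, 1]), (-3, [3, 1, 2, 3, 1])]

/-- The leading coefficient of the field equation `(1, 2)`. -/
def body12 : Poly :=
  [(-3, [2]), (2, [0, 0, 0, 0, 0, 0, 0, 0, 0, 0, 0, 0, 0, 0, 0, 0, 0, 0, 0, 0, 0, 0, 0, 1]),
    (-2, [0, 0, 0, 0, 0, 0, 0, 0, 1]), (2, [0, 0, 0, 0, 0, 0, 1, 0, 1]),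
    (1, [2, 0, 0, 0, 0, 0, 2]), (1, [1, 0, 0, 0, 0, 0, 2, 1]), (-1, [3, 0, 0, 1, 1, 2]),
    (-1, [2, 0, 1, 1, 1]), (-3, [3, 0, 2, 2, 2]), (2, [0, 1, 0, 0, 0, 0, 0, 0, 0, 0, 1]),
    (-1, [0, 1, 0, 0, 0, 0, 1, 0, 0, 0, 1]), (-1, [0, 1, 0, 0, 0, 0, 1, 1, 0, 0, 1]),
    (1, [1, 1, 0, 1, 0, 1]), (1, [0, 1, 1, 2, 0, 0, 0, 0, 0, 1]),
    (1, [0, 1, 1, 1, 1, 0, 0, 0, 0, 0, 1]), (-1, [0, 1, 1, 2, 0, 0, 1, 1, 0, 1]),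
    (1, [3, 2, 0, 2, 0, 2]), (-5, [2, 2, 1, 2]), (2, [0, 2, 1, 2, 0, 0, 0, 0, 1]),
    (1, [1, 2, 1, 2, 0, 0, 2, 1]), (-3, [3, 2, 2, 3, 1])]

/-- The leading coefficient of the field equation `(2, 2)`. -/
def body22 : Poly :=
  [(2, [0, 0, 0, 0, 0, 0, 0, 0, 0, 0, 0, 0, 0, 0, 0, 0, 0, 0, 0, 0, 0, 0, 0, 0, 0, 0, 1]),
    (-1, [3, 0, 0, 2, 0, 2]), (5, [2, 0, 1, 2]), (-2, [0, 0, 1, 2, 0, 0, 0, 0, 1]),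
    (-1, [1, 0, 1, 2, 0, 0, 2, 1]), (3, [3, 0, 2, 3, 1])]

/-- The leading coefficient of the field equation `(2, 1)`. -/
def body21 : Poly :=
  [(-3, [2]),
    (2, [0, 0, 0, 0, 0, 0, 0, 0, 0, 0, 0, 0, 0, 0, 0, 0, 0, 0, 0, 0, 0, 0, 0, 0, 0, 1]),
    (-2, [0, 0, 0, 0, 0, 0, 0, 0, 1]), (-2, [0, 0, 0, 0, 0, 0, 1, 0, 1]),
    (1, [2, 0, 0, 0, 0, 0, 2]), (1, [1, 0, 0, 0, 0, 0, 2, 1]), (-1, [3, 0, 0, 1, 1, 2]),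
    (-1, [2, 0, 1, 1, 1]), (-3, [3, 0, 2, 2, 2]), (2, [0, 1, 0, 0, 0, 0, 0, 0, 0, 0, 1]),
    (1, [0, 1, 0, 0, 0, 0, 1, 0, 0, 0, 1]), (1, [0, 1, 0, 0, 0, 0, 1, 1, 0, 0, 1]),
    (-1, [1, 1, 0, 1, 0, 1]), (1, [0, 1, 1, 2, 0, 0, 0, 0, 0, 1]),
    (1, [0, 1, 1, 1, 1, 0, 0, 0, 0, 0, 1]), (1, [0, 1, 1, 2, 0, 0, 1, 1, 0, 1]),
    (1, [3, 2, 0, 2, 0, 2]), (-5, [2, 2, 1, 2]), (2, [0, 2, 1, 2, 0, 0, 0, 0, 1]),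
    (1, [1, 2, 1, 2, 0, 0, 2, 1]), (-3, [3, 2, 2, 3, 1])]

/-- The `n`-th variable. -/
def var (n : ℕ) : Poly := [(1, List.replicate n 0 ++ [1])]

/-- The leading part of a one-form. -/
def frame : Fin 5 → Poly
  | 0 => [(1, [0, 0, 0, 0, 0, 0, 0, 0, 1]), (-1, [0, 1, 0, 0, 0, 0, 0, 0, 0, 0, 1])]
  | 1 => [(1, [0, 0, 0, 0, 0, 0, 0, 0, 0, 1]), (2, [0, 1, 0, 0, 0, 0, 0, 0, 1]),
      (-1, [0, 2, 0, 0, 0, 0, 0, 0, 0, 0, 1])]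
  | 2 => [(1, [0, 0, 0, 0, 0, 0, 0, 0, 0, 0, 1])]
  | _ => []

/-- The product with `c u ^ n`. -/
def polyShift (c : ℤ) (n : ℕ) (p : Poly) : Poly := termMul (c, [0, n]) p

/-- The test for the equality of two polynomials. -/
def polysEq (p q : Poly) : Bool := isZero (p ++ termMul (-1, []) q)

namespace Form

/-- The field equation for a one-form `X` with the partial derivatives `DX`. -/
def fieldEq (X : Fin 5 → Form) (DX : Fin 5 → Fin 5 → Form) (μ ν : Fin 5) : Form :=
  ((sourceEntry μ ν).add (interior (raise inverse X) field μ ν)).add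
    ((cov1 gamma X DX μ ν).term (2, []))

/-- A one-form with the given coefficients. -/
def oneForm (c0 c1 c2 c3 c4 c5 c6 : Poly) : Fin 5 → Form
  | 0 => (SPoly.mk (frame 0) [] [] c0).form
  | 1 => (SPoly.mk (frame 1) [] [] c1).form
  | 2 => (SPoly.mk (frame 2) [] [] c2).form
  | 3 => (SPoly.mk [] c3 c4 []).form
  | 4 => (SPoly.mk [] c5 c6 []).form

/-- The partial derivatives of a one-form. -/
def derivs (X : Fin 5 → Form) (μ ν : Fin 5) : Form :=
  bif Nat.ble 3 μ then pd 0 μ (X ν)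
  else (SPoly.mk (var (18 + 3 * μ + ν)) [] [] (var (27 + 3 * μ + ν))).form

/-- A general one-form. -/
def genericForm : Fin 5 → Form :=
  oneForm (var 11) (var 12) (var 13) (var 14) (var 15) (var 16) (var 17)

/-- A one-form that satisfies the field equations with two odd indices. -/
def mixedForm : Fin 5 → Form := oneForm (var 11) (var 12) (var 13) psiPsi psiChi chiPsi chiChi

/-- A one-form that satisfies the field equations with two odd indices and a half of those with one
odd index. -/
def topForm : Fin 5 → Form := oneForm phiTop yTop uTop psiPsi psiChi chiPsi chiChi

/-- The leading part of `∂_μ X_ν` for odd `μ, ν` is a linear coefficient of `X_ν`, and it occurs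
here with factor `-2`. So each of the four equations determines one unknown. Variable `n + 8` stands
for the entry `n` of `jet`. -/
theorem odd_check : (polysEq ((fieldEq genericForm (derivs genericForm) 3 3).part .one)
      (polySmul (-2) (var 14 ++ polySmul (-1) psiPsi)) &&
    polysEq ((fieldEq genericForm (derivs genericForm) 3 4).part .one)
      (polySmul (-2) (var 16 ++ polySmul (-1) chiPsi)) &&
    polysEq ((fieldEq genericForm (derivs genericForm) 4 3).part .one)
      (polySmul (-2) (var 15 ++ polySmul (-1) psiChi)) &&
    polysEq ((fieldEq genericForm (derivs genericForm) 4 4).part .one)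
      (polySmul (-2) (var 17 ++ polySmul (-1) chiChi))) = true := by
  decide +kernel

/-- Since `∂_χ (ψχ) = -ψ`, the `ψ`-part of the equation with indices `χ, i` contains the
`ψχ`-coefficient of `X_i`; after insertion of the odd coefficients the equation determines it. -/
theorem mixed_check : (polysEq ((fieldEq mixedForm (derivs mixedForm) 4 0).part .psi)
      (polySmul 2 (var 11 ++ polySmul (-1) phiTop)) &&
    polysEq ((fieldEq mixedForm (derivs mixedForm) 4 1).part .psi)
      (polySmul 2 (var 12 ++ polySmul (-1) yTop)) &&
    polysEq ((fieldEq mixedForm (derivs mixedForm) 4 2).part .psi)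
      (polySmul 2 (var 13 ++ polySmul (-1) uTop))) = true := by
  decide +kernel

/-- For even `μ` the derivatives of `X` are treated as independent variables; they are related to
its values only later, once some components are known to be constant. -/
theorem body_check : (polysEq ((fieldEq genericForm (derivs genericForm) 0 0).part .one) body00 &&
      polysEq ((fieldEq genericForm (derivs genericForm) 1 0).part .one) body10 &&
      polysEq ((fieldEq genericForm (derivs genericForm) 2 0).part .one) body20 &&
      polysEq ((fieldEq genericForm (derivs genericForm) 0 2).part .one) body02 &&
      polysEq ((fieldEq genericForm (derivs genericForm) 1 2).part .one) body12 &&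
      polysEq ((fieldEq genericForm (derivs genericForm) 2 2).part .one) body22 &&
      polysEq ((fieldEq genericForm (derivs genericForm) 2 1).part .one) body21) = true := by
  decide +kernel

/-- This and the next eight checks express the remaining equations by polynomials free of `u`, with
powers of `u` as multipliers. The system is unitriangular in the order listed. The factor 32 clears
the denominators. -/
theorem linear42_check : polysEq (polySmul 32
    ((fieldEq topForm (derivs topForm) 4 2).part .chi))
    linear42 = true := by
  decide +kernel

theorem linear40_check : polysEq (polySmul 32
    ((fieldEq topForm (derivs topForm) 4 0).part .chi))
    (linear40 ++ polyShift (-1) 1 linear42) = true := by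
  decide +kernel

theorem linear41_check : polysEq (polySmul 32
    ((fieldEq topForm (derivs topForm) 4 1).part .chi))
    (linear41 ++ polyShift 2 1 linear40 ++ polyShift (-1) 2 linear42) = true := by
  decide +kernel

theorem linear32Chi_check : polysEq (polySmul 32
    ((fieldEq topForm (derivs topForm) 3 2).part .chi))
    (linear32Chi ++ polyShift 2 1 linear42) = true := by
  decide +kernel

theorem linear32Psi_check : polysEq (polySmul 32
    ((fieldEq topForm (derivs topForm) 3 2).part .psi))
    (linear32Psi ++ polyShift 1 1 linear32Chi ++ polyShift 1 2 linear42) = true := by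
  decide +kernel

theorem linear30Chi_check : polysEq (polySmul 32
    ((fieldEq topForm (derivs topForm) 3 0).part .chi))
    (linear30Chi ++ polyShift (-1) 1 linear32Chi ++ polyShift 2 1 linear40 ++
        polyShift (-2) 2 linear42) = true := by
  decide +kernel

theorem linear30Psi_check : polysEq (polySmul 32
    ((fieldEq topForm (derivs topForm) 3 0).part .psi))
    (linear30Psi ++ polyShift 1 1 linear30Chi ++ polyShift (-1) 1 linear32Psi ++
        polyShift (-1) 2 linear32Chi ++ polyShift 1 2 linear40 ++
        polyShift (-1) 3 linear42) = true := by
  decide +kernel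

theorem linear31Chi_check : polysEq (polySmul 32
    ((fieldEq topForm (derivs topForm) 3 1).part .chi))
    (linear31Chi ++ polyShift 2 1 linear30Chi ++ polyShift 2 1 linear41 ++
        polyShift (-1) 2 linear32Chi ++ polyShift 4 2 linear40 ++
        polyShift (-2) 3 linear42) = true := by
  decide +kernel

theorem linear31Psi_check : polysEq (polySmul 32
    ((fieldEq topForm (derivs topForm) 3 1).part .psi))
    (linear31Psi ++ polyShift 2 1 linear30Psi ++ polyShift 1 1 linear31Chi ++
        polyShift 2 2 linear30Chi ++ polyShift (-1) 2 linear32Psi ++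
        polyShift 1 2 linear41 ++ polyShift (-1) 3 linear32Chi ++
        polyShift 2 3 linear40 ++ polyShift (-1) 4 linear42) = true := by
  decide +kernel

end Form

end OSp

namespace OSp

/-! ### The field equations at a point -/

theorem polyEval_var (v : ℕ → ℝ) (n : ℕ) : polyEval v (var n) = v n := by
  have h : ∀ v : ℕ → ℝ, monoEval v (List.replicate n 0 ++ [1]) = v n := by
    induction n with
    | zero => intro v; simp [monoEval]
    | succ n ih =>
      intro v
      rw [List.replicate_succ, List.cons_append, monoEval, ih, pow_zero, one_mul]
  simp [var, polyEval, h]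

theorem polyEval_polyShift (v : ℕ → ℝ) (c : ℤ) (n : ℕ) (p : Poly) :
    polyEval v (polyShift c n p) = c * v 1 ^ n * polyEval v p := by
  simp [polyShift, polyEval_termMul, monoEval]

theorem polyEval_eq_of_polysEq (P : Params) (ξ : ℕ → ℝ) (u : ℝ) {p q : Poly}
    (h : polysEq p q = true) : polyEval (P.env ξ u) p = polyEval (P.env ξ u) q := by
  have h := polyEval_of_isZero P ξ u _ h
  rw [polyEval_append, polyEval_termMul] at h
  simp only [Int.cast_neg, Int.cast_one, monoEval] at h
  linarith

/-- The values at `x` of the coefficients of the one-form `X` and of its derivatives. -/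
noncomputable def jet (X : Vec) (x : Fin 3 → ℝ) : ℕ → ℝ
  | 0 => X 0 ∅ x + x 2 * X 2 ∅ x
  | 1 => X 1 ∅ x / scale 2 x - 2 * x 2 * (X 0 ∅ x + x 2 * X 2 ∅ x) + x 2 ^ 2 * X 2 ∅ x
  | 2 => X 2 ∅ x
  | 3 => X 0 {0, 1} x / scale 1 x
  | 4 => X 1 {0, 1} x / scale 3 x
  | 5 => X 2 {0, 1} x / scale 1 x
  | 6 => X 3 {0} x / scale 2 x
  | 7 => X 3 {1} x / scale 1 x
  | 8 => X 4 {0} x / scale 1 x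
  | 9 => X 4 {1} x
  | 10 => derivEven 0 (X 0) ∅ x
  | 11 => derivEven 0 (X 1) ∅ x / scale 2 x
  | 12 => derivEven 0 (X 2) ∅ x
  | 13 => derivEven 1 (X 0) ∅ x / scale 2 x
  | 14 => derivEven 1 (X 1) ∅ x / scale 4 x
  | 15 => derivEven 1 (X 2) ∅ x / scale 2 x
  | 16 => derivEven 2 (X 0) ∅ x
  | 17 => derivEven 2 (X 1) ∅ x / scale 2 x
  | 18 => derivEven 2 (X 2) ∅ x
  | 19 => derivEven 0 (X 0) {0, 1} x / scale 1 x
  | 20 => derivEven 0 (X 1) {0, 1} x / scale 3 x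
  | 21 => derivEven 0 (X 2) {0, 1} x / scale 1 x
  | 22 => derivEven 1 (X 0) {0, 1} x / scale 3 x
  | 23 => derivEven 1 (X 1) {0, 1} x / scale 5 x
  | 24 => derivEven 1 (X 2) {0, 1} x / scale 3 x
  | 25 => derivEven 2 (X 0) {0, 1} x / scale 1 x
  | 26 => derivEven 2 (X 1) {0, 1} x / scale 3 x
  | 27 => derivEven 2 (X 2) {0, 1} x / scale 1 x
  | _ => 0

theorem IsEvenField.apply_eq_zero {U : Set (Fin 3 → ℝ)} {V : Vec} (hV : IsEvenField U V)
    {x : Fin 3 → ℝ} (hx : x ∈ U) (μ : Fin 5) (S : Finset ℕ) (h : S.card % 2 ≠ par μ % 2) :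
    V μ S x = 0 := by
  by_contra h'
  exact h ((hV μ).2 S x hx h')

theorem derivEven_eq_zero {U : Set (Fin 3 → ℝ)} (hU : IsOpen U) {f : SuperFun} {S : Finset ℕ}
    (hf : ∀ y ∈ U, f S y = 0) {x : Fin 3 → ℝ} (hx : x ∈ U) (i : Fin 3) :
    derivEven i f S x = 0 := by
  rw [derivEven_apply_congr hU hf hx]
  simp

section

variable {P : Params} {U : Set (Fin 3 → ℝ)} {G M B : Ten2} {X : Vec} {x : Fin 3 → ℝ}
  {c0 c1 c2 c3 c4 c5 c6 : Poly}

/-- `X` is an arbitrary field, so the representation is at the single point `x`, with `ξ` the jet of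
`X` there. The seven polynomials are arbitrary with the right values, so that solved coefficients
can be substituted step by step. Parity removes the other coefficients. -/
theorem rep_oneForm (hX : IsEvenField U X) (hx : x ∈ U)
    (h0 : polyEval (P.env (jet X x) (x 2)) c0 = jet X x 3)
    (h1 : polyEval (P.env (jet X x) (x 2)) c1 = jet X x 4)
    (h2 : polyEval (P.env (jet X x) (x 2)) c2 = jet X x 5)
    (h3 : polyEval (P.env (jet X x) (x 2)) c3 = jet X x 6)
    (h4 : polyEval (P.env (jet X x) (x 2)) c4 = jet X x 7)
    (h5 : polyEval (P.env (jet X x) (x 2)) c5 = jet X x 8)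
    (h6 : polyEval (P.env (jet X x) (x 2)) c6 = jet X x 9) (i : Fin 5) :
    Rep P (jet X x) x (wt i) (X i) (Form.oneForm c0 c1 c2 c3 c4 c5 c6 i) := by
  have hz := fun μ S h => hX.apply_eq_zero hx μ S h
  have hs := fun W => scale_ne_zero W x
  fin_cases i
  · refine rep_form_iff.2 ⟨?_, ?_, ?_, ?_⟩
    · simp [frame, polyEval, monoEval, Params.env, wt, jet]
    · simpa using hz 0 {0} (by decide)
    · simpa using hz 0 {1} (by decide)
    · simp [h0, jet, wt, mul_div_cancel₀ _ (hs 1)]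
  · refine rep_form_iff.2 ⟨?_, ?_, ?_, ?_⟩
    · have := hs 2
      simp [frame, polyEval, monoEval, Params.env, wt, jet]
      field_simp
      ring
    · simpa using hz 1 {0} (by decide)
    · simpa using hz 1 {1} (by decide)
    · simp [h1, jet, wt, mul_div_cancel₀ _ (hs 3)]
  · refine rep_form_iff.2 ⟨?_, ?_, ?_, ?_⟩
    · simp [frame, polyEval, monoEval, Params.env, wt, jet]
    · simpa using hz 2 {0} (by decide)
    · simpa using hz 2 {1} (by decide)
    · simp [h2, jet, wt, mul_div_cancel₀ _ (hs 1)]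
  · refine rep_form_iff.2 ⟨?_, ?_, ?_, ?_⟩
    · simpa using hz 3 ∅ (by decide)
    · simp [h3, jet, wt, mul_div_cancel₀ _ (hs 2)]
    · simp [h4, jet, wt, mul_div_cancel₀ _ (hs 1)]
    · simpa using hz 3 {0, 1} (by decide)
  · refine rep_form_iff.2 ⟨?_, ?_, ?_, ?_⟩
    · simpa using hz 4 ∅ (by decide)
    · simp [h5, jet, wt, mul_div_cancel₀ _ (hs 1)]
    · simp [h6, jet, wt]
    · simpa using hz 4 {0, 1} (by decide)

/-- Odd derivatives are read off from the coefficients at `x`; even derivatives are entries of the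
jet. The hypothesis `h` excludes even derivatives of the odd components, for which the jet has no
entries. -/
theorem rep_derivs (hU : IsOpen U) (hX : IsEvenField U X) (hx : x ∈ U) {Xp : Fin 5 → Form}
    (hXp : ∀ i, Rep P (jet X x) x (wt i) (X i) (Xp i)) (μ ν : Fin 5)
    (h : 3 ≤ μ.val ∨ ν.val < 3) :
    Rep P (jet X x) x (wt μ + wt ν) (pd μ (X ν)) (Form.derivs Xp μ ν) := by
  have hz := fun (i : Fin 3) μ S h =>
    derivEven_eq_zero hU (fun y hy => hX.apply_eq_zero hy μ S h) hx i
  have hs := fun W => scale_ne_zero W x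
  have key : ∀ (i : Fin 3) (j : Fin 5) (V W : ℤ) (f : SuperFun) (m n : ℕ), f = X j →
      par j = 0 → V + 1 = W →
      derivEven i (X j) ∅ x = scale V x * jet X x m →
      derivEven i (X j) {0, 1} x = scale W x * jet X x n →
      Rep P (jet X x) x V (derivEven i f) (SPoly.mk (var (8 + m)) [] [] (var (8 + n))).form := by
    intro i j V W f m n hf hj hW h0 h3
    subst hf hW
    refine rep_form_iff.2 ⟨?_, ?_, ?_, ?_⟩
    · rw [polyEval_var, h0, Nat.add_comm]; rfl
    · simpa using hz i j {0} (by rw [hj]; decide)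
    · simpa using hz i j {1} (by rw [hj]; decide)
    · rw [polyEval_var, h3, Nat.add_comm]; rfl
  fin_cases μ
  · fin_cases ν
    · exact key 0 0 0 1 _ 10 19 rfl rfl rfl (by simp [jet])
        (by simp [jet, mul_div_cancel₀ _ (hs 1)])
    · exact key 0 1 2 3 _ 11 20 rfl rfl rfl (by simp [jet, mul_div_cancel₀ _ (hs 2)])
        (by simp [jet, mul_div_cancel₀ _ (hs 3)])
    · exact key 0 2 0 1 _ 12 21 rfl rfl rfl (by simp [jet])
        (by simp [jet, mul_div_cancel₀ _ (hs 1)])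
    · exact absurd h (by decide)
    · exact absurd h (by decide)
  · fin_cases ν
    · exact key 1 0 2 3 _ 13 22 rfl rfl rfl (by simp [jet, mul_div_cancel₀ _ (hs 2)])
        (by simp [jet, mul_div_cancel₀ _ (hs 3)])
    · exact key 1 1 4 5 _ 14 23 rfl rfl rfl (by simp [jet, mul_div_cancel₀ _ (hs 4)])
        (by simp [jet, mul_div_cancel₀ _ (hs 5)])
    · exact key 1 2 2 3 _ 15 24 rfl rfl rfl (by simp [jet, mul_div_cancel₀ _ (hs 2)])
        (by simp [jet, mul_div_cancel₀ _ (hs 3)])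
    · exact absurd h (by decide)
    · exact absurd h (by decide)
  · fin_cases ν
    · exact key 2 0 0 1 _ 16 25 rfl rfl rfl (by simp [jet])
        (by simp [jet, mul_div_cancel₀ _ (hs 1)])
    · exact key 2 1 2 3 _ 17 26 rfl rfl rfl (by simp [jet, mul_div_cancel₀ _ (hs 2)])
        (by simp [jet, mul_div_cancel₀ _ (hs 3)])
    · exact key 2 2 0 1 _ 18 27 rfl rfl rfl (by simp [jet])
        (by simp [jet, mul_div_cancel₀ _ (hs 1)])
    · exact absurd h (by decide)
    · exact absurd h (by decide)
  · exact ((hXp ν).derivOdd_zero (V := 0)).cast (by simp [wt, add_comm])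
  · exact ((hXp ν).derivOdd_one (V := 0)).cast (by simp [wt])

theorem rep_fieldEq (hb : IsBackground P G B) (hM : IsInverse U G M) (hU : IsOpen U) (hx : x ∈ U)
    {ξ : ℕ → ℝ} {Xp : Fin 5 → Form} (hX : ∀ i, Rep P ξ x (wt i) (X i) (Xp i))
    {DX : Fin 5 → Fin 5 → Form} (μ ν : Fin 5)
    (hDX : Rep P ξ x (wt μ + wt ν) (pd μ (X ν)) (DX μ ν)) (hm : (μ, ν) ∈ Form.usedPairs) :
    Rep P ξ x (wt μ + wt ν) (fieldEq G M (flux B) X μ ν) (Form.fieldEq Xp DX μ ν) := by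
  have hΓ := fun l j k => hb.rep_christoffel hM hU ξ l j k
  have hI := fun i j => hb.rep_inverse hM ξ hx i j
  have hH := hb.flux ξ
  have hs : Rep P ξ x (wt μ + wt ν) (ricci G M μ ν + (1 / 4 : ℝ) • (∑ ρ, ∑ σ,
      flux B μ ρ σ * raise2 M (flux B) σ ρ ν) - (1 / 2 : ℝ) • divFlux G M (flux B) μ ν)
      (Form.source μ ν) :=
    ((rep_ricci hU hΓ hx μ ν).add ((Rep.sum fun ρ => Rep.sum fun σ =>
      (hH x μ ρ σ).mul (hb.rep_raise2 hM ξ hx σ ρ ν) (by ring)).term _ _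
        (by norm_num [monoEval, Params.env]))).sub
      ((rep_divFlux hU hI hΓ (fun i j k y _ => hH y i j k) hx μ ν).term _ _
        (by norm_num [monoEval, Params.env]))
  have hc := List.all_eq_true.1 Form.source_check _ hm
  exact ((hs.of_isZero hc).add (rep_interior (rep_raise hI hX) (hH x) μ ν)).add
    ((rep_cov1 (fun l j k => hΓ l j k x hx) hX μ ν hDX).term _ _ (by norm_num [monoEval]))

/-- The polynomial identities implied by the field equations. -/
theorem polyEval_eq_zero_of_fieldEq (hb : IsBackground P G B) (hM : IsInverse U G M)
    (hU : IsOpen U) (hX : IsEvenField U X)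
    (hF : ∀ μ ν, EqOver U (fieldEq G M (flux B) X μ ν) 0) (hx : x ∈ U) :
    ∀ p ∈ [linear42, linear40, linear41, linear32Chi, linear32Psi, linear30Chi, linear30Psi,
      linear31Chi, linear31Psi, body00, body10, body20, body02, body12, body22, body21],
    polyEval (P.env (jet X x) (x 2)) p = 0 := by
  set v := P.env (jet X x) (x 2) with hv
  -- Every part of every used equation vanishes, for each description of the higher coefficients of
  -- `X` by polynomials. This is applied to the generic form, then after each of the two
  -- eliminations.
  have main : ∀ {c0 c1 c2 c3 c4 c5 c6 : Poly}, polyEval v c0 = jet X x 3 →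
      polyEval v c1 = jet X x 4 → polyEval v c2 = jet X x 5 → polyEval v c3 = jet X x 6 →
      polyEval v c4 = jet X x 7 → polyEval v c5 = jet X x 8 → polyEval v c6 = jet X x 9 →
      ∀ m ∈ Form.usedPairs, ∀ a, polyEval v ((Form.fieldEq (Form.oneForm c0 c1 c2 c3 c4 c5 c6)
        (Form.derivs (Form.oneForm c0 c1 c2 c3 c4 c5 c6)) m.1 m.2).part a) = 0 := by
    intro c0 c1 c2 c3 c4 c5 c6 h0 h1 h2 h3 h4 h5 h6 m hm a
    have hd : ∀ m ∈ Form.usedPairs, 3 ≤ m.1.val ∨ m.2.val < 3 := by decide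
    have hX1 := rep_oneForm hX hx h0 h1 h2 h3 h4 h5 h6
    obtain ⟨e0, e1, e2, e3⟩ := rep_fieldEq hb hM hU hx hX1 m.1 m.2
      (rep_derivs hU hX hx hX1 m.1 m.2 (hd m hm)) hm
    have hF := fun S => hF m.1 m.2 S x hx
    simp only [coeff_eq, zero_apply] at hF
    rw [hF, zero_eq_mul, or_iff_right (scale_ne_zero _ _)] at e0 e1 e2 e3
    cases a
    exacts [e0, e1, e2, e3]
  have hvar : ∀ n, polyEval v (var (n + 8)) = jet X x n := fun n => polyEval_var v (n + 8)
  have h1 := main (hvar 3) (hvar 4) (hvar 5) (hvar 6) (hvar 7) (hvar 8) (hvar 9)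
  have eq := fun {p q} (h : polysEq p q = true) => polyEval_eq_of_polysEq P (jet X x) (x 2) h
  rw [← hv] at eq
  have ho := Form.odd_check
  simp only [Bool.and_eq_true] at ho
  obtain ⟨⟨⟨ho1, ho2⟩, ho3⟩, ho4⟩ := ho
  -- First elimination: the equations with two odd indices give the linear coefficients of `X_ψ` and
  -- `X_χ`.
  have k6 : polyEval v psiPsi = jet X x 6 := by
    have := (eq ho1).symm.trans (h1 (3, 3) (by decide) .one)
    rw [polyEval_smul, polyEval_append, polyEval_smul, hvar 6] at this
    push_cast at this
    linarith
  have k8 : polyEval v chiPsi = jet X x 8 := by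
    have := (eq ho2).symm.trans (h1 (3, 4) (by decide) .one)
    rw [polyEval_smul, polyEval_append, polyEval_smul, hvar 8] at this
    push_cast at this
    linarith
  have k7 : polyEval v psiChi = jet X x 7 := by
    have := (eq ho3).symm.trans (h1 (4, 3) (by decide) .one)
    rw [polyEval_smul, polyEval_append, polyEval_smul, hvar 7] at this
    push_cast at this
    linarith
  have k9 : polyEval v chiChi = jet X x 9 := by
    have := (eq ho4).symm.trans (h1 (4, 4) (by decide) .one)
    rw [polyEval_smul, polyEval_append, polyEval_smul, hvar 9] at this
    push_cast at this
    linarith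
  have h2 := main (hvar 3) (hvar 4) (hvar 5) k6 k7 k8 k9
  have hm := Form.mixed_check
  simp only [Bool.and_eq_true] at hm
  obtain ⟨⟨hm1, hm2⟩, hm3⟩ := hm
  -- Second elimination: the `ψχ`-coefficients of `X_φ, X_y, X_u`.
  have k3 : polyEval v phiTop = jet X x 3 := by
    have := (eq hm1).symm.trans (h2 (4, 0) (by decide) .psi)
    rw [polyEval_smul, polyEval_append, polyEval_smul, hvar 3] at this
    push_cast at this
    linarith
  have k4 : polyEval v yTop = jet X x 4 := by
    have := (eq hm2).symm.trans (h2 (4, 1) (by decide) .psi)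
    rw [polyEval_smul, polyEval_append, polyEval_smul, hvar 4] at this
    push_cast at this
    linarith
  have k5 : polyEval v uTop = jet X x 5 := by
    have := (eq hm3).symm.trans (h2 (4, 2) (by decide) .psi)
    rw [polyEval_smul, polyEval_append, polyEval_smul, hvar 5] at this
    push_cast at this
    linarith
  have h3 := main k3 k4 k5 k6 k7 k8 k9
  have hl : ∀ {m a q}, m ∈ Form.usedPairs → polysEq (polySmul 32
      ((Form.fieldEq Form.topForm (Form.derivs Form.topForm) m.1 m.2).part a)) q = true →
      polyEval v q = 0 := by
    intro m a q hm h
    rw [← eq h, polyEval_smul]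
    exact mul_eq_zero_of_right _ (h3 m hm a)
  have l42 := hl (m := (4, 2)) (by decide) Form.linear42_check
  have l40 := hl (m := (4, 0)) (by decide) Form.linear40_check
  have l41 := hl (m := (4, 1)) (by decide) Form.linear41_check
  have l32c := hl (m := (3, 2)) (by decide) Form.linear32Chi_check
  have l32p := hl (m := (3, 2)) (by decide) Form.linear32Psi_check
  have l30c := hl (m := (3, 0)) (by decide) Form.linear30Chi_check
  have l30p := hl (m := (3, 0)) (by decide) Form.linear30Psi_check
  have l31c := hl (m := (3, 1)) (by decide) Form.linear31Chi_check
  have l31p := hl (m := (3, 1)) (by decide) Form.linear31Psi_check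
  -- Back substitution in the triangular system removes the powers of `u`.
  simp only [polyEval_append, polyEval_polyShift, l42, mul_zero, add_zero] at l40 l32c
  simp only [polyEval_append, polyEval_polyShift, l42, l40, l32c, mul_zero, add_zero]
    at l41 l32p l30c
  simp only [polyEval_append, polyEval_polyShift, l42, l40, l32c, l41, l32p, l30c, mul_zero,
    add_zero] at l30p l31c
  simp only [polyEval_append, polyEval_polyShift, l42, l40, l32c, l41, l32p, l30c, l30p, l31c,
    mul_zero, add_zero] at l31p
  have hB := Form.body_check
  simp only [Bool.and_eq_true] at hB
  obtain ⟨⟨⟨⟨⟨⟨b00, b10⟩, b20⟩, b02⟩, b12⟩, b22⟩, b21⟩ := hB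
  have hb' : ∀ {m q}, m ∈ Form.usedPairs → polysEq
      ((Form.fieldEq Form.genericForm (Form.derivs Form.genericForm) m.1 m.2).part .one) q = true →
      polyEval v q = 0 := fun hm h => (eq h).symm.trans (h1 _ hm .one)
  simp only [List.forall_mem_cons]
  exact ⟨l42, l40, l41, l32c, l32p, l30c, l30p, l31c, l31p,
    hb' (m := (0, 0)) (by decide) b00, hb' (m := (1, 0)) (by decide) b10,
    hb' (m := (2, 0)) (by decide) b20, hb' (m := (0, 2)) (by decide) b02,
    hb' (m := (1, 2)) (by decide) b12, hb' (m := (2, 2)) (by decide) b22,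
    hb' (m := (2, 1)) (by decide) b21, by simp⟩

end

end OSp

namespace OSp

/-! ### Consequences of the field equations at a point -/

section

variable {P : Params} {ξ : ℕ → ℝ} {u : ℝ}

/-- Suitable combinations of the nine equations have no inhomogeneous term, and the common factor
`K` appears; one of them carries an additional factor `b`, which is cancelled. -/
theorem omega_mul_eq_zero (ha : P.a = 1) (hb : P.b ≠ 0)
    (h42 : polyEval (P.env ξ u) linear42 = 0) (h40 : polyEval (P.env ξ u) linear40 = 0)
    (h41 : polyEval (P.env ξ u) linear41 = 0) (h32p : polyEval (P.env ξ u) linear32Psi = 0)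
    (h30p : polyEval (P.env ξ u) linear30Psi = 0) (h31p : polyEval (P.env ξ u) linear31Psi = 0) :
    (1 - P.k ^ 2 - P.b * P.A ^ 2 - 2 * (P.b * P.g)) * ξ 0 = 0 ∧
      (1 - P.k ^ 2 - P.b * P.A ^ 2 - 2 * (P.b * P.g)) * (ξ 1 + P.b * ξ 2) = 0 := by
  obtain ⟨g, a, b, A, k, D, hD⟩ := P
  simp only at ha hb ⊢
  subst ha
  simp only [linear42, linear40, linear41, linear32Psi, linear30Psi, linear31Psi, polyEval,
    monoEval, Params.env, pow_zero, pow_one, mul_one, one_mul] at h42 h40 h41 h32p h30p h31p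
  constructor
  · refine (mul_eq_zero.1 ?_).resolve_left hb
    linear_combination -1 / 16 * (b * (h32p + h41) + b ^ 2 * h42 + h31p
      - 2 * b * A * k * (ξ 1 + b * ξ 2) * hD)
  · linear_combination 1 / 4 * (h30p + b * h40 + 2 * k * (1 + k) * (ξ 1 + b * ξ 2) * hD)

/-- When `K = 0` the unknowns `ξ` can be eliminated altogether, which leaves polynomial conditions
on `k`, `b g` and `b A²`. Their solutions are the excluded undeformed point or violate `D (1 + b g)
= 1` or `g ≥ 0`. -/
theorem omega_false_of_eq_zero (ha : P.a = 1) (hb : P.b ≠ 0) (hg : 0 ≤ P.g)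
    (hdef : ¬(P.g = 0 ∧ P.A = 0 ∧ P.k ^ 2 = 1))
    (hK : 1 - P.k ^ 2 - P.b * P.A ^ 2 - 2 * (P.b * P.g) = 0)
    (h41 : polyEval (P.env ξ u) linear41 = 0) (h32c : polyEval (P.env ξ u) linear32Chi = 0)
    (h32p : polyEval (P.env ξ u) linear32Psi = 0) (h30c : polyEval (P.env ξ u) linear30Chi = 0)
    (h31c : polyEval (P.env ξ u) linear31Chi = 0) : False := by
  obtain ⟨g, a, b, A, k, D, hD⟩ := P
  simp only at ha hb hg hdef hK
  subst ha
  simp only [linear41, linear32Chi, linear32Psi, linear30Chi, linear31Chi, polyEval,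
    monoEval, Params.env, pow_zero, pow_one, mul_one, one_mul] at h41 h32c h32p h30c h31c
  have excl : b * g = 0 → k ^ 2 = 1 → False := fun ht hk => by
    have hA : b * A ^ 2 = 0 := by linear_combination -hK - hk - 2 * ht
    exact hdef ⟨(mul_eq_zero.1 ht).resolve_left hb,
      pow_eq_zero_iff two_ne_zero |>.1 ((mul_eq_zero.1 hA).resolve_left hb), hk⟩
  have hT : 1 + b * g ≠ 0 := fun h => by
    have : (0 : ℝ) = 1 := by linear_combination hD - D * h
    exact zero_ne_one this
  -- In `h32p - h41 - h30c` all `ξ` cancel.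
  have hC : (k - (1 + b * g)) * (k ^ 2 + 3 * k * (1 + b * g) + 2 * (1 + b * g)) = 0 := by
    linear_combination (1 + b * g) / 2 * (h32p - h41 - h30c)
      + (1 + b * g) * (2 * k - 2 * (1 + b * g)) * hK - k ^ 3 * hD
  rcases mul_eq_zero.1 hC with hk | hk
  · have hkD : k * D = 1 := by linear_combination hD + D * hk
    have h : k * (k - 1) = 0 := by
      linear_combination -1 / 12 * (h30c - (4 * A * ξ 1 - 4 * b * A * ξ 2 + 6 * k + 2 * k ^ 2) * hkD
        + (2 + 4 * k) * hK + (2 - 6 * k) * hk)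
    have hk0 : k ≠ 0 := fun h => by simp [h] at hkD
    have hk1 : k = 1 := by linear_combination (mul_eq_zero.1 h).resolve_left hk0
    exact excl (by linear_combination hk1 - hk) (by rw [hk1]; norm_num)
  · have hkD : k ^ 2 * D + 3 * k + 2 = 0 := by linear_combination D * hk - (3 * k + 2) * hD
    have ht : b * g * (3 * k + 2) = -(k + 1) * (k + 2) := by linear_combination hk
    -- A second condition free of `ξ`: the part of `h30c` containing `ξ 1 - b ξ 2` is cancelled
    -- against `b h32c + h31c`.
    have hQ : (1 + k) * (-6 * k - 6 * k ^ 2 + 6 * k ^ 2 * D + 4 * k ^ 3 + 2 * k ^ 3 * D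
        + 2 * (b * A ^ 2) + 4 * (b * A ^ 2) * k + 6 * (b * g) + 2 * (b * g) * k)
        - 2 * (b * A ^ 2) * (1 + 4 * k - 2 * k ^ 2 - k ^ 2 * D - 2 * (b * A ^ 2) - b * g) = 0 := by
      linear_combination (1 + k) * h30c
        - A / 2 * (b * h32c + h31c + 4 * k * (1 + k) * (ξ 1 - b * ξ 2) * hD)
    -- `D` is eliminated by `hkD` and `b A²` by `hK`; only `k` and `b g` remain.
    have hQ' : (1 + k) * (-2 * (k + 1) * (7 * k + 5) + (2 - 6 * k) * (b * g))
        - 2 * ((1 - k) * (1 + k) - 2 * (b * g)) * (1 + 7 * k + 3 * (b * g)) = 0 := by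
      linear_combination hQ - ((1 + k) * (6 + 2 * k) + 2 * (b * A ^ 2)) * hkD
        + ((1 + k) * (2 + 4 * k) - 2 * (3 + 7 * k - 2 * k ^ 2 - b * g)
          + 4 * (b * A ^ 2 + 1 - k ^ 2 - 2 * (b * g))) * hK
    -- Multiplication by `(3 k + 2) ^ 2` allows the elimination of `b g` through `ht`.
    have h : (k + 1) ^ 2 * (k * (4 * k + 3)) = 0 := by
      linear_combination -1 / 96 * ((3 * k + 2) ^ 2 * hQ' - (12 * ((3 * k + 2) * (b * g)
        - (k + 1) * (k + 2)) + 24 * k * (3 * k + 2)) * ht)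
    rcases mul_eq_zero.1 h with h | h
    · have hk1 : k = -1 := by
        have := pow_eq_zero_iff two_ne_zero |>.1 h
        linarith
      subst hk1
      exact excl (by linear_combination -ht) (by norm_num)
    · have hk0 : k ≠ 0 := fun h => hT (by rw [h] at hk; linear_combination hk / 2)
      have hk1 : k = -3 / 4 := by
        linear_combination 1 / 4 * (mul_eq_zero.1 h).resolve_left hk0
      subst hk1
      have ht' : b * g = 5 / 4 := by linear_combination -4 * ht
      have hA : b * A ^ 2 = -33 / 16 := by linear_combination -hK - 2 * ht'
      -- At `k = -3/4` the numbers `b g` and `b A²` have opposite signs, although their product is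
      -- nonnegative.
      have : 0 ≤ b ^ 2 * g * A ^ 2 := by positivity
      have h' : b ^ 2 * g * A ^ 2 = 5 / 4 * (-33 / 16) := by
        linear_combination b * A ^ 2 * ht' + 5 / 4 * hA
      linarith

/-- The hypotheses `he` and `hc` are what remains of two bosonic equations when `ξ 0` and `ξ 1 + b ξ
2` vanish identically. Together with two linear equations they lead to the undeformed point if `A =
0`, and force `A = 0` otherwise. -/
theorem omega_false_of_constant (ha : P.a = 1) (hb : P.b ≠ 0)
    (hdef : ¬(P.g = 0 ∧ P.A = 0 ∧ P.k ^ 2 = 1)) (h0 : ξ 0 = 0) (hS : ξ 1 + P.b * ξ 2 = 0)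
    (he : ξ 2 * (1 - P.k * P.D) + P.A / 4 = 0)
    (hc : 3 + P.k ^ 2 - 4 * P.k ^ 2 * P.D + P.b * P.A ^ 2 - 4 * (P.b * P.g) = 0)
    (h40 : polyEval (P.env ξ u) linear40 = 0) (h30c : polyEval (P.env ξ u) linear30Chi = 0) :
    False := by
  obtain ⟨g, a, b, A, k, D, hD⟩ := P
  simp only at ha hb hdef hS he hc
  subst ha
  simp only [linear40, linear30Chi, polyEval, monoEval, Params.env, h0, pow_zero, pow_one, mul_one,
    one_mul] at h40 h30c
  have h3 : -3 * k - k ^ 2 + k ^ 2 * D + 3 * k ^ 3 * D + b * g + 3 * (b * g) * k = 0 := by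
    linear_combination 1 / 6 * (h30c - (-4 * A + 4 * A * k * D) * hS - 8 * A * b * he - 4 * k * hc)
  -- `D` is the inverse of `1 + b g`, so `1 - (b g)² = 1`.
  have excl : D = 1 - b * g → g = 0 := fun h => by
    have : (b * g) ^ 2 = 0 := by rw [h] at hD; linear_combination -hD
    exact (mul_eq_zero.1 (pow_eq_zero_iff two_ne_zero |>.1 this)).resolve_left hb
  by_cases hA : A = 0
  · subst hA
    have h : (k - 1) * ((k - 1) * (k + 1)) = 0 := by
      linear_combination 1 / 3 * (4 * h3 + (1 + 3 * k) * hc)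
    have hk : k ^ 2 = 1 := by
      rcases mul_eq_zero.1 h with h | h
      · rw [sub_eq_zero.1 h]; norm_num
      · linear_combination h
    refine hdef ⟨excl ?_, rfl, hk⟩
    linear_combination -1 / 4 * hc + (1 / 4 - D) * hk
  -- After substitution of `he` and `hc` the equation `h40` is divisible by `A`, which may now be
  -- cancelled.
  · have hR : k - 3 * k ^ 2 * D - 3 * (b * g) + 2 = 0 := by
      refine (mul_eq_zero.1 ?_).resolve_left hA
      linear_combination 1 / 3 * (h40 - (-2 * A ^ 2 - 4 * g - 2 * g * k * D - 2 * g * k ^ 2 * D) * hS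
        - 4 * (1 + k) * he - 2 * k * (1 + k) * ξ 2 * hD) + 2 / 3 * A * hc
    have hk : k = 1 := by linear_combination -1 / 2 * (hR + 3 * (h3 + k * hR))
    subst hk
    have hD' : D = 1 - b * g := by linear_combination -1 / 3 * hR
    have hg := excl hD'
    subst hg
    have : b * A ^ 2 = 0 := by rw [hD'] at hc; linear_combination hc
    exact hA (pow_eq_zero_iff two_ne_zero |>.1 ((mul_eq_zero.1 this).resolve_left hb))

/-- For `a = 0` one has `D = 1`, and the factor `1 - k²` splits off from the equations for `ξ 2` and
then for `k`; it is cancelled. -/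
theorem flat_linear (ha : P.a = 0) (hb : P.b ^ 2 = 1)
    (h40 : polyEval (P.env ξ u) linear40 = 0) (h41 : polyEval (P.env ξ u) linear41 = 0)
    (h30c : polyEval (P.env ξ u) linear30Chi = 0) (hk : P.k ^ 2 ≠ 1) :
    P.k = 0 ∧ ξ 0 = 0 ∧ ξ 2 = 0 := by
  obtain ⟨g, a, b, A, k, D, hD⟩ := P
  simp only at ha hb hk ⊢
  subst ha
  have hD' : D = 1 := by linear_combination hD
  subst hD'
  simp only [linear40, linear41, linear30Chi, polyEval, monoEval, Params.env, pow_zero, pow_one,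
    mul_one, one_mul] at h40 h41 h30c
  have hk' : 1 - k ^ 2 ≠ 0 := fun h => hk (by linear_combination -h)
  have h2 : ξ 2 = 0 := by
    refine (mul_eq_zero.1 ?_).resolve_left hk'
    linear_combination 1 / 4 * h40
  have hk0 : k = 0 := by
    refine (mul_eq_zero.1 ?_).resolve_left hk'
    linear_combination -1 / 6 * (h30c - 4 * b * A * (1 - k) * h2)
  subst hk0
  exact ⟨rfl, by linear_combination -1 / 8 * h41, h2⟩

/-- Eliminating `ξ 2` from `h30p` and `h30c` yields `A² = 0`. Then `g` cannot vanish, and it is the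
coefficient of both unknowns. -/
theorem flat_neg_one (ha : P.a = 0) (hb : P.b ^ 2 = 1) (hk : P.k = -1)
    (hdef : ¬(P.g = 0 ∧ P.A = 0 ∧ P.k ^ 2 = 1))
    (h30c : polyEval (P.env ξ u) linear30Chi = 0) (h30p : polyEval (P.env ξ u) linear30Psi = 0)
    (h31p : polyEval (P.env ξ u) linear31Psi = 0) : ξ 0 = -3 / 4 ∧ ξ 2 = 0 := by
  obtain ⟨g, a, b, A, k, D, hD⟩ := P
  simp only at ha hb hk hdef ⊢
  subst ha hk
  have hD' : D = 1 := by linear_combination hD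
  subst hD'
  simp only [linear30Chi, linear30Psi, linear31Psi, polyEval, monoEval, Params.env, pow_zero,
    pow_one, mul_one, one_mul] at h30c h30p h31p
  have hA : A = 0 := by
    have h : A ^ 2 = 0 := by
      linear_combination b / 6 * (A * h30p + b / 4 * (A ^ 2 + 2 * g) * h30c) - A ^ 2 * hb
    exact pow_eq_zero_iff two_ne_zero |>.1 h
  subst hA
  have hg : g ≠ 0 := fun h => hdef ⟨h, rfl, by norm_num⟩
  constructor
  · refine mul_left_cancel₀ hg ?_
    linear_combination 1 / 8 * h31p - (8 * g * ξ 0 + 6 * g) / 8 * hb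
  · refine (mul_eq_zero.1 ?_).resolve_left hg
    linear_combination -1 / 4 * h30p - g * ξ 2 * hb

theorem flat_one (ha : P.a = 0) (hb : P.b ^ 2 = 1) (hk : P.k = 1)
    (h30p : polyEval (P.env ξ u) linear30Psi = 0) (h31p : polyEval (P.env ξ u) linear31Psi = 0) :
    ξ 2 * (P.A ^ 2 + 4 * P.g) = -(P.b * P.A) ∧
      ξ 0 * (4 * P.A ^ 2 + 16 * P.g) = -(3 * P.A ^ 2 + 6 * P.g) := by
  obtain ⟨g, a, b, A, k, D, hD⟩ := P
  simp only at ha hb hk ⊢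
  subst ha hk
  have hD' : D = 1 := by linear_combination hD
  subst hD'
  simp only [linear30Psi, linear31Psi, polyEval, monoEval, Params.env, pow_zero,
    pow_one, mul_one, one_mul] at h30p h31p
  constructor
  · linear_combination -1 / 2 * h30p - (A ^ 2 + 4 * g) * ξ 2 * hb
  · linear_combination h31p - (3 * A ^ 2 + 4 * A ^ 2 * ξ 0 + 16 * g * ξ 0 + 6 * g) * hb

end

end OSp

namespace OSp

/-! ### Solutions of the field equations -/

theorem Smooth.differentiableAt {U : Set (Fin 3 → ℝ)} (hU : IsOpen U) {f : SuperFun}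
    (hf : Smooth U f) {x : Fin 3 → ℝ} (hx : x ∈ U) (S : Finset ℕ) :
    DifferentiableAt ℝ (f S) x :=
  ((hf S).contDiffAt (hU.mem_nhds hx)).differentiableAt (by simp)

theorem fderiv_scale_mul' (W : ℤ) {h : (Fin 3 → ℝ) → ℝ} {x : Fin 3 → ℝ}
    (hd : DifferentiableAt ℝ h x) (v : Fin 3 → ℝ) :
    fderiv ℝ (fun y => scale W y * h y) x v =
      -W / 2 * v 0 * (scale W x * h x) + scale W x * fderiv ℝ h x v := by
  have hs : DifferentiableAt ℝ (scale W) x := (contDiff_scale W).differentiable (by simp) x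
  have h1 := fderiv_scale_mul W (fun _ => 1) 0 x (hasDerivAt_const _ _) v
  simp only [mul_one, mul_zero, add_zero] at h1
  have h2 : fderiv ℝ (fun y => scale W y * h y) x =
      scale W x • fderiv ℝ h x + h x • fderiv ℝ (scale W) x := fderiv_fun_mul hs hd
  rw [h2, _root_.add_apply, _root_.smul_apply,
    _root_.smul_apply, show fderiv ℝ (scale W) x v = _ from h1, smul_eq_mul,
    smul_eq_mul]
  ring

theorem fderiv_neg_scale_mul (W : ℤ) {h : (Fin 3 → ℝ) → ℝ} {x : Fin 3 → ℝ}
    (hd : DifferentiableAt ℝ h x) {v : Fin 3 → ℝ} (hv : v 0 = 0) :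
    fderiv ℝ (fun y => -(scale W y * h y)) x v = -(scale W x * fderiv ℝ h x v) := by
  rw [fderiv_fun_neg, _root_.neg_apply, fderiv_scale_mul' W hd, hv]
  ring

theorem fderiv_add_sub_scale_mul {f g h : (Fin 3 → ℝ) → ℝ} {x : Fin 3 → ℝ}
    (hf : DifferentiableAt ℝ f x) (hg : DifferentiableAt ℝ g x) (hh : DifferentiableAt ℝ h x)
    (c : ℝ) {v : Fin 3 → ℝ} (hv : v 0 = 0) :
    fderiv ℝ (fun y => f y + scale 4 y * (c * g y) - scale 2 y * h y) x v =
      fderiv ℝ f x v + scale 4 x * (c * fderiv ℝ g x v) - scale 2 x * fderiv ℝ h x v := by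
  have dsc := fun W => (contDiff_scale W).differentiable (by simp) x
  have m1 : DifferentiableAt ℝ (fun y => scale 4 y * (c * g y)) x :=
    (dsc 4).mul (hg.const_mul c)
  have m2 : DifferentiableAt ℝ (fun y => scale 2 y * h y) x := (dsc 2).mul hh
  rw [fderiv_fun_sub (hf.fun_add m1) m2, fderiv_fun_add hf m1, _root_.sub_apply,
    _root_.add_apply, fderiv_scale_mul' 4 (hg.const_mul c), fderiv_scale_mul' 2 hh,
    fderiv_const_mul hg, _root_.smul_apply, hv, smul_eq_mul]
  ring

theorem derivEven_of_scale {W : ℤ} {f : SuperFun} {S : Finset ℕ} {c : ℝ}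
    (hf : ∀ y, f S y = scale W y * c) (i : Fin 3) (x : Fin 3 → ℝ) :
    derivEven i f S x = -W / 2 * (Pi.single i 1 : Fin 3 → ℝ) 0 * (scale W x * c) := by
  rw [derivEven_apply_congr isOpen_univ (fun y _ => hf y) (Set.mem_univ x),
    fderiv_scale_mul' W (differentiableAt_const c)]
  simp

section

variable {P : Params} {U : Set (Fin 3 → ℝ)} {G M B : Ten2} {I X Z V : Vec} {Λ : SuperFun}
  {T : Ten2} {x : Fin 3 → ℝ}

theorem IsSolution.fieldEq_eq_zero (h : IsSolution U G M B I X Z Λ) (μ ν : Fin 5) :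
    EqOver U (fieldEq G M (flux B) X μ ν) 0 := fun S x hx => by
  have h1 := h.metric_eq μ ν S x hx
  have h2 := h.flux_eq μ ν S x hx
  simp only [coeff_eq, fieldEq, add_apply, sub_apply, smul_apply, zero_apply] at h1 h2 ⊢
  linarith

/-- Odd components of an even field have no leading coefficient, so to leading order with even
indices this is the ordinary Lie derivative in three dimensions. -/
theorem lieDeriv_empty (hU : IsOpen U) (hV : IsEvenField U V) (hx : x ∈ U) {μ ν : Fin 5}
    (hμ : μ.val < 3) (hν : ν.val < 3) : lieDeriv V T μ ν ∅ x =
      (pd μ (V 0) ∅ x * T 0 ν ∅ x + V 0 ∅ x * derivEven 0 (T μ ν) ∅ x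
        + pd ν (V 0) ∅ x * T μ 0 ∅ x)
      + (pd μ (V 1) ∅ x * T 1 ν ∅ x + V 1 ∅ x * derivEven 1 (T μ ν) ∅ x
        + pd ν (V 1) ∅ x * T μ 1 ∅ x)
      + (pd μ (V 2) ∅ x * T 2 ν ∅ x + V 2 ∅ x * derivEven 2 (T μ ν) ∅ x
        + pd ν (V 2) ∅ x * T μ 2 ∅ x) := by
  have hz : ∀ y ∈ U, V 3 ∅ y = 0 ∧ V 4 ∅ y = 0 := fun y hy =>
    ⟨hV.apply_eq_zero hy 3 ∅ (by decide), hV.apply_eq_zero hy 4 ∅ (by decide)⟩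
  have hp : ∀ μ : Fin 5, μ.val < 3 →
      par μ = 0 ∧ pd μ (V 3) ∅ x = 0 ∧ pd μ (V 4) ∅ x = 0 := by
    intro μ hμ
    fin_cases μ
    · exact ⟨rfl, derivEven_eq_zero hU (fun y hy => (hz y hy).1) hx 0,
        derivEven_eq_zero hU (fun y hy => (hz y hy).2) hx 0⟩
    · exact ⟨rfl, derivEven_eq_zero hU (fun y hy => (hz y hy).1) hx 1,
        derivEven_eq_zero hU (fun y hy => (hz y hy).2) hx 1⟩
    · exact ⟨rfl, derivEven_eq_zero hU (fun y hy => (hz y hy).1) hx 2,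
        derivEven_eq_zero hU (fun y hy => (hz y hy).2) hx 2⟩
    · exact absurd hμ (by decide)
    · exact absurd hμ (by decide)
  obtain ⟨m0, m3, m4⟩ := hp μ hμ
  obtain ⟨n0, n3, n4⟩ := hp ν hν
  have p0 : ∀ f, pd 0 f = derivEven 0 f := fun _ => rfl
  have p1 : ∀ f, pd 1 f = derivEven 1 f := fun _ => rfl
  have p2 : ∀ f, pd 2 f = derivEven 2 f := fun _ => rfl
  have q0 : par 0 = 0 := rfl
  have q1 : par 1 = 0 := rfl
  have q2 : par 2 = 0 := rfl
  simp only [lieDeriv, Fin.sum_univ_five, add_apply, smul_apply, mul_empty, m3, m4, n3, n4,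
    (hz x hx).1, (hz x hx).2, p0, p1, p2, m0, n0, q0, q1, q2, sgn]
  ring

theorem interior_empty (hV : IsEvenField U V) (hx : x ∈ U) (H : Ten3) (μ ν : Fin 5) :
    interior V H μ ν ∅ x =
      V 0 ∅ x * H 0 μ ν ∅ x + V 1 ∅ x * H 1 μ ν ∅ x + V 2 ∅ x * H 2 μ ν ∅ x := by
  have q0 : par 0 = 0 := rfl
  have q1 : par 1 = 0 := rfl
  have q2 : par 2 = 0 := rfl
  simp only [interior, Fin.sum_univ_five, add_apply, smul_apply, mul_empty,
    hV.apply_eq_zero hx 3 ∅ (by decide), hV.apply_eq_zero hx 4 ∅ (by decide), q0, q1, q2, sgn]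
  ring

theorem lower_empty (hV : IsEvenField U V) (hx : x ∈ U) (μ : Fin 5) :
    lower G V μ ∅ x = V 0 ∅ x * G 0 μ ∅ x + V 1 ∅ x * G 1 μ ∅ x + V 2 ∅ x * G 2 μ ∅ x := by
  have q0 : par 0 = 0 := rfl
  have q1 : par 1 = 0 := rfl
  have q2 : par 2 = 0 := rfl
  simp only [lower, Fin.sum_univ_five, add_apply, smul_apply, mul_empty,
    hV.apply_eq_zero hx 3 ∅ (by decide), hV.apply_eq_zero hx 4 ∅ (by decide), q0, q1, q2, sgn]
  ring

/-- The derivatives of `X_φ + u X_u` where it is constant. -/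
theorem derivEven_frame (hU : IsOpen U) (hX : IsEvenField U X) {c : ℝ}
    (hc : ∀ y ∈ U, jet X y 0 = c) (hx : x ∈ U) (i : Fin 3) :
    derivEven i (X 0) ∅ x + x 2 * derivEven i (X 2) ∅ x
      + (Pi.single i 1 : Fin 3 → ℝ) 2 * X 2 ∅ x = 0 := by
  have h0 := (hX 0).1.differentiableAt hU hx ∅
  have h2 := (hX 2).1.differentiableAt hU hx ∅
  have hp : HasFDerivAt (fun y : Fin 3 → ℝ => y 2)
      (ContinuousLinearMap.proj (R := ℝ) (φ := fun _ : Fin 3 => ℝ) 2) x := hasFDerivAt_apply 2 x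
  have h := h0.hasFDerivAt.add (hp.mul h2.hasFDerivAt)
  have he : (fun y => X 0 ∅ y + y 2 * X 2 ∅ y) =ᶠ[nhds x] fun _ => c :=
    Filter.eventually_of_mem (hU.mem_nhds hx) hc
  have h' := h.unique ((hasFDerivAt_const c x).congr_of_eventuallyEq he)
  have h'' := congrArg (fun L => L (Pi.single i 1)) h'
  simp at h''
  simp only [derivEven]
  linear_combination h''

/-- Mixed derivatives: `h` cannot be independent of `φ` when `∂_y h` is a nonzero multiple of an
exponential. -/
theorem eq_zero_of_mixed_deriv (hU : IsOpen U) {h : (Fin 3 → ℝ) → ℝ}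
    (hh : ContDiffOn ℝ (⊤ : ℕ∞) h U) (hx : x ∈ U) {W : ℤ} (hW : W ≠ 0) {c : ℝ}
    (h0 : ∀ y ∈ U, fderiv ℝ h y (Pi.single 0 1) = 0)
    (h1 : ∀ y ∈ U, fderiv ℝ h y (Pi.single 1 1) = scale W y * c) : c = 0 := by
  have hx' := hU.mem_nhds hx
  have hd : ContDiffAt ℝ 2 h x := mod_cast contDiffAt_infty.1 (hh.contDiffAt hx') 2
  have hs := (hd.isSymmSndFDerivAt (by simp)).eq
    (Pi.single 0 1 : Fin 3 → ℝ) (Pi.single 1 1 : Fin 3 → ℝ)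
  have hdd : DifferentiableAt ℝ (fderiv ℝ h) x :=
    (hd.fderiv_right (m := 1) (by norm_num)).differentiableAt (by simp)
  have key : ∀ v w, fderiv ℝ (fun y => fderiv ℝ h y w) x v = fderiv ℝ (fderiv ℝ h) x v w := by
    intro v w
    rw [fderiv_clm_apply hdd (differentiableAt_const w)]
    simp
  rw [← key, ← key, Filter.EventuallyEq.fderiv_eq (Filter.eventually_of_mem hx' h0),
    Filter.EventuallyEq.fderiv_eq (Filter.eventually_of_mem hx' h1),
    fderiv_scale_mul' W (differentiableAt_const c)] at hs
  have hs' := scale_ne_zero W x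
  have hW' : (W : ℝ) ≠ 0 := Int.cast_ne_zero.2 hW
  simpa [hs', hW'] using hs

/-- If `K = 0`, one point suffices. If `K ≠ 0`, the openness of `U` enters, since `ξ 0` has to be
differentiated. -/
theorem not_admits_of_omega (hb : IsBackground P G B) (ha : P.a = 1) (hb0 : P.b ≠ 0)
    (hg : 0 ≤ P.g) (hdef : ¬(P.g = 0 ∧ P.A = 0 ∧ P.k ^ 2 = 1)) (hU : IsOpen U)
    (hne : U.Nonempty) : ¬Admits U G B := by
  rintro ⟨M, I, X, Z, Λ, hM, -, hX, -, -, -, hs⟩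
  have hF := fun x hx => polyEval_eq_zero_of_fieldEq hb hM hU hX hs.fieldEq_eq_zero (x := x) hx
  simp only [List.forall_mem_cons] at hF
  by_cases hK : 1 - P.k ^ 2 - P.b * P.A ^ 2 - 2 * (P.b * P.g) = 0
  · obtain ⟨x, hx⟩ := hne
    obtain ⟨-, -, l41, l32c, l32p, l30c, -, l31c, -⟩ := hF x hx
    exact omega_false_of_eq_zero ha hb0 hg hdef hK l41 l32c l32p l30c l31c
  · have h0 : ∀ y ∈ U, jet X y 0 = 0 ∧ jet X y 1 + P.b * jet X y 2 = 0 := fun y hy => by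
      obtain ⟨l42, l40, l41, -, l32p, -, l30p, -, l31p, -⟩ := hF y hy
      obtain ⟨h1, h2⟩ := omega_mul_eq_zero ha hb0 l42 l40 l41 l32p l30p l31p
      exact ⟨(mul_eq_zero.1 h1).resolve_left hK, (mul_eq_zero.1 h2).resolve_left hK⟩
    obtain ⟨x, hx⟩ := hne
    obtain ⟨-, l40, -, -, -, l30c, -, -, -, b00, -, b20, b02, -, b22, -, -⟩ := hF x hx
    have d0 := derivEven_frame hU hX (fun y hy => (h0 y hy).1) hx 0
    have d2 := derivEven_frame hU hX (fun y hy => (h0 y hy).1) hx 2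
    have hj : jet X x 0 = 0 := (h0 x hx).1
    have hS := (h0 x hx).2
    have j2 : X 2 ∅ x = jet X x 2 := rfl
    have j10 : derivEven 0 (X 0) ∅ x = jet X x 10 := rfl
    have j12 : derivEven 0 (X 2) ∅ x = jet X x 12 := rfl
    have j16 : derivEven 2 (X 0) ∅ x = jet X x 16 := rfl
    have j18 : derivEven 2 (X 2) ∅ x = jet X x 18 := rfl
    rw [j10, j12] at d0
    rw [j16, j18, j2] at d2
    simp only [Pi.single_eq_same, Pi.single_apply, Fin.reduceEq, if_false, zero_mul, add_zero,
      one_mul] at d0 d2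
    have hD := P.hD
    rw [ha, one_mul] at hD
    -- Adding `u` times the equation `(2, 2)` to `(2, 0)` contracts the second index with `∂_φ + u
    -- ∂_u`; the derivatives then combine to those in `d2`. The equations `(0, 0)` and `(0, 2)` are
    -- used below with `d0` in the same way.
    have e : jet X x 2 * (1 - P.k * P.D) + P.A / 4 = 0 := by
      simp only [body20, body22, polyEval, monoEval, Params.env, ha, hj, pow_zero, pow_one,
        mul_one, one_mul] at b20 b22
      linear_combination -(b20 + x 2 * b22 - 2 * d2) + P.g / 2 * (1 + P.k * P.D) * hS
        - P.k / 2 * jet X x 2 * hD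
    refine omega_false_of_constant ha hb0 hdef hj hS e ?_ l40 l30c
    simp only [body00, body02, polyEval, monoEval, Params.env, ha, hj, pow_zero, pow_one,
      mul_one, one_mul] at b00 b02
    linear_combination -8 * (b00 + x 2 * b02 - 2 * d0) + 8 * x 2 * e
      - 4 * x 2 * P.g * (1 + P.k * P.D) * hS + 4 * x 2 * P.k * jet X x 2 * hD

/-! ### Killing equations and the backgrounds with `a = 0` -/

/-- The leading coefficient of the flux equation `dZ + I ⌟ H = 0` with the indices `y`, `u`. -/
theorem IsSolution.dZ_empty (hb : IsBackground P G B) (hM : IsInverse U G M)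
    (hU : IsOpen U) (hI : IsEvenField U I) (h : IsSolution U G M B I X Z Λ) (hx : x ∈ U) :
    derivEven 1 (Z 2) ∅ x - derivEven 2 (Z 1) ∅ x + I 0 ∅ x * (scale 2 x * P.k) = 0 := by
  have h := h.dZ_eq 1 2 ∅ x hx
  -- The connection is symmetric in the two even indices and drops out of the antisymmetrised
  -- derivative.
  have hΓ : ∀ s, christoffel G M s 1 2 ∅ x = christoffel G M s 2 1 ∅ x := fun s => by
    rw [(hb.rep_christoffel hM hU 0 s 1 2 x hx).1, (hb.rep_christoffel hM hU 0 s 2 1 x hx).1]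
    have : Form.gamma s 2 1 = Form.gamma s 1 2 := Form.sign_eq _ 0
    rw [this, add_comm (wt 1)]
  have h0 : flux B 0 1 2 ∅ x = scale 2 x * P.k := by
    have : Form.field 0 1 2 = [(.one, 1, [0, 0, 0, 0, 0, 0, 1])] := rfl
    rw [(hb.flux 0 x 0 1 2).1, this]
    simp [Form.eval_cons, Mask.elim, monoEval, Params.env, wt]
  have h1 : flux B 1 1 2 ∅ x = 0 := by
    have : Form.field 1 1 2 = [] := rfl
    rw [(hb.flux 0 x 1 1 2).1, this, Form.eval_nil, mul_zero]
  have h2 : flux B 2 1 2 ∅ x = 0 := by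
    have : Form.field 2 1 2 = [] := rfl
    rw [(hb.flux 0 x 2 1 2).1, this, Form.eval_nil, mul_zero]
  have q1 : par 1 = 0 := rfl
  have q2 : par 2 = 0 := rfl
  have p1 : ∀ f, pd 1 f = derivEven 1 f := fun _ => rfl
  have p2 : ∀ f, pd 2 f = derivEven 2 f := fun _ => rfl
  simp only [coeff_eq, add_apply, sub_apply, smul_apply, zero_apply, cov1, Fin.sum_univ_five,
    mul_empty, hΓ, interior_empty hI hx, h0, h1, h2, q1, q2, p1, p2, sgn] at h
  linear_combination h

/-- The backgrounds with `a = 0`, `κ = 1` and `A = 0` have no solution. -/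
theorem not_isSolution_of_flat (hb : IsBackground P G B) (ha : P.a = 0) (hb1 : P.b ^ 2 = 1)
    (hk : P.k = 1) (hg : P.g ≠ 0)
    (hB0 : ∀ y, B 0 0 ∅ y = 0) (hB1 : ∀ y, B 0 1 ∅ y = 0) (hB2 : ∀ y, B 1 1 ∅ y = 0)
    (hB3 : ∀ y, B 0 2 ∅ y = 0) (hB4 : ∀ y, B 2 1 ∅ y = scale 2 y * P.k)
    (hM : IsInverse U G M) (hU : IsOpen U) (hI : IsEvenField U I) (hX : IsEvenField U X)
    (hXZ : ∀ μ, EqOver U (X μ) (lower G I μ + Z μ))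
    (hX2 : ∀ y ∈ U, X 2 ∅ y = 0)
    (hX1 : ∀ y ∈ U, derivEven 2 (X 1) ∅ y = scale 2 y * (-3 / 4))
    (hne : U.Nonempty) : ¬IsSolution U G M B I X Z Λ := by
  intro h
  have gm := fun i j y => (rep_form_iff.1 (hb.metric 0 y i j)).1
  have G01 : ∀ y, G 0 1 ∅ y = scale 2 y * 0 := fun y => by
    rw [gm 0 1 y]
    simp [SPoly.entry, SPoly.metricTable, polyEval, monoEval, Params.env, wt, ha, SPoly.zero]
  have G10 : ∀ y, G 1 0 ∅ y = scale 2 y * 0 := fun y => by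
    rw [gm 1 0 y]
    simp [SPoly.entry, SPoly.metricTable, polyEval, monoEval, Params.env, wt, ha, SPoly.zero]
  have G02 : ∀ y, G 0 2 ∅ y = scale 0 y * 0 := fun y => by
    rw [gm 0 2 y]
    simp [SPoly.entry, SPoly.metricTable, polyEval, monoEval, Params.env, wt, ha, SPoly.zero]
  have G20 : ∀ y, G 2 0 ∅ y = scale 0 y * 0 := fun y => by
    rw [gm 2 0 y]
    simp [SPoly.entry, SPoly.metricTable, polyEval, monoEval, Params.env, wt, ha, SPoly.zero]
  have G11 : ∀ y, G 1 1 ∅ y = scale 4 y * (-P.g / 2) := fun y => by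
    rw [gm 1 1 y]
    simp [SPoly.entry, SPoly.metricTable, polyEval, monoEval, Params.env, wt, ha, hb1, SPoly.zero]
    ring
  have G12 : ∀ y, G 1 2 ∅ y = scale 2 y * 1 := fun y => by
    rw [gm 1 2 y]
    simp [SPoly.entry, SPoly.metricTable, polyEval, monoEval, Params.env, wt, ha, SPoly.zero]
  have G21 : ∀ y, G 2 1 ∅ y = scale 2 y * 1 := fun y => by
    rw [gm 2 1 y]
    simp [SPoly.entry, SPoly.metricTable, polyEval, monoEval, Params.env, wt, ha, SPoly.zero]
  have G22 : ∀ y, G 2 2 ∅ y = scale 0 y * 0 := fun y => by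
    rw [gm 2 2 y]
    simp [SPoly.entry, SPoly.metricTable, polyEval, monoEval, Params.env, wt, ha, SPoly.zero]
  have p0 : ∀ f, pd 0 f = derivEven 0 f := fun _ => rfl
  have p1 : ∀ f, pd 1 f = derivEven 1 f := fun _ => rfl
  have p2 : ∀ f, pd 2 f = derivEven 2 f := fun _ => rfl
  have hs := fun W x => scale_ne_zero W x
  -- Write `f = ∂_y I^y - I^φ`. The `uu` Killing equation gives `∂_u I^y = 0`; then the `yu` one
  -- gives `f + ∂_u I^u = 0`. With `∂_u X_y = -3/4 exp (-φ)` the equation for `dZ` gives `-f + 3/4 +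
  -- ∂_u I^u = 0`, so `f = 3/8`. The `yy` Killing equation turns this into the value of `∂_y I^u`.
  -- In the `φ, y` component of the Lie derivative of `B` only `B_{uy}` survives, which gives `∂_φ
  -- I^u = 0`.
  have key : ∀ x ∈ U, derivEven 0 (I 2) ∅ x = 0 ∧
      derivEven 1 (I 2) ∅ x = scale 2 x * (3 / 16 * P.g) := by
    intro x hx
    have kuu := h.killing_metric 2 2 ∅ x hx
    have kyu := h.killing_metric 1 2 ∅ x hx
    have kyy := h.killing_metric 1 1 ∅ x hx
    have kb := h.killing_bfield 0 1 ∅ x hx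
    simp only [coeff_eq, zero_apply] at kuu kyu kyy kb
    rw [lieDeriv_empty hU hI hx (by decide) (by decide)] at kuu kyu kyy kb
    simp only [p1, p2, G01, G10, G02, G20, G11, G12, G21, G22, derivEven_of_scale G22,
      derivEven_of_scale G11, derivEven_of_scale G12, Pi.single_eq_same, Pi.single_apply,
      Fin.reduceEq, if_false] at kuu kyu kyy
    have hB1' : ∀ y, B 0 1 ∅ y = scale 0 y * 0 := fun y => by simp [hB1]
    simp only [p0, p1, hB0, hB1, hB2, hB3, hB4, hk, derivEven_of_scale hB1'] at kb
    have hdZ := h.dZ_empty hb hM hU hI hx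
    have hZ : ∀ μ, ∀ y ∈ U, Z μ ∅ y = X μ ∅ y - lower G I μ ∅ y := fun μ y hy => by
      have := hXZ μ ∅ y hy
      simp only [coeff_eq, add_apply] at this
      linarith
    have hZ2 : ∀ y ∈ U, Z 2 ∅ y = -(scale 2 y * I 1 ∅ y) := fun y hy => by
      rw [hZ 2 y hy, lower_empty hI hy, hX2 y hy, G02, G12, G22]; ring
    have hZ1 : ∀ y ∈ U, Z 1 ∅ y =
        X 1 ∅ y + scale 4 y * (P.g / 2 * I 1 ∅ y) - scale 2 y * I 2 ∅ y := fun y hy => by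
      rw [hZ 1 y hy, lower_empty hI hy, G01, G11, G21]; ring
    have d1 := (hI 1).1.differentiableAt hU hx ∅
    have d2 := (hI 2).1.differentiableAt hU hx ∅
    have dX := (hX 1).1.differentiableAt hU hx ∅
    have e2 : derivEven 1 (Z 2) ∅ x = -(scale 2 x * derivEven 1 (I 1) ∅ x) := by
      refine (derivEven_apply_congr hU hZ2 hx 1).trans ?_
      refine (fderiv_neg_scale_mul 2 d1 (v := Pi.single 1 1) rfl).trans ?_
      rfl
    have e1 : derivEven 2 (Z 1) ∅ x = scale 2 x * (-3 / 4)
        + scale 4 x * (P.g / 2 * derivEven 2 (I 1) ∅ x) - scale 2 x * derivEven 2 (I 2) ∅ x := by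
      refine (derivEven_apply_congr hU hZ1 hx 2).trans ?_
      refine (fderiv_add_sub_scale_mul dX d1 d2 _ rfl).trans ?_
      rw [← hX1 x hx]
      rfl
    have s4 : scale 4 x = scale 2 x * scale 2 x := scale_add 2 2 x
    have s2 := hs 2 x
    rw [e1, e2, hk] at hdZ
    have iuu : derivEven 2 (I 1) ∅ x = 0 := by
      refine (mul_eq_zero.1 ?_).resolve_left s2
      linear_combination kuu / 2
    rw [iuu] at hdZ kyu
    have iyu : derivEven 1 (I 1) ∅ x - I 0 ∅ x + derivEven 2 (I 2) ∅ x = 0 := by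
      refine (mul_eq_zero.1 ?_).resolve_left s2
      push_cast at kyu
      linear_combination kyu
    have iZ : -derivEven 1 (I 1) ∅ x + 3 / 4 + derivEven 2 (I 2) ∅ x + I 0 ∅ x = 0 := by
      refine (mul_eq_zero.1 ?_).resolve_left s2
      linear_combination hdZ
    constructor
    · refine (mul_eq_zero.1 ?_).resolve_left s2
      linear_combination kb
    · refine mul_left_cancel₀ s2 ?_
      rw [s4] at kyy
      push_cast at kyy
      linear_combination kyy / 2 + scale 2 x * scale 2 x * P.g / 4 * (iyu - iZ)
  obtain ⟨x, hx⟩ := hne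
  have := eq_zero_of_mixed_deriv hU ((hI 2).1 ∅) hx (W := 2) (by norm_num)
    (fun y hy => (key y hy).1) (fun y hy => (key y hy).2)
  exact hg (by linarith)

/-- The cases are `k = 1`, `k = -1` and `k² ≠ 1`. In each `ξ 0` and `ξ 2` are constant on `U`, so a
bosonic equation becomes algebraic. The potential `B` itself, as opposed to its flux, matters only
for `k = 1`, where the Lie derivative of `B` is used. -/
theorem not_admits_of_flat (hb : IsBackground P G B) (ha : P.a = 0) (hb1 : P.b ^ 2 = 1)
    (hg : 0 ≤ P.g) (hdef : ¬(P.g = 0 ∧ P.A = 0 ∧ P.k ^ 2 = 1))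
    (hB0 : ∀ y, B 0 0 ∅ y = 0) (hB1 : P.A = 0 → ∀ y, B 0 1 ∅ y = 0) (hB2 : ∀ y, B 1 1 ∅ y = 0)
    (hB3 : ∀ y, B 0 2 ∅ y = 0) (hB4 : ∀ y, B 2 1 ∅ y = scale 2 y * P.k)
    (hU : IsOpen U) (hne : U.Nonempty) : ¬Admits U G B := by
  rintro ⟨M, I, X, Z, Λ, hM, hI, hX, -, -, hXZ, hs⟩
  have hF := fun x hx => polyEval_eq_zero_of_fieldEq hb hM hU hX hs.fieldEq_eq_zero (x := x) hx
  simp only [List.forall_mem_cons] at hF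
  have hD : P.D = 1 := by have := P.hD; rw [ha] at this; linear_combination this
  have j10 : ∀ x, derivEven 0 (X 0) ∅ x = jet X x 10 := fun _ => rfl
  have j12 : ∀ x, derivEven 0 (X 2) ∅ x = jet X x 12 := fun _ => rfl
  have j13 : ∀ x, derivEven 1 (X 0) ∅ x = scale 2 x * jet X x 13 := fun x =>
    (mul_div_cancel₀ _ (scale_ne_zero 2 x)).symm
  have j15 : ∀ x, derivEven 1 (X 2) ∅ x = scale 2 x * jet X x 15 := fun x =>
    (mul_div_cancel₀ _ (scale_ne_zero 2 x)).symm
  have j17 : ∀ x, derivEven 2 (X 1) ∅ x = scale 2 x * jet X x 17 := fun x =>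
    (mul_div_cancel₀ _ (scale_ne_zero 2 x)).symm
  by_cases hk : P.k ^ 2 = 1
  · rcases sq_eq_sq_iff_eq_or_eq_neg.1 (hk.trans (one_pow 2).symm) with hk | hk
    · have hq : P.A ^ 2 + 4 * P.g ≠ 0 := fun h => by
        have h1 : P.A ^ 2 = 0 := by nlinarith [sq_nonneg P.A]
        exact hdef ⟨by linarith, pow_eq_zero_iff two_ne_zero |>.1 h1, by rw [hk]; norm_num⟩
      have h0 : ∀ y ∈ U, jet X y 2 = -(P.b * P.A) / (P.A ^ 2 + 4 * P.g) ∧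
          jet X y 0 = -(3 * P.A ^ 2 + 6 * P.g) / (4 * (P.A ^ 2 + 4 * P.g)) := fun y hy => by
        obtain ⟨-, -, -, -, -, -, l30p, -, l31p, -⟩ := hF y hy
        obtain ⟨h2, h0⟩ := flat_one ha hb1 hk l30p l31p
        exact ⟨by rw [eq_div_iff hq, h2],
          by rw [eq_div_iff (mul_ne_zero four_ne_zero hq)]; linear_combination h0⟩
      -- Constancy of `ξ 0` and `ξ 2` kills `∂_y X_φ`. The equation `(1, 0)` then gives `A² ξ 2 =
      -- 0`, and `ξ 2 = 0` would also imply `A = 0` by the formula for `ξ 2`.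
      have hA : P.A = 0 := by
        obtain ⟨x, hx⟩ := hne
        obtain ⟨-, -, -, -, -, -, -, -, -, -, b10, -⟩ := hF x hx
        have d1 := derivEven_frame hU hX (fun y hy => (h0 y hy).2) hx 1
        have d2 : derivEven 1 (X 2) ∅ x = 0 := by
          rw [derivEven_apply_congr hU (fun y hy => (h0 y hy).1) hx]
          simp
        rw [d2, j13] at d1
        simp only [Pi.single_apply, Fin.reduceEq, if_false, zero_mul, mul_zero, add_zero] at d1
        have d1 := (mul_eq_zero.1 d1).resolve_left (scale_ne_zero 2 x)
        simp only [body10, polyEval, monoEval, Params.env, ha, hk, hD, d1, pow_zero, pow_one,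
          mul_one, one_mul] at b10
        have h2 := (eq_div_iff hq).1 (h0 x hx).1
        have h3 : P.A ^ 2 * jet X x 2 = 0 := by
          linear_combination h2 + 4 * b10 + 4 * P.g * jet X x 2 * hb1
        rcases mul_eq_zero.1 h3 with h3 | h3
        · exact pow_eq_zero_iff two_ne_zero |>.1 h3
        · rw [h3, zero_mul] at h2
          linear_combination P.b * h2 - P.A * hb1
      have hg0 : P.g ≠ 0 := fun h => hq (by rw [hA, h]; norm_num)
      have h0 : ∀ y ∈ U, jet X y 2 = 0 ∧ jet X y 0 = -3 / 8 := fun y hy => by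
        obtain ⟨h2, h0⟩ := h0 y hy
        rw [hA] at h2 h0
        exact ⟨by rw [h2]; simp, by rw [h0]; field_simp; ring⟩
      refine not_isSolution_of_flat hb ha hb1 hk hg0 hB0 (hB1 hA) hB2 hB3 hB4 hM hU hI hX hXZ
        (fun y hy => (h0 y hy).1) (fun y hy => ?_) hne hs
      rw [j17]
      obtain ⟨-, -, -, -, -, -, -, -, -, -, -, -, -, -, -, b21, -⟩ := hF y hy
      simp only [body21, polyEval, monoEval, Params.env, ha, hA, hk, hD, (h0 y hy).1,
        (h0 y hy).2, pow_zero, pow_one, mul_one, one_mul] at b21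
      congr 1
      linear_combination 1 / 2 * b21
    · have h0 : ∀ y ∈ U, jet X y 0 = -3 / 4 ∧ jet X y 2 = 0 := fun y hy => by
        obtain ⟨-, -, -, -, -, l30c, l30p, -, l31p, -⟩ := hF y hy
        exact flat_neg_one ha hb1 hk hdef l30c l30p l31p
      obtain ⟨x, hx⟩ := hne
      obtain ⟨-, -, -, -, -, -, -, -, -, -, -, -, -, b12, -⟩ := hF x hx
      obtain ⟨hj0, hj2⟩ := h0 x hx
      have d1 : derivEven 1 (X 2) ∅ x = 0 :=
        derivEven_eq_zero hU (fun y hy => (h0 y hy).2) hx 1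
      rw [j15] at d1
      have d1 := (mul_eq_zero.1 d1).resolve_left (scale_ne_zero 2 x)
      -- With all values inserted, the equation `(1, 2)` reads `3 = 0`.
      simp only [body12, polyEval, monoEval, Params.env, ha, hk, hD, hj0, hj2, d1, pow_zero,
        pow_one, mul_one, one_mul] at b12
      norm_num at b12
  · have h0 : ∀ y ∈ U, P.k = 0 ∧ jet X y 0 = 0 ∧ jet X y 2 = 0 := fun y hy => by
      obtain ⟨-, l40, l41, -, -, l30c, -⟩ := hF y hy
      exact flat_linear ha hb1 l40 l41 l30c hk
    obtain ⟨x, hx⟩ := hne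
    obtain ⟨-, -, -, -, -, -, -, -, -, b00, -, -, b02, -⟩ := hF x hx
    obtain ⟨hk0, hj0, hj2⟩ := h0 x hx
    have d0 := derivEven_frame hU hX (fun y hy => (h0 y hy).2.1) hx 0
    rw [j10, j12] at d0
    simp only [Pi.single_apply, Fin.reduceEq, if_false, zero_mul, add_zero] at d0
    simp only [body00, body02, polyEval, monoEval, Params.env, ha, hk0, hD, hj0, hj2, pow_zero,
      pow_one, mul_one, one_mul] at b00 b02
    -- Contraction with `∂_φ + u ∂_u` again removes the derivatives; only the constant of the
    -- equation `(0, 0)` survives.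
    have : (3 : ℝ) / 8 = 0 := by linear_combination -b00 - x 2 * b02 + 2 * d0
    norm_num at this

end

end OSp

namespace OSp

/-! ### The backgrounds have no solutions -/

theorem not_admits_omega (η w A κ : ℝ) (hw : w ≠ 0) (h : 1 + w * η ^ 2 ≠ 0)
    (hdef : ¬(η = 0 ∧ A = 0 ∧ κ ^ 2 = 1)) {U : Set (Fin 3 → ℝ)} (hU : IsOpen U)
    (hne : U.Nonempty) : ¬Admits U (metricOmega w η) (bfieldOmega w A κ) :=
  not_admits_of_omega (isBackground_omega η w A κ h) rfl hw (sq_nonneg η)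
    (fun ⟨h1, h2, h3⟩ => hdef ⟨pow_eq_zero_iff two_ne_zero |>.1 h1, h2, h3⟩) hU hne

theorem not_admits_II (η ε A κ : ℝ) (hε : ε ^ 2 = 1)
    (hdef : ¬(η = 0 ∧ A = 0 ∧ κ ^ 2 = 1)) {U : Set (Fin 3 → ℝ)} (hU : IsOpen U)
    (hne : U.Nonempty) : ¬Admits U (metricI η) (bfieldII ε A κ) := by
  refine not_admits_of_flat (isBackground_II η ε A κ hε) rfl hε (sq_nonneg η)
    (fun ⟨h1, h2, h3⟩ => hdef ⟨pow_eq_zero_iff two_ne_zero |>.1 h1, h2, h3⟩) (fun y => ?_)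
    (fun h y => ?_) (fun y => ?_) (fun y => ?_) (fun y => ?_) hU hne
  · simp [bfieldII, ofTwoForm]
  · simp [bfieldII, ofTwoForm, show A = 0 from h]
  · simp [bfieldII, ofTwoForm]
  · simp [bfieldII, ofTwoForm]
  · simp [bfieldII, ofTwoForm, paramsI, mul_comm]

theorem not_admits_I (η ε A κ : ℝ) (hε : ε ^ 2 = 1)
    (hdef : ¬(η = 0 ∧ A = 0 ∧ κ ^ 2 = 1)) {U : Set (Fin 3 → ℝ)} (hU : IsOpen U)
    (hne : U.Nonempty) : ¬Admits U (metricI η) (bfieldI ε A κ) := by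
  refine not_admits_of_flat (isBackground_I η ε A κ hε) rfl ((neg_sq ε).trans hε) (sq_nonneg η)
    (fun ⟨h1, h2, h3⟩ => hdef ⟨pow_eq_zero_iff two_ne_zero |>.1 h1, h2, h3⟩) (fun y => ?_)
    (fun h y => ?_) (fun y => ?_) (fun y => ?_) (fun y => ?_) hU hne
  · simp [bfieldI, ofTwoForm]
  · simp [bfieldI, ofTwoForm, show A = 0 from h]
  · simp [bfieldI, ofTwoForm]
  · simp [bfieldI, ofTwoForm]
  · simp [bfieldI, ofTwoForm, paramsI, mul_comm]

end OSp

theorem mainTheorem4 (η A κ : ℝ) (hdef : ¬ (η = 0 ∧ A = 0 ∧ κ ^ 2 = 1)) :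
    (OSp.IsMetric (OSp.metricI η) ∧
      ∀ ε : ℝ, (ε = 1 ∨ ε = -1) → ∀ U : Set (Fin 3 → ℝ), IsOpen U → U.Nonempty →
        ¬ OSp.Admits U (OSp.metricI η) (OSp.bfieldI ε A κ) ∧
        ¬ OSp.Admits U (OSp.metricI η) (OSp.bfieldII ε A κ)) ∧
    (∀ ω : ℝ, ω ≠ 0 → 1 + ω * η ^ 2 ≠ 0 →
      OSp.IsMetric (OSp.metricOmega ω η) ∧
      ∀ U : Set (Fin 3 → ℝ), IsOpen U → U.Nonempty →
        ¬ OSp.Admits U (OSp.metricOmega ω η) (OSp.bfieldOmega ω A κ)) := by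
  refine ⟨⟨(OSp.isBackground_II η 1 A κ (by norm_num)).isMetric, fun ε hε U hU hne => ?_⟩,
    fun ω hω h => ⟨(OSp.isBackground_omega η ω A κ h).isMetric, fun U hU hne =>
      OSp.not_admits_omega η ω A κ hω h hdef hU hne⟩⟩
  have hε : ε ^ 2 = 1 := by rcases hε with rfl | rfl <;> norm_num
  exact ⟨OSp.not_admits_I η ε A κ hε hdef hU hne, OSp.not_admits_II η ε A κ hε hdef hU hne⟩
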